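/- Let $(M,g)$ be an oriented smooth Riemannian surface with boundary. Let $\pi\colon SM\to M$ be its unit tangent bundle, $v\mapsto v_\perp$ the rotation by $+\pi/2$ in the tangent planes, $\nu$ the inward unit normal of $\partial M$, $\kappa$ the Gauss curvature, $\varphi_t(x,v)=(\gamma_{x,v}(t),\dot\gamma_{x,v}(t))$ the geodesic flow, and $$\partial_+SM=\{(x,v)\in SM:\ x\in\partial M,\ \langle v,\nu_x\rangle>0\}.$$ Let $\tau(x,v)$ be the first time $t>0$ with $\gamma_{x,v}(t)\in\partial M$. Assume that $M$ is non-trapping (every unit speed geodesic issued from an interior point reaches $\partial M$, and $\tau$ is bounded on the unit vectors over the interior of $M$) and that $\partial M$ is strictly convex (its second fundamental form is positive definite). For $(x,v)\in SM$ over the interior $M^\circ$ put $F(x,v)=\varphi_{-\tau(x,-v)}(x,v)\in\partial_+SM$, and let $$\mathcal C_{F_*}=\{(\eta,\,dF|_{(x,v)}^T\eta):\ (x,v)\in SM,\ x\in M^\circ,\ \eta\in T^*_{F(x,v)}(\partial_+SM)\setminus\{0\}\}\subset T^*(\partial_+SM)\times T^*(SM),$$ $$\mathcal C_{\pi^*}=\{(d\pi|_{(x,v)}^T\omega,\,\omega):\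 (x,v)\in SM,\ x\in M^\circ,\ \omega\in T^*_xM\setminus\{0\}\}\subset T^*(SM)\times T^*M$$ be the canonical relations of the push-forward $F_*$ and the pull-back $\pi^*$ (so that the geodesic X-ray transform on functions is $I_0=F_*\circ\pi^*$). For $(x,v)\in\partial_+SM$ let $V_{(x,v)}=\frac{d}{ds}\big|_{s=0}(x,(\cos s)v+(\sin s)v_\perp)$, let $T_{(x,v)}$ be $\langle v,\nu_x\rangle^{-1}$ times the horizontal lift of $-(\nu_x)_\perp$ to $T_{(x,v)}(SM)$, and let $(V^\flat,T^\flat)$ be the co-frame of $T^*_{(x,v)}(\partial_+SM)$ dual to the basis $(V,T)$ of $T_{(x,v)}(\partial_+SM)$. Let $a=a(x,v,t)$ and $b=b(x,v,t)$ solve, for $0\le t<\tau(x,v)$, $$\ddot a+\kappa(\gamma_{x,v}(t))\,a=0,\quad \ddot b+\kappa(\gamma_{x,v}(t))\,b=0,\qquad a(0)=1,\ \dot a(0)=0,\quad b(0)=0,\ \dot b(0)=1.$$ Then the composition $\mathcal C_{F_*}\circ\mathcal C_{\pi^*}\subset T^*(\partial_+SM)\times T^*M$ is $$\mathcal C_{F_*}\circ\mathcal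 C_{\pi^*}=\{(\lambda\,\eta_{x,v,t},\ \lambda\,\omega_{x,v,t}):\ (x,v)\in\partial_+SM,\ t\in(0,\tau(x,v)),\ \lambda\in\mathbb R\setminus\{0\}\},$$ where $$\eta_{x,v,t}=b(x,v,t)\,V^\flat_{(x,v)}-a(x,v,t)\,T^\flat_{(x,v)}\in T^*_{(x,v)}(\partial_+SM),\qquad \omega_{x,v,t}=(\dot\gamma_{x,v}(t)_\perp)^\flat=\langle\dot\gamma_{x,v}(t)_\perp,\cdot\rangle\in T^*_{\gamma_{x,v}(t)}M.$$ -/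

import Mathlib

open Bundle Manifold Set
open scoped ContDiff Topology

noncomputable section

namespace RiemSurface

/-- The model vector space `ℝ²` of the surface and of its tangent planes. -/
abbrev Plane : Type := EuclideanSpace ℝ (Fin 2)

/-- The standard basis vectors of the model plane. -/
def stdVec (i : Fin 2) : Plane := EuclideanSpace.single i 1

/- Throughout, `M` is a smooth surface with boundary (modelled on the closed half plane
`{y : ℝ² | 0 ≤ y 0}`) whose tangent planes carry inner products. Mathlib represents `T_x M` as the
model plane, a vector being given by its coordinates in the preferred chart `extChartAt (𝓡∂ 2) x`
at `x`; likewise `T_p (TM)`, `p = (x, v)`, is represented as `Plane × Plane`, a vector being given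
by its coordinates (base, fibre) in the chart of `TM` induced by the preferred chart at `x`. In
that chart `p` itself has coordinates `(extChartAt (𝓡∂ 2) x x, v)`. -/
variable {M : Type*} [TopologicalSpace M] [ChartedSpace (EuclideanHalfSpace 2) M]
  [IsManifold (𝓡∂ 2) ∞ M]

/-- The tangent bundle `TM`. -/
abbrev TM (M : Type*) [TopologicalSpace M] [ChartedSpace (EuclideanHalfSpace 2) M] : Type _ :=
  TangentBundle (𝓡∂ 2) M

/-- The tangent plane `T_x M`. -/
abbrev TanM (x : M) : Type := TangentSpace (𝓡∂ 2) x

/-- The tangent space `T_p (TM)` of the tangent bundle. -/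
abbrev TanTM (p : TM M) : Type := TangentSpace (𝓡∂ 2).tangent p

instance factFinrank (x : M) : Fact (Module.finrank ℝ (TanM x) = 2) :=
  ⟨finrank_euclideanSpace_fin (𝕜 := ℝ) (n := 2)⟩

/-- The tangent line `T_x ∂M` at a boundary point `x`: in the preferred chart, the boundary is
the line `y 0 = 0`. -/
def boundaryLine (x : M) : Submodule ℝ (TanM x) :=
  LinearMap.ker (EuclideanSpace.proj 0 : Plane →L[ℝ] ℝ).toLinearMap

variable [RiemannianBundle (fun x : M => TangentSpace (𝓡∂ 2) x)]

/-! ### Levi-Civita connection and curvature in charts -/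

/-- The metric in the preferred chart at `x₀`: `g_y(u, w)` where `y` is a point of the chart and
`u`, `w` are coordinate vectors. -/
def metricCoord (x₀ : M) (y u w : Plane) : ℝ :=
  inner ℝ
    ((trivializationAt Plane (TangentSpace (𝓡∂ 2) : M → Type) x₀).symm
      ((extChartAt (𝓡∂ 2) x₀).symm y) u)
    ((trivializationAt Plane (TangentSpace (𝓡∂ 2) : M → Type) x₀).symm
      ((extChartAt (𝓡∂ 2) x₀).symm y) w)

/-- The matrix `g_{ij}(y)` in the preferred chart at `x₀`. -/
def gram (x₀ : M) (y : Plane) : Matrix (Fin 2) (Fin 2) ℝ :=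
  Matrix.of fun i j => metricCoord x₀ y (stdVec i) (stdVec j)

/-- The directional derivative `∂_z (g(u, w))` at `y`, for constant coordinate vectors `u`, `w`;
at boundary points it is the derivative from within the half plane. -/
def dMetric (x₀ : M) (y z u w : Plane) : ℝ :=
  fderivWithin ℝ (fun y' => metricCoord x₀ y' u w) (range (𝓡∂ 2)) y z

/-- The Christoffel symbols in the preferred chart at `x₀`:
`Γ(u, w)^k = ½ g^{kl} (∂_u g(w, e_l) + ∂_w g(u, e_l) - ∂_l g(u, w))`. -/
def christoffel (x₀ : M) (y u w : Plane) : Plane :=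
  ∑ k, (∑ l, (gram x₀ y)⁻¹ k l * ((1 / 2) *
    (dMetric x₀ y u w (stdVec l) + dMetric x₀ y w u (stdVec l) - dMetric x₀ y (stdVec l) u w)))
      • stdVec k

/-- The Christoffel symbols at `x`, in the preferred chart at `x` itself. For constant coordinate
vector fields `U`, `W` with values `u`, `w` this is `∇_U W (x)`. -/
def christoffelAt (x : M) (u w : TanM x) : TanM x :=
  christoffel x (extChartAt (𝓡∂ 2) x x) u w

/-- The curvature `R(u, w) z = ∇_u ∇_w z - ∇_w ∇_u z` on constant coordinate vectors, at `x`. -/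
def curvatureAt (x : M) (u w z : TanM x) : TanM x :=
  let y := extChartAt (𝓡∂ 2) x x
  fderivWithin ℝ (fun y' => christoffel x y' w z) (range (𝓡∂ 2)) y u
    - fderivWithin ℝ (fun y' => christoffel x y' u z) (range (𝓡∂ 2)) y w
    + christoffel x y u (christoffel x y w z) - christoffel x y w (christoffel x y u z)

/-- The Gauss curvature `κ = g(R(e₀, e₁) e₁, e₀) / det g`. -/
def gaussCurvature (x : M) : ℝ :=
  inner ℝ (curvatureAt x (stdVec 0) (stdVec 1) (stdVec 1)) (stdVec 0 : TanM x)
    / (gram x (extChartAt (𝓡∂ 2) x x)).det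

/-! ### Boundary: inner unit normal and convexity -/

/-- The gradient at `x` of the chart coordinate `y 0`. -/
def gradBoundaryCoord (x : M) : TanM x :=
  ∑ k, (gram x (extChartAt (𝓡∂ 2) x x))⁻¹ k 0 • (stdVec k : TanM x)

/-- The inward unit normal `ν_x` at a boundary point `x`: there `y 0` vanishes on the boundary and
is positive inside, so `ν_x` is its normalized gradient. -/
def innerNormal (x : M) : TanM x := ‖gradBoundaryCoord x‖⁻¹ • gradBoundaryCoord x

/-- The second fundamental form of `∂M` with respect to the inward normal, `II(u, w) =
g(∇_U W, ν)` for `U`, `W` tangent to `∂M` (here the constant coordinate fields extending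
`u, w ∈ T_x ∂M`). It is positive for the boundary of a round disk. -/
def secondFundamentalForm (x : M) (u w : TanM x) : ℝ :=
  inner ℝ (christoffelAt x u w) (innerNormal x)

/-- The boundary is strictly convex: its second fundamental form is positive definite. -/
def StrictlyConvexBoundary (M : Type*) [TopologicalSpace M]
    [ChartedSpace (EuclideanHalfSpace 2) M] [IsManifold (𝓡∂ 2) ∞ M]
    [RiemannianBundle (fun x : M => TangentSpace (𝓡∂ 2) x)] : Prop :=
  ∀ x ∈ (𝓡∂ 2).boundary M, ∀ w ∈ boundaryLine x, w ≠ 0 → 0 < secondFundamentalForm x w w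

/-! ### Unit tangent bundle and geodesic flow -/

/-- The unit tangent bundle `SM`. -/
def unitTangent (M : Type*) [TopologicalSpace M] [ChartedSpace (EuclideanHalfSpace 2) M]
    [IsManifold (𝓡∂ 2) ∞ M] [RiemannianBundle (fun x : M => TangentSpace (𝓡∂ 2) x)] :
    Set (TM M) :=
  {p | ‖p.2‖ = 1}

/-- The inward boundary `∂₊SM` of `SM`. -/
def influx (M : Type*) [TopologicalSpace M] [ChartedSpace (EuclideanHalfSpace 2) M]
    [IsManifold (𝓡∂ 2) ∞ M] [RiemannianBundle (fun x : M => TangentSpace (𝓡∂ 2) x)] :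
    Set (TM M) :=
  {p | p ∈ unitTangent M ∧ p.1 ∈ (𝓡∂ 2).boundary M ∧ 0 < inner ℝ p.2 (innerNormal p.1)}

/-- The horizontal lift to `T_p (TM)`, `p = (x, v)`, of a vector `w ∈ T_x M`. -/
def horizontalLift (p : TM M) (w : TanM p.1) : TanTM p :=
  ((w, -christoffelAt p.1 w p.2) : Plane × Plane)

/-- The vertical lift to `T_p (TM)`, `p = (x, v)`, of a vector `w ∈ T_x M`: the velocity of
`s ↦ (x, v + s w)` at `s = 0`. -/
def verticalLift (p : TM M) (w : TanM p.1) : TanTM p := ((0, w) : Plane × Plane)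

/-- The geodesic vector field `X`; its integral curves are `t ↦ (γ(t), γ̇(t))`, `γ` a geodesic. -/
def geodesicField (p : TM M) : TanTM p := horizontalLift p p.2

/-- `c` is the lift `t ↦ (γ(t), γ̇(t))` to `TM` of a geodesic of `M` defined (at least) for the
times between `0` and `t`, with initial data `p`. -/
def IsGeodesicFrom (p : TM M) (t : ℝ) (c : ℝ → TM M) : Prop :=
  c 0 = p ∧ IsMIntegralCurveOn c geodesicField (uIcc 0 t)

open Classical in
/-- The geodesic flow `φ_t(p)`, for `t` of any sign; its value is `p` if the geodesic with initial
data `p` does not exist in `M` up to time `t`. -/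
def geodesicFlow (t : ℝ) (p : TM M) : TM M :=
  if h : ∃ c, IsGeodesicFrom p t c then h.choose t else p

/-- The positive times at which the geodesic with initial data `p` is at the boundary. -/
def hitTimes (p : TM M) : Set ℝ :=
  {t | 0 < t ∧ ∃ c, IsGeodesicFrom p t c ∧ (c t).1 ∈ (𝓡∂ 2).boundary M}

/-- The exit time `τ(p)`: the first positive time at which the geodesic with initial data `p` is
at the boundary. -/
def exitTime (p : TM M) : ℝ := sInf (hitTimes p)

/-- `M` is non-trapping: all unit speed geodesics issued from interior points reach the boundary,
and their exit times are bounded. -/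
def NonTrapping (M : Type*) [TopologicalSpace M] [ChartedSpace (EuclideanHalfSpace 2) M]
    [IsManifold (𝓡∂ 2) ∞ M] [RiemannianBundle (fun x : M => TangentSpace (𝓡∂ 2) x)] : Prop :=
  ∃ B : ℝ, ∀ p ∈ unitTangent M, p.1 ∈ (𝓡∂ 2).interior M →
    (hitTimes p).Nonempty ∧ exitTime p ≤ B

/-- The base point map `F(x, v) = φ_{-τ(x, -v)}(x, v)`. -/
def baseMap (p : TM M) : TM M := geodesicFlow (-exitTime (⟨p.1, -p.2⟩ : TM M)) p

/-! ### Tangent and cotangent spaces of `SM` and `∂₊SM` -/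

/-- `T_p SM ⊆ T_p (TM)`, the kernel of the differential of `(x, v) ↦ |v|²`. -/
def tangentSM (p : TM M) : Submodule ℝ (TanTM p) :=
  LinearMap.ker
    (mfderiv (𝓡∂ 2).tangent 𝓘(ℝ, ℝ) (fun q : TM M => ‖q.2‖ ^ 2) p).toLinearMap

/-- The differential at `p` of the projection `TM → M`. -/
def dProj (p : TM M) : TanTM p →ₗ[ℝ] TanM p.1 :=
  (mfderiv (𝓡∂ 2).tangent (𝓡∂ 2) (fun q : TM M => q.1) p).toLinearMap

/-- `T_p (∂₊SM) ⊆ T_p (TM)`: the vectors of `T_p SM` whose projection to `M` is tangent to the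
boundary. -/
def tangentInflux (p : TM M) : Submodule ℝ (TanTM p) :=
  tangentSM p ⊓ (boundaryLine p.1).comap (dProj p)

/-- The cotangent bundle `T*M`. -/
abbrev CotM (M : Type*) [TopologicalSpace M] [ChartedSpace (EuclideanHalfSpace 2) M] : Type _ :=
  Σ x : M, Module.Dual ℝ (TanM x)

/-- The cotangent bundle `T*(SM)`. -/
abbrev CotSM (M : Type*) [TopologicalSpace M] [ChartedSpace (EuclideanHalfSpace 2) M]
    [IsManifold (𝓡∂ 2) ∞ M] [RiemannianBundle (fun x : M => TangentSpace (𝓡∂ 2) x)] : Type _ :=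
  Σ p : unitTangent M, Module.Dual ℝ (tangentSM p.1)

/-- The cotangent bundle `T*(∂₊SM)`. -/
abbrev CotInflux (M : Type*) [TopologicalSpace M] [ChartedSpace (EuclideanHalfSpace 2) M]
    [IsManifold (𝓡∂ 2) ∞ M] [RiemannianBundle (fun x : M => TangentSpace (𝓡∂ 2) x)] : Type _ :=
  Σ p : influx M, Module.Dual ℝ (tangentInflux p.1)

/-! ### The canonical relations -/

/-- The canonical relation of the pull-back `π^*`: the pairs `(dπ_p^T ξ, ξ)`, for `p = (x, v) ∈ SM`
over the interior of `M` and `ξ ∈ T_x^* M` nonzero. -/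
def canonicalPullback (M : Type*) [TopologicalSpace M] [ChartedSpace (EuclideanHalfSpace 2) M]
    [IsManifold (𝓡∂ 2) ∞ M] [RiemannianBundle (fun x : M => TangentSpace (𝓡∂ 2) x)] :
    SetRel (CotSM M) (CotM M) :=
  {c | ∃ (p : unitTangent M) (ξ : Module.Dual ℝ (TanM p.1.1)),
    p.1.1 ∈ (𝓡∂ 2).interior M ∧ ξ ≠ 0 ∧
    c = (⟨p, ξ ∘ₗ dProj p.1 ∘ₗ (tangentSM p.1).subtype⟩, ⟨p.1.1, ξ⟩)}

/-- The canonical relation of the push-forward `F_*`: the pairs `(η, dF_p^T η)`, for `p ∈ SM` over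
the interior of `M` and `η ∈ T^*_{F(p)} (∂₊SM)` nonzero. Here `dF_p : T_p SM → T_{F(p)} (∂₊SM)` is
the restriction to `T_p SM` of a derivative `D` of `F` within `SM` at `p`. -/
def canonicalPushforward (M : Type*) [TopologicalSpace M]
    [ChartedSpace (EuclideanHalfSpace 2) M] [IsManifold (𝓡∂ 2) ∞ M]
    [RiemannianBundle (fun x : M => TangentSpace (𝓡∂ 2) x)] :
    SetRel (CotInflux M) (CotSM M) :=
  {c | ∃ (p : unitTangent M) (hF : baseMap p.1 ∈ influx M)
      (η : Module.Dual ℝ (tangentInflux (baseMap p.1))) (D : TanTM p.1 →L[ℝ] TanTM (baseMap p.1))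
      (hD : ∀ Y ∈ tangentSM p.1, D.toLinearMap Y ∈ tangentInflux (baseMap p.1)),
    p.1.1 ∈ (𝓡∂ 2).interior M ∧ η ≠ 0 ∧
    HasMFDerivWithinAt (𝓡∂ 2).tangent (𝓡∂ 2).tangent baseMap (unitTangent M) p.1 D ∧
    c = (⟨⟨baseMap p.1, hF⟩, η⟩, ⟨p, η ∘ₗ D.toLinearMap.restrict hD⟩)}

/-! ### Orientation, the frame `(V, T)` of `∂₊SM`, and the Jacobi equation -/

/-- The rotation `v ↦ v_⊥` by `+π/2` in the oriented tangent plane `T_x M`. -/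
def perp (o : ∀ x : M, Orientation ℝ (TanM x) (Fin 2)) (x : M) (v : TanM x) : TanM x :=
  (o x).rightAngleRotation v

/-- The orientations of the tangent planes form an orientation of the surface: they depend
continuously on the point, in the sense that the rotation by `+π/2` is continuous on `TM`. -/
def IsSurfaceOrientation (o : ∀ x : M, Orientation ℝ (TanM x) (Fin 2)) : Prop :=
  Continuous fun p : TM M => (⟨p.1, perp o p.1 p.2⟩ : TM M)

/-- The generator `V` of the rotations of the fibres of `SM`, that is, the velocity at `s = 0` of
`s ↦ (x, cos s • v + sin s • v_⊥)`. -/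
def frameV (o : ∀ x : M, Orientation ℝ (TanM x) (Fin 2)) (p : TM M) : TanTM p :=
  verticalLift p (perp o p.1 p.2)

/-- The vector `T_{(x,v)} = ⟨v, ν_x⟩⁻¹ ∇_T`, with `∇_T` the horizontal lift of `-(ν_x)_⊥`. -/
def frameT (o : ∀ x : M, Orientation ℝ (TanM x) (Fin 2)) (p : TM M) : TanTM p :=
  (inner ℝ p.2 (innerNormal p.1))⁻¹ • horizontalLift p (-perp o p.1 (innerNormal p.1))

/-- `y` solves the scalar Jacobi equation `ÿ + κ(γ(t)) y = 0` along the geodesic with initial data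
`p`, for `0 ≤ t < τ(p)`, with `y(0) = y₀` and `ẏ(0) = y₁`. -/
def IsScalarJacobi (p : TM M) (y₀ y₁ : ℝ) (y : ℝ → ℝ) : Prop :=
  ∃ y' : ℝ → ℝ, y 0 = y₀ ∧ y' 0 = y₁ ∧
    ∀ t ∈ Ico 0 (exitTime p),
      HasDerivWithinAt y (y' t) (Ico 0 (exitTime p)) t ∧
      HasDerivWithinAt y' (-(gaussCurvature (geodesicFlow t p).1 * y t)) (Ico 0 (exitTime p)) t

/-- The covector `u^♭ = g(u, ·)`. -/
def flat {x : M} (u : TanM x) : Module.Dual ℝ (TanM x) := innerₛₗ ℝ u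

/-- The set of the pairs `(l η_{x,v,t}, l ω_{x,v,t})`, for `p = (x, v) ∈ ∂₊SM`, `0 < t < τ(x, v)`
and `l ≠ 0`, where `η_{x,v,t} = b V^♭ - a T^♭` and `ω_{x,v,t} = (γ̇(t)_⊥)^♭`. Here `(V^♭, T^♭)` is
the coframe dual to the basis `e = (V, T)` of `T_p (∂₊SM)`. -/
def jacobiRelation (o : ∀ x : M, Orientation ℝ (TanM x) (Fin 2)) :
    SetRel (CotInflux M) (CotM M) :=
  {c | ∃ (p : influx M) (t l : ℝ) (a b : ℝ → ℝ) (e : Module.Basis (Fin 2) ℝ (tangentInflux p.1)),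
    t ∈ Ioo 0 (exitTime p.1) ∧ l ≠ 0 ∧
    IsScalarJacobi p.1 1 0 a ∧ IsScalarJacobi p.1 0 1 b ∧
    (e 0 : TanTM p.1) = frameV o p.1 ∧ (e 1 : TanTM p.1) = frameT o p.1 ∧
    c = (⟨p, l • (b t • e.coord 0 - a t • e.coord 1)⟩,
      ⟨(geodesicFlow t p.1).1,
        l • flat (perp o (geodesicFlow t p.1).1 (geodesicFlow t p.1).2)⟩)}

end RiemSurface

end

open RiemSurface

open Bundle Manifold Set
open scoped ContDiff Topology

/-! The base point map F is constant along geodesics, and this determines the composition. Let q ∈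
∂₊SM and p = (x, v) = φ_t(q), and suppose dF_p^T η = dπ_p^T ω. The geodesic field X at p is killed
by dF_p and sent to v by dπ, so ω(v) = 0, and in dimension two ω = λ (v_⊥)^♭. The relation becomes
η(dF_p Y) = λ ⟨v_⊥, dπ Y⟩ for all Y ∈ T_p SM. Since dF_p maps T_p SM onto T_q(∂₊SM) with kernel
spanned by X, this fixes η: its value on Y₀ is λ times the normal component j(t) = ⟨v_⊥, dπ Y⟩ of
any preimage Y of Y₀. Modulo X such a preimage is dφ_t Y₀, so j is the normal component of a Jacobi
field and j'' + κ j = 0, where j(0) = ⟨v_⊥, dπ Y₀⟩ and j'(0) is the v_⊥-component of the vertical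
part of Y₀, both taken at q. The data (j, j')(0) are (0, 1) for Y₀ = V and (-1, 0) for Y₀ = T,
whence j = b and j = -a, and η = λ (b V^♭ - a T^♭). The same identity read backwards gives the other
inclusion.

The geometric core is `IsChartMetric.hasDerivWithinAt_jacobi`, transported to the surface by
`exists_hasDerivWithinAt_jacobiComp` and combined with F in `IsEntering.exists_jacobi`.

The analytic difficulty is that F must be differentiated along geodesics issued from the boundary,
where the geodesic spray is only defined on one side. The spray is extended by reflection
(`exists_contDiffAt_extension`), and the C¹ flow of the extension (`exists_isLocalFlow`) is
transverse to the boundary at an inward vector. Hence near the boundary F is a projection along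
trajectories (`IsLocalFlow.exists_footpoint`), whose derivative inverts the linearized flow on
vectors tangent to the boundary. In the interior F is invariant under the flow, so flow boxes carry
its derivative along the geodesic (`exists_flow_box`), and connectedness of the time interval gives
it at all times (`IsEntering.exists_surjective`). All this takes place in TM;
`IsBaseDeriv.mem_tangentInflux_iff` and `eqOn_tangentSM` restrict the result to SM. -/

namespace RiemSurface

noncomputable section

/-! ### Flows of C¹ vector fields and their dependence on the initial value -/

section Flow

open Metric NNReal

variable {E : Type*} [NormedAddCommGroup E] [NormedSpace ℝ E]

/-- A two-sided Grönwall bound for a curve vanishing at time `0`. -/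
theorem norm_le_of_norm_deriv_le_of_apply_zero {u u' : ℝ → E} {ε C e : ℝ} (hC : 0 < C) (he : 0 ≤ e)
    (hu : ∀ t ∈ Ioo (-ε) ε, HasDerivAt u (u' t) t) (h0 : u 0 = 0)
    (hb : ∀ t ∈ Ioo (-ε) ε, ‖u' t‖ ≤ C * ‖u t‖ + e) :
    ∀ t ∈ Ioo (-ε) ε, ‖u t‖ ≤ e / C * Real.exp (C * ε) := by
  have key : ∀ (w w' : ℝ → E), (∀ t ∈ Ioo (-ε) ε, HasDerivAt w (w' t) t) → w 0 = 0 →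
      (∀ t ∈ Ioo (-ε) ε, ‖w' t‖ ≤ C * ‖w t‖ + e) → ∀ t ∈ Ico 0 ε,
        ‖w t‖ ≤ e / C * Real.exp (C * ε) := by
    intro w w' hw hw0 hwb t ht
    have hsub : ∀ s ∈ Icc 0 t, s ∈ Ioo (-ε) ε := fun s hs =>
      ⟨by linarith [hs.1, ht.1, ht.2], by linarith [hs.2, ht.2]⟩
    have := norm_le_gronwallBound_of_norm_deriv_right_le (f := w) (f' := w') (δ := 0) (K := C)
      (ε := e) (a := 0) (b := t)
      (fun s hs => (hw s (hsub s hs)).continuousAt.continuousWithinAt)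
      (fun s hs => (hw s (hsub s (Ico_subset_Icc_self hs))).hasDerivWithinAt) (by simp [hw0])
      (fun s hs => hwb s (hsub s (Ico_subset_Icc_self hs))) t ⟨ht.1, le_rfl⟩
    refine this.trans ?_
    rw [gronwallBound_of_K_ne_0 hC.ne']
    simp only [zero_mul, zero_add, sub_zero]
    have h1 : Real.exp (C * t) ≤ Real.exp (C * ε) := Real.exp_le_exp.2 (by gcongr; exact ht.2.le)
    have h2 : 0 ≤ e / C := by positivity
    nlinarith
  intro t ht
  rcases le_or_gt 0 t with h | h
  · exact key u u' hu h0 hb t ⟨h, ht.2⟩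
  · have hneg : ∀ s ∈ Ioo (-ε) ε, -s ∈ Ioo (-ε) ε := fun s hs =>
      ⟨by linarith [hs.2], by linarith [hs.1]⟩
    have := key (fun s => u (-s)) (fun s => -u' (-s)) (fun s hs => by
      simpa [Function.comp_def] using (hu (-s) (hneg s hs)).scomp s (hasDerivAt_neg s)) (by simp [h0])
      (fun s hs => by simpa using hb (-s) (hneg s hs)) (-t) ⟨by linarith, by linarith [ht.1]⟩
    simpa using this

/-- A function which is continuously differentiable near a compact convex set is uniformly
differentiable there. -/
theorem exists_forall_norm_sub_sub_le {f : E → E} {s : Set E} (hs : IsCompact s) (hsc : Convex ℝ s)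
    (hf : ∀ x ∈ s, ContDiffAt ℝ 1 f x) {η : ℝ} (hη : 0 < η) :
    ∃ δ > 0, ∀ x ∈ s, ∀ y ∈ s, dist y x < δ →
      ‖f y - f x - fderiv ℝ f x (y - x)‖ ≤ η * ‖y - x‖ := by
  have hc : ContinuousOn (fderiv ℝ f) s := fun x hx =>
    ((hf x hx).continuousAt_fderiv one_ne_zero).continuousWithinAt
  have hu := hs.uniformContinuousOn_of_continuous hc
  obtain ⟨δ, hδ, h⟩ := Metric.uniformContinuousOn_iff.1 hu η hη
  refine ⟨δ, hδ, fun x hx y hy hxy => ?_⟩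
  have hconv : Convex ℝ (s ∩ ball x δ) := hsc.inter (convex_ball x δ)
  exact hconv.norm_image_sub_le_of_norm_hasFDerivWithin_le' (f := f) (f' := fderiv ℝ f)
    (φ := fderiv ℝ f x)
    (fun z hz => ((hf z hz.1).differentiableAt one_ne_zero).hasFDerivAt.hasFDerivWithinAt)
    (fun z hz => by
      rw [← dist_eq_norm]; exact (h z hz.1 x hx hz.2).le)
    ⟨hx, mem_ball_self hδ⟩ ⟨hy, hxy⟩

/-- `φ` is a flow of the vector field `f` near `z₀`, for the times in `(-ε, ε)` and the initial
values in a ball, with values in the open set `U` on which `f` is Lipschitz continuous, and `A`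
is its derivative with respect to the initial value. -/
structure IsLocalFlow (f : E → E) (z₀ : E) (U : Set E) (r ε : ℝ) (φ : E → ℝ → E)
    (A : E → ℝ → E →L[ℝ] E) : Prop where
  isOpen : IsOpen U
  lipschitz : ∃ K : ℝ≥0, LipschitzOnWith K f U
  r_pos : 0 < r
  ε_pos : 0 < ε
  apply_zero : ∀ z ∈ ball z₀ r, φ z 0 = z
  mem : ∀ z ∈ ball z₀ r, ∀ t ∈ Ioo (-ε) ε, φ z t ∈ U
  hasDerivAt : ∀ z ∈ ball z₀ r, ∀ t ∈ Ioo (-ε) ε, HasDerivAt (φ z) (f (φ z t)) t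
  hasFDerivAt : ∀ z ∈ ball z₀ r, ∀ t ∈ Ioo (-ε) ε, HasFDerivAt (fun w => φ w t) (A z t) z
  deriv_zero : ∀ z ∈ ball z₀ r, A z 0 = ContinuousLinearMap.id ℝ E
  hasDerivAt_deriv : ∀ z ∈ ball z₀ r, ∀ t ∈ Ioo (-ε) ε,
    HasDerivAt (A z) (fderiv ℝ f (φ z t) ∘L A z t) t
  continuousOn : ContinuousOn (Function.uncurry φ) (ball z₀ r ×ˢ Ioo (-ε) ε)
  hasStrictFDerivAt : HasStrictFDerivAt (Function.uncurry φ)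
    (ContinuousLinearMap.fst ℝ E ℝ + (ContinuousLinearMap.snd ℝ E ℝ).smulRight (f z₀)) (z₀, 0)

/-- Picard–Lindelöf in the space of operators, on the unit ball around the identity. Operators there
have norm at most 2, so the field is bounded by 2C, and `2 * C * ε ≤ 1` keeps the solution in the
ball for the whole time interval. -/
theorem exists_linear_flow [FiniteDimensional ℝ E] {L : ℝ → E →L[ℝ] E} {ε C : ℝ} (hε : 0 < ε)
    (hC : 0 ≤ C) (hεC : 2 * C * ε ≤ 1) (hL : ContinuousOn L (Icc (-ε) ε))
    (hb : ∀ t ∈ Icc (-ε) ε, ‖L t‖ ≤ C) :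
    ∃ A : ℝ → E →L[ℝ] E, A 0 = ContinuousLinearMap.id ℝ E ∧
      ∀ t ∈ Ioo (-ε) ε, HasDerivAt A (L t ∘L A t) t := by
  have : CompleteSpace E := FiniteDimensional.complete ℝ E
  have h0 : (0 : ℝ) ∈ Icc (-ε) ε := ⟨by linarith, hε.le⟩
  have hpl : IsPicardLindelof (fun t (B : E →L[ℝ] E) => L t ∘L B) (⟨0, h0⟩ : Icc (-ε) ε)
      (ContinuousLinearMap.id ℝ E) 1 0 (⟨2 * C, by positivity⟩) ⟨C, hC⟩ := by
    refine ⟨fun t ht => ?_, fun B hB => ?_, fun t ht B hB => ?_, ?_⟩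
    · refine LipschitzOnWith.of_dist_le_mul fun B hB B' hB' => ?_
      rw [dist_eq_norm, dist_eq_norm, ← ContinuousLinearMap.comp_sub]
      exact (ContinuousLinearMap.opNorm_comp_le _ _).trans
        (mul_le_mul_of_nonneg_right (hb t ht) (norm_nonneg _))
    · exact (ContinuousLinearMap.compL ℝ E E E).flip B |>.continuous.comp_continuousOn hL
    · have h1 : ‖B‖ ≤ 2 := by
        have h2 : ‖B - ContinuousLinearMap.id ℝ E‖ ≤ 1 := by simpa [dist_eq_norm] using hB
        have h3 : ‖ContinuousLinearMap.id ℝ E‖ ≤ 1 := ContinuousLinearMap.norm_id_le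
        have := norm_le_norm_sub_add B (ContinuousLinearMap.id ℝ E)
        linarith
      calc ‖L t ∘L B‖ ≤ ‖L t‖ * ‖B‖ := ContinuousLinearMap.opNorm_comp_le _ _
        _ ≤ C * 2 := mul_le_mul (hb t ht) h1 (norm_nonneg _) hC
        _ = _ := by rw [mul_comm]; rfl
    · simp only [sub_zero, zero_sub, neg_neg, max_self, NNReal.coe_one, NNReal.coe_zero]
      exact hεC
  obtain ⟨A, hA0, hA⟩ := hpl.exists_eq_forall_mem_Icc_hasDerivWithinAt₀
  exact ⟨A, hA0, fun t ht => (hA t (Ioo_subset_Icc_self ht)).hasDerivAt (Icc_mem_nhds ht.1 ht.2)⟩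

/-- A continuously differentiable vector field has a local flow, which depends differentiably on
the initial value. -/
theorem exists_isLocalFlow [FiniteDimensional ℝ E] {f : E → E} {z₀ : E} (hf : ContDiffAt ℝ 1 f z₀)
    {V : Set E} (hV : V ∈ 𝓝 z₀) :
    ∃ U ⊆ V, ∃ r ε φ A, IsLocalFlow f z₀ U r ε φ A := by
  have : CompleteSpace E := FiniteDimensional.complete ℝ E
  have : ProperSpace E := FiniteDimensional.proper ℝ E
  obtain ⟨K, W, hW, hlip⟩ := hf.exists_lipschitzOnWith
  obtain ⟨ρ, hρ, hρV⟩ := Metric.mem_nhds_iff.1 (Filter.inter_mem (Filter.inter_mem hV hW)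
    (hf.eventually (by simp)))
  set s := closedBall z₀ (ρ / 2) with hs
  have hsU : s ⊆ ball z₀ ρ := closedBall_subset_ball (by linarith)
  have hsc : IsCompact s := isCompact_closedBall _ _
  have hfs : ∀ x ∈ s, ContDiffAt ℝ 1 f x := fun x hx => (hρV (hsU hx)).2
  obtain ⟨L, hL⟩ := hsc.exists_bound_of_continuousOn
    (fun x hx => (hfs x hx).continuousAt.continuousWithinAt)
  obtain ⟨C, hC⟩ := hsc.exists_bound_of_continuousOn (f := fderiv ℝ f)
    (fun x hx => ((hfs x hx).continuousAt_fderiv one_ne_zero).continuousWithinAt)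
  have hz₀s : z₀ ∈ s := mem_closedBall_self (by positivity)
  set L₁ := max L 1
  set C₁ := max C 1
  have hL₁ : 0 < L₁ := lt_max_of_lt_right one_pos
  have hC₁ : 0 < C₁ := lt_max_of_lt_right one_pos
  -- The first bound keeps trajectories that start within ρ/4 of z₀ inside the ball `s` of radius
  -- ρ/2; the second is what `exists_linear_flow` asks for the variational equation.
  obtain ⟨ε, hε, hεL, hεC⟩ : ∃ ε > 0, L₁ * ε ≤ ρ / 4 ∧ 2 * C₁ * ε ≤ 1 := by
    refine ⟨min (ρ / 4 / L₁) (1 / (2 * C₁)), by positivity, ?_, ?_⟩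
    · calc L₁ * _ ≤ L₁ * (ρ / 4 / L₁) := by gcongr; exact min_le_left _ _
        _ = ρ / 4 := by field_simp
    · calc 2 * C₁ * _ ≤ 2 * C₁ * (1 / (2 * C₁)) := by gcongr; exact min_le_right _ _
        _ = 1 := by field_simp
  classical
  -- The solution produced by Picard–Lindelöf is not known in advance to stay in `s`. The field cut
  -- off by zero is bounded everywhere, so the speed bound confines the solution to `s`, where the
  -- cut-off field is `f` again.
  set fc : E → E := s.indicator f with hfc
  have hfc_eq : ∀ x ∈ s, fc x = f x := fun x hx => indicator_of_mem hx f
  have hfc_le : ∀ x, ‖fc x‖ ≤ L₁ := by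
    intro x
    by_cases hx : x ∈ s
    · rw [hfc_eq x hx]; exact (hL x hx).trans (le_max_left _ _)
    · rw [hfc, indicator_of_notMem hx]; simpa using hL₁.le
  have h0 : (0 : ℝ) ∈ Icc (-ε) ε := ⟨by linarith, hε.le⟩
  have h0' : (0 : ℝ) ∈ Ioo (-ε) ε := ⟨by linarith, hε⟩
  have hpl : IsPicardLindelof (fun _ => fc) (⟨0, h0⟩ : Icc (-ε) ε) z₀ ⟨ρ / 2, by positivity⟩
      ⟨ρ / 4, by positivity⟩ ⟨L₁, hL₁.le⟩ K := by
    refine IsPicardLindelof.of_time_independent (fun x _ => hfc_le x) ?_ ?_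
    · intro x hx y hy
      rw [hfc_eq x hx, hfc_eq y hy]
      exact hlip (hρV (hsU hx)).1.2 (hρV (hsU hy)).1.2
    · simp only [sub_zero, zero_sub, neg_neg, max_self]
      exact hεL.trans (by change ρ / 4 ≤ ρ / 2 - ρ / 4; linarith)
  obtain ⟨φ, hφ, L', hL'⟩ := hpl.exists_forall_mem_closedBall_eq_hasDerivWithinAt_lipschitzOnWith
  have hball : ∀ z ∈ ball z₀ (ρ / 4), z ∈ closedBall z₀ ((⟨ρ / 4, by positivity⟩ : ℝ≥0) : ℝ) :=
    fun z hz => ball_subset_closedBall hz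
  have hφ0 : ∀ z ∈ ball z₀ (ρ / 4), φ z 0 = z := fun z hz => (hφ z (hball z hz)).1
  have hφs : ∀ z ∈ ball z₀ (ρ / 4), ∀ t ∈ Icc (-ε) ε, φ z t ∈ s := by
    intro z hz t ht
    have := (convex_Icc (-ε) ε).norm_image_sub_le_of_norm_hasDerivWithin_le
      (hφ z (hball z hz)).2 (fun t _ => hfc_le _) h0 ht
    rw [hφ0 z hz, sub_zero] at this
    have h2 : ‖t‖ ≤ ε := abs_le.2 ht
    have h3 : L₁ * ‖t‖ ≤ ρ / 4 := le_trans (by gcongr) hεL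
    have h4 : dist z z₀ < ρ / 4 := hz
    rw [hs, mem_closedBall]
    calc dist (φ z t) z₀ ≤ dist (φ z t) z + dist z z₀ := dist_triangle _ _ _
      _ ≤ ρ / 2 := by rw [dist_eq_norm]; linarith
  have hφd : ∀ z ∈ ball z₀ (ρ / 4), ∀ t ∈ Ioo (-ε) ε, HasDerivAt (φ z) (f (φ z t)) t := by
    intro z hz t ht
    rw [← hfc_eq _ (hφs z hz t (Ioo_subset_Icc_self ht))]
    exact ((hφ z (hball z hz)).2 t (Ioo_subset_Icc_self ht)).hasDerivAt (Icc_mem_nhds ht.1 ht.2)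
  have hA : ∀ z, ∃ A : ℝ → E →L[ℝ] E, z ∈ ball z₀ (ρ / 4) → A 0 = ContinuousLinearMap.id ℝ E ∧
      ∀ t ∈ Ioo (-ε) ε, HasDerivAt A (fderiv ℝ f (φ z t) ∘L A t) t := by
    intro z
    by_cases hz : z ∈ ball z₀ (ρ / 4)
    swap
    · exact ⟨0, fun h => absurd h hz⟩
    obtain ⟨A, hA⟩ := exists_linear_flow (L := fun t => fderiv ℝ f (φ z t)) hε hC₁.le hεC
      (fun t ht => (ContinuousAt.comp_continuousWithinAt (g := fderiv ℝ f)
        ((hfs _ (hφs z hz t ht)).continuousAt_fderiv one_ne_zero)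
        ((hφ z (hball z hz)).2 t ht).continuousWithinAt))
      (fun t ht => (hC _ (hφs z hz t ht)).trans (le_max_left _ _))
    exact ⟨A, fun _ => hA⟩
  choose A hA using hA
  have hcont : ContinuousOn (Function.uncurry φ) (ball z₀ (ρ / 4) ×ˢ Ioo (-ε) ε) :=
    continuousOn_prod_of_continuousOn_lipschitzOnWith _ L'
      (fun z hz t ht => (hφd z hz t ht).continuousAt.continuousWithinAt)
      (fun t ht => (hL' t (Ioo_subset_Icc_self ht)).mono hball)
  refine ⟨ball z₀ ρ, fun x hx => (hρV hx).1.1, ρ / 4, ε, φ, A, isOpen_ball,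
    ⟨K, hlip.mono fun x hx => (hρV hx).1.2⟩, by positivity, hε, hφ0,
    fun z hz t ht => hsU (hφs z hz t (Ioo_subset_Icc_self ht)), hφd, ?_,
    fun z hz => (hA z hz).1, fun z hz => (hA z hz).2, hcont, ?_⟩
  · intro z hz t ht
    rw [hasFDerivAt_iff_isLittleO, Asymptotics.isLittleO_iff]
    intro c hc
    -- Chosen so that the Grönwall constant below turns η into c; `L' + 1` instead of `L'` avoids
    -- dividing by zero.
    set η := c / ((L' + 1) / C₁ * Real.exp (C₁ * ε)) with hη
    have hη0 : 0 < η := by positivity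
    obtain ⟨δ, hδ, hδ'⟩ := exists_forall_norm_sub_sub_le hsc (convex_closedBall _ _) hfs hη0
    have hnear : ∀ᶠ w in 𝓝 z, w ∈ ball z₀ (ρ / 4) ∧ L' * dist w z < δ := by
      refine Filter.Eventually.and (isOpen_ball.mem_nhds hz) ?_
      have : Filter.Tendsto (fun w => L' * dist w z) (𝓝 z) (𝓝 (L' * dist z z)) :=
        (continuous_const.mul (continuous_id.dist continuous_const)).tendsto z
      rw [dist_self, mul_zero] at this
      exact this.eventually (gt_mem_nhds hδ)
    filter_upwards [hnear] with w ⟨hw, hwz⟩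
    have hd : ∀ t ∈ Icc (-ε) ε, dist (φ w t) (φ z t) ≤ L' * dist w z := fun t ht =>
      (hL' t ht).dist_le_mul _ (hball w hw) _ (hball z hz)
    -- The error of the linear approximation satisfies the variational equation up to the Taylor
    -- remainder of `f`. That remainder is at most η times the distance of the two trajectories,
    -- uniformly in time, and the distance is at most L' ‖w - z‖.
    have hbound := norm_le_of_norm_deriv_le_of_apply_zero (ε := ε) (C := C₁)
      (e := η * (L' * ‖w - z‖)) hC₁ (by positivity)
      (u := fun s => φ w s - φ z s - A z s (w - z))
      (u' := fun s => f (φ w s) - f (φ z s) - (fderiv ℝ f (φ z s) ∘L A z s) (w - z))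
      (fun s hs' => ((hφd w hw s hs').sub (hφd z hz s hs')).sub
        (((hA z hz).2 s hs').clm_apply (hasDerivAt_const s (w - z)) |>.congr_deriv (by simp)))
      (by simp [hφ0 w hw, hφ0 z hz, (hA z hz).1])
      (fun s hs' => by
        have hs'' := Ioo_subset_Icc_self hs'
        have h1 := hδ' _ (hφs z hz s hs'') _ (hφs w hw s hs'') ((hd s hs'').trans_lt hwz)
        have h2 : f (φ w s) - f (φ z s) - (fderiv ℝ f (φ z s) ∘L A z s) (w - z)
            = fderiv ℝ f (φ z s) (φ w s - φ z s - A z s (w - z))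
              + (f (φ w s) - f (φ z s) - fderiv ℝ f (φ z s) (φ w s - φ z s)) := by
          simp only [ContinuousLinearMap.comp_apply, map_sub]; abel
        rw [h2]
        refine (norm_add_le _ _).trans (add_le_add ?_ (h1.trans ?_))
        · exact (ContinuousLinearMap.le_opNorm _ _).trans (mul_le_mul_of_nonneg_right
            ((hC _ (hφs z hz s hs'')).trans (le_max_left _ _)) (norm_nonneg _))
        · have := hd s hs''
          rw [dist_eq_norm, dist_eq_norm] at this
          gcongr) t ht
    refine hbound.trans ?_
    have h3 : η * ((L' + 1) / C₁ * Real.exp (C₁ * ε)) = c := by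
      rw [hη]; field_simp
    calc η * (L' * ‖w - z‖) / C₁ * Real.exp (C₁ * ε)
        ≤ η * ((L' + 1) * ‖w - z‖) / C₁ * Real.exp (C₁ * ε) := by gcongr; linarith
      _ = (η * ((L' + 1) / C₁ * Real.exp (C₁ * ε))) * ‖w - z‖ := by ring
      _ = c * ‖w - z‖ := by rw [h3]
  -- The increment splits into a change of initial value and a change of time. The first deviates
  -- from z - w by at most K L' |t| ‖z - w‖, the second from (t - u) f z₀ by the oscillation of `f ∘
  -- φ` near (z₀, 0).
  · rw [hasStrictFDerivAt_iff_isLittleO, Asymptotics.isLittleO_iff]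
    intro c hc
    have hz₀ : z₀ ∈ ball z₀ (ρ / 4) := mem_ball_self (by positivity)
    have hfφ : ContinuousAt (fun p : E × ℝ => f (φ p.1 p.2)) (z₀, 0) := by
      have h1 : ContinuousAt (Function.uncurry φ) (z₀, 0) :=
        hcont.continuousAt ((isOpen_ball.prod isOpen_Ioo).mem_nhds ⟨hz₀, h0'⟩)
      have h2 : ContinuousAt f (Function.uncurry φ (z₀, 0)) := by
        simp only [Function.uncurry_apply_pair, hφ0 z₀ hz₀]; exact hf.continuousAt
      exact ContinuousAt.comp (f := Function.uncurry φ) h2 h1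
    have hnear : ∀ᶠ p : E × ℝ in 𝓝 (z₀, 0), dist (f (φ p.1 p.2)) (f z₀) < c / 2 := by
      have := Metric.tendsto_nhds.1 hfφ.tendsto (c / 2) (by positivity)
      simpa [hφ0 z₀ hz₀] using this
    obtain ⟨d, hd, hdc⟩ := Metric.eventually_nhds_iff_ball.1 hnear
    obtain ⟨d', hd', hdd, hdρ, hdε, hdK⟩ : ∃ d' > 0, d' ≤ d ∧ d' ≤ ρ / 4 ∧ d' ≤ ε ∧
        K * L' * d' ≤ c / 2 := by
      refine ⟨min (min d (ρ / 4)) (min ε (c / 2 / (K * L' + 1))), by positivity, ?_, ?_, ?_, ?_⟩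
      · exact (min_le_left _ _).trans (min_le_left _ _)
      · exact (min_le_left _ _).trans (min_le_right _ _)
      · exact (min_le_right _ _).trans (min_le_left _ _)
      · calc (K * L' : ℝ) * _ ≤ (K * L' + 1) * (c / 2 / (K * L' + 1)) := by
              gcongr
              · linarith
              · exact (min_le_right _ _).trans (min_le_right _ _)
          _ = c / 2 := by field_simp
    have hev : ∀ᶠ p : (E × ℝ) × (E × ℝ) in 𝓝 ((z₀, 0), (z₀, 0)),
        p.1 ∈ ball ((z₀, 0) : E × ℝ) d' ∧ p.2 ∈ ball ((z₀, 0) : E × ℝ) d' := by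
      rw [nhds_prod_eq]
      exact Filter.prod_mem_prod (ball_mem_nhds _ hd') (ball_mem_nhds _ hd')
    filter_upwards [hev] with ⟨⟨z, t⟩, ⟨w, u⟩⟩ ⟨hzt, hwu⟩
    rw [← ball_prod_same] at hzt hwu
    have hz : z ∈ ball z₀ (ρ / 4) := ball_subset_ball hdρ hzt.1
    have hw : w ∈ ball z₀ (ρ / 4) := ball_subset_ball hdρ hwu.1
    have hball_eq : ball (0 : ℝ) d' = Ioo (-d') d' := by rw [Real.ball_eq_Ioo]; simp
    have hIoo : ∀ s ∈ ball (0 : ℝ) d', s ∈ Ioo (-ε) ε := fun s hs' => by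
      rw [hball_eq] at hs'; exact ⟨by linarith [hs'.1], by linarith [hs'.2]⟩
    have hd1 : ‖(φ z t - z) - (φ w t - w)‖ ≤ c / 2 * ‖z - w‖ := by
      have := (convex_ball (0 : ℝ) d').norm_image_sub_le_of_norm_hasDerivWithin_le
        (f := fun s => φ z s - φ w s) (f' := fun s => f (φ z s) - f (φ w s))
        (C := K * (L' * ‖z - w‖)) (x := 0) (y := t)
        (fun s hs' => ((hφd z hz s (hIoo s hs')).sub
          (hφd w hw s (hIoo s hs'))).hasDerivWithinAt)
        (fun s hs' => by
          have hs'' := Ioo_subset_Icc_self (hIoo s hs')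
          rw [← dist_eq_norm, ← dist_eq_norm]
          have h1 := hlip.dist_le_mul _ (hρV (hsU (hφs z hz s hs''))).1.2 _
            (hρV (hsU (hφs w hw s hs''))).1.2
          have h2 := (hL' s hs'').dist_le_mul _ (hball z hz) _ (hball w hw)
          exact h1.trans (by gcongr))
        (mem_ball_self hd') hzt.2
      rw [hφ0 z hz, hφ0 w hw, sub_zero] at this
      have ht' : ‖t‖ ≤ d' := by simpa using (mem_ball_zero_iff.1 hzt.2).le
      calc _ = ‖φ z t - φ w t - (z - w)‖ := by congr 1; abel
        _ ≤ _ := this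
        _ ≤ K * (L' * ‖z - w‖) * d' := by gcongr
        _ = (K * L' * d') * ‖z - w‖ := by ring
        _ ≤ c / 2 * ‖z - w‖ := by gcongr
    have hd2 : ‖φ w t - φ w u - (t - u) • f z₀‖ ≤ c / 2 * ‖t - u‖ := by
      have := (convex_ball (0 : ℝ) d').norm_image_sub_le_of_norm_hasDerivWithin_le
        (f := fun s => φ w s - s • f z₀) (f' := fun s => f (φ w s) - f z₀)
        (C := c / 2) (x := u) (y := t)
        (fun s hs' => ((hφd w hw s (hIoo s hs')).sub
          (((hasDerivAt_id s).smul_const (f z₀)).congr_deriv (by simp))).hasDerivWithinAt)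
        (fun s hs' => by
          rw [← dist_eq_norm]
          refine (hdc (w, s) ?_).le
          rw [← ball_prod_same]
          exact ⟨ball_subset_ball hdd hwu.1, ball_subset_ball hdd hs'⟩) hwu.2 hzt.2
      calc _ = ‖φ w t - t • f z₀ - (φ w u - u • f z₀)‖ := by
            congr 1; rw [sub_smul]; abel
        _ ≤ _ := this
    have hz1 : ‖z - w‖ ≤ ‖((z, t) : E × ℝ) - (w, u)‖ := le_max_left _ _
    have hz2 : ‖t - u‖ ≤ ‖((z, t) : E × ℝ) - (w, u)‖ := le_max_right _ _
    calc _ = ‖((φ z t - z) - (φ w t - w)) + (φ w t - φ w u - (t - u) • f z₀)‖ := by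
          congr 1; simp; abel
      _ ≤ c / 2 * ‖z - w‖ + c / 2 * ‖t - u‖ := (norm_add_le _ _).trans (add_le_add hd1 hd2)
      _ ≤ c / 2 * ‖((z, t) : E × ℝ) - (w, u)‖ + c / 2 * ‖((z, t) : E × ℝ) - (w, u)‖ := by gcongr
      _ = c * ‖((z, t) : E × ℝ) - (w, u)‖ := by ring

/-- Uniqueness is applied separately to the left and to the right of t₀, which may be an endpoint.
One-sided derivatives at the ends are needed for geodesics that start or stop at the boundary of the
surface. -/
theorem eqOn_Icc_of_hasDerivWithinAt {f : E → E} {U : Set E} {K : ℝ≥0} (hf : LipschitzOnWith K f U)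
    {a b t₀ : ℝ} {ζ ξ : ℝ → E} (ht₀ : t₀ ∈ Icc a b)
    (hζ : ∀ t ∈ Icc a b, HasDerivWithinAt ζ (f (ζ t)) (Icc a b) t) (hζU : ∀ t ∈ Icc a b, ζ t ∈ U)
    (hξ : ∀ t ∈ Icc a b, HasDerivWithinAt ξ (f (ξ t)) (Icc a b) t) (hξU : ∀ t ∈ Icc a b, ξ t ∈ U)
    (h : ζ t₀ = ξ t₀) : EqOn ζ ξ (Icc a b) := by
  have hc : ∀ {χ : ℝ → E}, (∀ t ∈ Icc a b, HasDerivWithinAt χ (f (χ t)) (Icc a b) t) →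
      ContinuousOn χ (Icc a b) := fun h t ht => (h t ht).continuousWithinAt
  have hr : ∀ {χ : ℝ → E}, (∀ t ∈ Icc a b, HasDerivWithinAt χ (f (χ t)) (Icc a b) t) →
      ∀ t ∈ Ico t₀ b, HasDerivWithinAt χ (f (χ t)) (Ici t) t := fun {χ} h t ht =>
    (h t ⟨ht₀.1.trans ht.1, ht.2.le⟩).mono_of_mem_nhdsWithin
      (Filter.mem_of_superset (Icc_mem_nhdsGE ht.2) (Icc_subset_Icc_left (ht₀.1.trans ht.1)))
  have hl : ∀ {χ : ℝ → E}, (∀ t ∈ Icc a b, HasDerivWithinAt χ (f (χ t)) (Icc a b) t) →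
      ∀ t ∈ Ioc a t₀, HasDerivWithinAt χ (f (χ t)) (Iic t) t := fun {χ} h t ht =>
    (h t ⟨ht.1.le, ht.2.trans ht₀.2⟩).mono_of_mem_nhdsWithin
      (Filter.mem_of_superset (Icc_mem_nhdsLE ht.1) (Icc_subset_Icc_right (ht.2.trans ht₀.2)))
  have hsl : ∀ t ∈ Ioc a t₀, t ∈ Icc a b := fun t ht => ⟨ht.1.le, ht.2.trans ht₀.2⟩
  have hsr : ∀ t ∈ Ico t₀ b, t ∈ Icc a b := fun t ht => ⟨ht₀.1.trans ht.1, ht.2.le⟩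
  rw [← Icc_union_Icc_eq_Icc ht₀.1 ht₀.2]
  refine EqOn.union ?_ ?_
  · exact ODE_solution_unique_of_mem_Icc_left (v := fun _ => f) (s := fun _ => U)
      (fun _ _ => hf) ((hc hζ).mono (Icc_subset_Icc_right ht₀.2)) (hl hζ)
      (fun t ht => hζU t (hsl t ht)) ((hc hξ).mono (Icc_subset_Icc_right ht₀.2)) (hl hξ)
      (fun t ht => hξU t (hsl t ht)) h
  · exact ODE_solution_unique_of_mem_Icc_right (v := fun _ => f) (s := fun _ => U)
      (fun _ _ => hf) ((hc hζ).mono (Icc_subset_Icc_left ht₀.1)) (hr hζ)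
      (fun t ht => hζU t (hsr t ht)) ((hc hξ).mono (Icc_subset_Icc_left ht₀.1)) (hr hξ)
      (fun t ht => hξU t (hsr t ht)) h

namespace IsLocalFlow

variable {f : E → E} {z₀ : E} {U : Set E} {r ε : ℝ} {φ : E → ℝ → E} {A : E → ℝ → E →L[ℝ] E}

theorem zero_mem (h : IsLocalFlow f z₀ U r ε φ A) : (0 : ℝ) ∈ Ioo (-ε) ε :=
  ⟨by linarith [h.ε_pos], h.ε_pos⟩

theorem center_mem (h : IsLocalFlow f z₀ U r ε φ A) : z₀ ∈ ball z₀ r := mem_ball_self h.r_pos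

/-- Both sides, as functions of the second time, solve the same equation with the same value at time
0. -/
theorem apply_apply (h : IsLocalFlow f z₀ U r ε φ A) {z : E} (hz : z ∈ ball z₀ r) {s t : ℝ}
    (hs : s ∈ Ioo (-ε) ε) (ht : t ∈ Ioo (-ε) ε) (hst : s + t ∈ Ioo (-ε) ε)
    (hzs : φ z s ∈ ball z₀ r) : φ (φ z s) t = φ z (s + t) := by
  obtain ⟨K, hK⟩ := h.lipschitz
  have hu : ∀ u ∈ uIcc 0 t, u ∈ Ioo (-ε) ε ∧ s + u ∈ Ioo (-ε) ε := by
    intro u hu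
    rw [mem_uIcc] at hu
    have := h.zero_mem
    simp only [mem_Ioo] at *
    rcases hu with hu | hu <;> refine ⟨⟨?_, ?_⟩, ?_, ?_⟩ <;> linarith [hu.1, hu.2]
  have := eqOn_Icc_of_hasDerivWithinAt (ζ := φ (φ z s)) (ξ := fun u => φ z (s + u)) hK
    (t₀ := 0) (a := min 0 t) (b := max 0 t) (left_mem_uIcc (a := (0 : ℝ)) (b := t))
    (fun u hu' => (h.hasDerivAt _ hzs u (hu u hu').1).hasDerivWithinAt)
    (fun u hu' => h.mem _ hzs u (hu u hu').1)
    (fun u hu' => by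
      have h1 := h.hasDerivAt z hz (s + u) (hu u hu').2
      have h2 := h1.scomp u ((hasDerivAt_id u).const_add s)
      simp only [one_smul] at h2
      exact h2.hasDerivWithinAt)
    (fun u hu' => h.mem z hz _ (hu u hu').2) (by simp [h.apply_zero _ hzs])
  exact this right_mem_uIcc

/-- Differentiate φ_{-s} ∘ φ_s = id at z. This makes the linearized flow injective and lets the
derivative of a projection along trajectories be computed away from the hyperplane. -/
theorem deriv_comp_deriv_neg (h : IsLocalFlow f z₀ U r ε φ A) {z : E} (hz : z ∈ ball z₀ r) {s : ℝ}
    (hs : s ∈ Ioo (-ε) ε) (hzs : φ z s ∈ ball z₀ r) :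
    A (φ z s) (-s) ∘L A z s = ContinuousLinearMap.id ℝ E := by
  have hs' : -s ∈ Ioo (-ε) ε := ⟨by linarith [hs.2], by linarith [hs.1]⟩
  have h1 : HasFDerivAt (fun w => φ (φ w s) (-s)) (A (φ z s) (-s) ∘L A z s) z :=
    HasFDerivAt.comp (g := fun w => φ w (-s)) z (h.hasFDerivAt _ hzs _ hs')
      (h.hasFDerivAt z hz s hs)
  have h2 : (fun w => φ (φ w s) (-s)) =ᶠ[𝓝 z] id := by
    have hc : ContinuousAt (fun w => φ w s) z := (h.hasFDerivAt z hz s hs).continuousAt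
    filter_upwards [isOpen_ball.mem_nhds hz, hc (isOpen_ball.mem_nhds hzs)] with w hw hws
    rw [h.apply_apply hw hs hs' (by simpa using h.zero_mem) hws]
    simp [h.apply_zero w hw]
  exact h1.unique ((hasFDerivAt_id z).congr_of_eventuallyEq h2)

end IsLocalFlow

end Flow
end
end RiemSurface

open Bundle Manifold Set
open scoped ContDiff Topology

namespace RiemSurface

noncomputable section

/-! ### Extension of C¹ functions across a hyperplane -/

section Reflection

variable {E F : Type*} [NormedAddCommGroup E] [NormedSpace ℝ E] [NormedAddCommGroup F]
  [NormedSpace ℝ F]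

/-- The projection onto the hyperplane `ℓ = 0` along `e`, where `ℓ e = 1`. -/
def hyperProj (ℓ : E →L[ℝ] ℝ) (e : E) : E →L[ℝ] E := ContinuousLinearMap.id ℝ E - ℓ.smulRight e

/-- The reflection in the hyperplane `ℓ = 0` along `e`, where `ℓ e = 1`. -/
def hyperRefl (ℓ : E →L[ℝ] ℝ) (e : E) : E →L[ℝ] E :=
  ContinuousLinearMap.id ℝ E - (2 : ℝ) • ℓ.smulRight e

@[simp] theorem hyperProj_apply (ℓ : E →L[ℝ] ℝ) (e z : E) : hyperProj ℓ e z = z - ℓ z • e := rfl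

@[simp] theorem hyperRefl_apply (ℓ : E →L[ℝ] ℝ) (e z : E) :
    hyperRefl ℓ e z = z - (2 : ℝ) • ℓ z • e := rfl

/-- A function which is continuously differentiable up to the boundary of a half space extends
across the boundary to a continuously differentiable function. -/
theorem exists_contDiffAt_extension {ℓ : E →L[ℝ] ℝ} {e : E} (he : ℓ e = 1) {f : E → F} {z₀ : E}
    (hz₀ : ℓ z₀ = 0) (hf : ContDiffWithinAt ℝ 1 f {z | 0 ≤ ℓ z} z₀) :
    ∃ g : E → F, ContDiffAt ℝ 1 g z₀ ∧ ∀ z, 0 ≤ ℓ z → g z = f z := by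
  set H := {z : E | 0 ≤ ℓ z} with hH
  set N := {z : E | ℓ z ≤ 0} with hN
  have hz₀H : z₀ ∈ H := by simp [hH, hz₀]
  have hHc : IsClosed H := isClosed_le continuous_const ℓ.continuous
  have hNc : IsClosed N := isClosed_le ℓ.continuous continuous_const
  obtain ⟨u, hu, huH, hfu⟩ := hf.contDiffOn le_rfl (by simp)
  rw [insert_eq_of_mem hz₀H] at hu huH
  obtain ⟨v, hvo, hz₀v, hvu⟩ := mem_nhdsWithin.1 hu
  have hHu : UniqueDiffOn ℝ H := by
    refine uniqueDiffOn_convex (convex_halfSpace_ge ℓ.isLinear 0) ⟨e, ?_⟩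
    refine interior_maximal (t := {z | 0 < ℓ z}) (fun z hz => (show 0 < ℓ z from hz).le)
      (isOpen_lt continuous_const ℓ.continuous) ?_
    simp [he]
  have hvHu : UniqueDiffOn ℝ (v ∩ H) := by rw [inter_comm]; exact hHu.inter hvo
  obtain ⟨-, f', hcf', hf'⟩ := (contDiffOn_succ_iff_hasFDerivWithinAt_of_uniqueDiffOn
    (n := 0) hvHu).1 (by simpa using hfu.mono hvu)
  replace hcf' : ContinuousOn f' (v ∩ H) := hcf'.continuousOn
  set P := hyperProj ℓ e with hP
  set R := hyperRefl ℓ e with hR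
  -- On this neighbourhood the point, its projection and its reflection all lie where `f` is
  -- controlled.
  set v₀ := v ∩ P ⁻¹' v ∩ R ⁻¹' v with hv₀
  have hv₀o : IsOpen v₀ := (hvo.inter (hvo.preimage P.continuous)).inter (hvo.preimage R.continuous)
  have hz₀v₀ : z₀ ∈ v₀ := by
    have h1 : P z₀ = z₀ := by simp [hP, hz₀]
    have h2 : R z₀ = z₀ := by simp [hR, hz₀]
    exact ⟨⟨hz₀v, by rw [mem_preimage, h1]; exact hz₀v⟩, by rw [mem_preimage, h2]; exact hz₀v⟩
  have hPm : MapsTo P (v₀ ∩ N) (v ∩ H) := fun z hz => ⟨hz.1.1.2, by simp [hP, hH, he]⟩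
  have hRm : MapsTo R (v₀ ∩ N) (v ∩ H) := fun z hz => ⟨hz.1.2, by
    have : ℓ z ≤ 0 := hz.2
    simp [hR, hH, he]; linarith⟩
  -- On the hyperplane P and R are the identity, so the value is 2f - f = f. The derivative is 2 f'
  -- ∘ P - f' ∘ R, and 2P - R = id, so the derivative matches too, in the transverse direction as
  -- well as in the tangential ones.
  set g₂ : E → F := fun z => (2 : ℝ) • f (P z) - f (R z) with hg₂
  set g₂' : E → E →L[ℝ] F := fun z => (2 : ℝ) • (f' (P z) ∘L P) - f' (R z) ∘L R with hg₂'
  have hg₂d : ∀ z ∈ v₀ ∩ N, HasFDerivWithinAt g₂ (g₂' z) (v₀ ∩ N) z := fun z hz =>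
    (((hf' _ (hPm hz)).comp z P.hasFDerivWithinAt hPm).const_smul (2 : ℝ)).sub
      ((hf' _ (hRm hz)).comp z R.hasFDerivWithinAt hRm)
  have hg₂c : ContinuousOn g₂' (v₀ ∩ N) :=
    (((hcf'.comp P.continuous.continuousOn hPm).clm_comp continuousOn_const).const_smul
      (2 : ℝ)).sub ((hcf'.comp R.continuous.continuousOn hRm).clm_comp continuousOn_const)
  have hP0 : ∀ z, ℓ z = 0 → P z = z := fun z hz => by simp [hP, hz]
  have hR0 : ∀ z, ℓ z = 0 → R z = z := fun z hz => by simp [hR, hz]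
  have h0 : ∀ z, ℓ z = 0 → g₂ z = f z := fun z hz => by
    simp only [hg₂, hP0 z hz, hR0 z hz, two_smul, add_sub_cancel_right]
  have h0' : ∀ z, ℓ z = 0 → g₂' z = f' z := fun z hz => by
    simp only [hg₂', hP0 z hz, hR0 z hz]
    ext w
    change (2 : ℝ) • f' z (w - ℓ w • e) - f' z (w - (2 : ℝ) • ℓ w • e) = f' z w
    simp only [map_sub, map_smul]
    module
  classical
  set g : E → F := fun z => if 0 ≤ ℓ z then f z else g₂ z with hg
  set g' : E → E →L[ℝ] F := fun z => if 0 ≤ ℓ z then f' z else g₂' z with hg'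
  have hgH : ∀ z ∈ H, g z = f z := fun z hz => if_pos hz
  have hg'H : ∀ z ∈ H, g' z = f' z := fun z hz => if_pos hz
  have hgN : ∀ z ∈ N, g z = g₂ z := fun z hz => by
    by_cases h : 0 ≤ ℓ z
    · rw [hgH z h, h0 z (le_antisymm hz h)]
    · exact if_neg h
  have hg'N : ∀ z ∈ N, g' z = g₂' z := fun z hz => by
    by_cases h : 0 ≤ ℓ z
    · rw [hg'H z h, h0' z (le_antisymm hz h)]
    · exact if_neg h
  have hcov : v₀ ∩ H ∪ v₀ ∩ N = v₀ := by
    rw [← inter_union_distrib_left, inter_eq_left]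
    exact fun z _ => le_total 0 (ℓ z)
  have hcl : ∀ {S : Set E} {z}, IsClosed S → z ∉ S → z ∉ closure (v₀ ∩ S) := fun {S z} hS hz h =>
    hz (hS.closure_subset_iff.2 inter_subset_right h)
  have hv₀v : v₀ ∩ H ⊆ v ∩ H := fun z hz => ⟨hz.1.1.1, hz.2⟩
  refine ⟨g, contDiffAt_one_iff.2 ⟨g', v₀, hv₀o.mem_nhds hz₀v₀, ?_, ?_⟩, hgH⟩
  · intro z hz
    rw [← hcov]
    refine ContinuousWithinAt.union ?_ ?_
    · by_cases h : z ∈ H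
      · exact ((hcf'.mono hv₀v) z ⟨hz, h⟩).congr (fun y hy => hg'H y hy.2) (hg'H z h)
      · exact continuousWithinAt_of_notMem_closure (hcl hHc h)
    · by_cases h : z ∈ N
      · exact (hg₂c z ⟨hz, h⟩).congr (fun y hy => hg'N y hy.2) (hg'N z h)
      · exact continuousWithinAt_of_notMem_closure (hcl hNc h)
  · intro z hz
    refine HasFDerivWithinAt.hasFDerivAt (s := v₀) ?_ (hv₀o.mem_nhds hz)
    rw [← hcov]
    refine HasFDerivWithinAt.union ?_ ?_
    · by_cases h : z ∈ H
      · rw [hg'H z h]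
        exact ((hf' z (hv₀v ⟨hz, h⟩)).mono hv₀v).congr (fun y hy => hgH y hy.2) (hgH z h)
      · exact .of_notMem_closure (hcl hHc h)
    · by_cases h : z ∈ N
      · rw [hg'N z h]
        exact (hg₂d z ⟨hz, h⟩).congr (fun y hy => hgN y hy.2) (hgN z h)
      · exact .of_notMem_closure (hcl hNc h)

end Reflection
end
end RiemSurface

open Bundle Manifold Set
open scoped ContDiff Topology

namespace RiemSurface

set_option maxSynthPendingDepth 3
set_option linter.unusedSectionVars false

noncomputable section

/-! ### Riemannian metrics on the half plane -/

variable {P : Type*} [NormedAddCommGroup P] [NormedSpace ℝ P] [FiniteDimensional ℝ P]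

/-- The linear functionals `x` are the coordinates with respect to the basis `e` of the plane
`P`. -/
structure IsCoord (e : Fin 2 → P) (x : Fin 2 → P →L[ℝ] ℝ) : Prop where
  apply : ∀ i j, x i (e j) = if i = j then 1 else 0
  eq : ∀ u, u = x 0 u • e 0 + x 1 u • e 1

/-- `g` is a smooth Riemannian metric on the relatively open subset `T` of `S`. -/
structure IsChartMetric (e : Fin 2 → P) (x : Fin 2 → P →L[ℝ] ℝ) (S : Set P)
    (g : P → P →L[ℝ] P →L[ℝ] ℝ) (T : Set P) : Prop where
  coord : IsCoord e x
  unique : UniqueDiffOn ℝ S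
  closure_interior : S ⊆ closure (interior S)
  subset : T ⊆ S
  nhds : ∀ y ∈ T, T ∈ 𝓝[S] y
  smooth : ContDiffOn ℝ ∞ g T
  symm : ∀ y u w, g y u w = g y w u
  pos : ∀ y ∈ T, ∀ u, u ≠ 0 → 0 < g y u u

variable {e : Fin 2 → P} {x : Fin 2 → P →L[ℝ] ℝ} {S : Set P} {g : P → P →L[ℝ] P →L[ℝ] ℝ}
  {T : Set P} {y : P}

/-- The matrix of `g`. -/
def formGram (e : Fin 2 → P) (g : P → P →L[ℝ] P →L[ℝ] ℝ) (y : P) : Matrix (Fin 2) (Fin 2) ℝ :=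
  Matrix.of fun i j => g y (e i) (e j)

/-- The derivative of `g` within `S`. -/
def formDeriv (S : Set P) (g : P → P →L[ℝ] P →L[ℝ] ℝ) (y : P) :
    P →L[ℝ] P →L[ℝ] P →L[ℝ] ℝ :=
  fderivWithin ℝ g S y

/-- The Christoffel symbols of `g`, as a bilinear map. -/
def formChr (e : Fin 2 → P) (S : Set P) (g : P → P →L[ℝ] P →L[ℝ] ℝ) (y : P) :
    P →L[ℝ] P →L[ℝ] P :=
  LinearMap.toContinuousLinearMap
    (LinearMap.toContinuousLinearMap.toLinearMap ∘ₗ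
      LinearMap.mk₂ ℝ (fun u w => ∑ k, (∑ l, (formGram e g y)⁻¹ k l * ((1 / 2) *
        (formDeriv S g y u w (e l) + formDeriv S g y w u (e l)
          - formDeriv S g y (e l) u w))) • e k)
        (fun u u' w => by
          simp only [map_add, add_apply, Fin.sum_univ_two]; module)
        (fun c u w => by
          simp only [map_smul, smul_apply, Fin.sum_univ_two, smul_eq_mul]; module)
        (fun u w w' => by
          simp only [map_add, add_apply, Fin.sum_univ_two]; module)
        (fun c u w => by
          simp only [map_smul, smul_apply, Fin.sum_univ_two, smul_eq_mul]; module))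

theorem formChr_apply (u w : P) : formChr e S g y u w =
    ∑ k, (∑ l, (formGram e g y)⁻¹ k l * ((1 / 2) *
        (formDeriv S g y u w (e l) + formDeriv S g y w u (e l)
          - formDeriv S g y (e l) u w))) • e k := rfl

theorem form_expand (hx : IsCoord e x) (y u w : P) : g y u w = x 0 u * x 0 w * formGram e g y 0 0
    + x 0 u * x 1 w * formGram e g y 0 1 + x 1 u * x 0 w * formGram e g y 1 0
    + x 1 u * x 1 w * formGram e g y 1 1 := by
  conv_lhs => rw [hx.eq u, hx.eq w]
  simp only [map_add, map_smul, add_apply, smul_apply, smul_eq_mul, formGram, Matrix.of_apply]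
  ring

namespace IsChartMetric

theorem contDiffWithinAt (h : IsChartMetric e x S g T) (hy : y ∈ T) :
    ContDiffWithinAt ℝ ∞ g S y :=
  (h.smooth y hy).mono_of_mem_nhdsWithin (h.nhds y hy)

theorem hasFDerivWithinAt (h : IsChartMetric e x S g T) (hy : y ∈ T) :
    HasFDerivWithinAt g (formDeriv S g y) S y :=
  ((h.contDiffWithinAt hy).differentiableWithinAt (by simp)).hasFDerivWithinAt

theorem formDeriv_comm (h : IsChartMetric e x S g T) (hy : y ∈ T) (z u w : P) :
    formDeriv S g y z u w = formDeriv S g y z w u := by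
  have h1 : ∀ u w, HasFDerivWithinAt (fun y => g y u w)
      (((formDeriv S g y).flip u).flip w) S y := fun u w =>
    (((h.hasFDerivWithinAt hy).clm_apply (hasFDerivWithinAt_const u y _)).clm_apply
      (hasFDerivWithinAt_const w y _)).congr_fderiv (by ext; simp)
  have h2 := h1 u w
  rw [show (fun y => g y u w) = fun y => g y w u from funext fun y => h.symm y u w] at h2
  have := (h.unique y (h.subset hy)).eq h2 (h1 w u)
  simpa using congrArg (fun L => L z) this

theorem gram_comm (h : IsChartMetric e x S g T) (y : P) : formGram e g y 1 0 = formGram e g y 0 1 :=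
  h.symm _ _ _

theorem gram_pos (h : IsChartMetric e x S g T) (hy : y ∈ T) : 0 < formGram e g y 0 0 :=
  h.pos y hy _ fun h0 => by simpa [h0] using h.coord.apply 0 0

theorem det_pos (h : IsChartMetric e x S g T) (hy : y ∈ T) : 0 < (formGram e g y).det := by
  have h0 := h.gram_pos hy
  -- For this vector g(u, u) = g₀₀ (g₀₀ g₁₁ - g₀₁²), so positivity of the form gives positivity of
  -- the determinant.
  set u : P := (-formGram e g y 0 1) • e 0 + formGram e g y 0 0 • e 1 with hu
  have h1 : x 0 u = -formGram e g y 0 1 := by simp [hu, h.coord.apply]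
  have h2 : x 1 u = formGram e g y 0 0 := by simp [hu, h.coord.apply]
  have h3 := h.pos y hy u fun hu0 => by
    rw [hu0, map_zero] at h2; exact h0.ne h2
  rw [form_expand h.coord, h1, h2, h.gram_comm] at h3
  rw [Matrix.det_fin_two, h.gram_comm]
  nlinarith

theorem det_ne_zero (h : IsChartMetric e x S g T) (hy : y ∈ T) : (formGram e g y).det ≠ 0 :=
  ne_of_gt (h.det_pos hy)

/-- The Koszul formula. -/
theorem koszul (h : IsChartMetric e x S g T) (hy : y ∈ T) (u w z : P) :
    g y (formChr e S g y u w) z = (1 / 2) * (formDeriv S g y u w z + formDeriv S g y w u z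
      - formDeriv S g y z u w) := by
  have key : ∀ m, g y (formChr e S g y u w) (e m) = (1 / 2) * (formDeriv S g y u w (e m)
      + formDeriv S g y w u (e m) - formDeriv S g y (e m) u w) := by
    intro m
    set c : Fin 2 → ℝ := fun l => (1 / 2) * (formDeriv S g y u w (e l)
      + formDeriv S g y w u (e l) - formDeriv S g y (e l) u w) with hc
    have hmul : formGram e g y * (formGram e g y)⁻¹ = 1 :=
      Matrix.mul_nonsing_inv _ (isUnit_iff_ne_zero.2 (h.det_ne_zero hy))
    have hsymm : ∀ i j, formGram e g y i j = formGram e g y j i := fun i j => h.symm _ _ _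
    have h1 : g y (formChr e S g y u w) (e m)
        = ∑ k, (∑ l, (formGram e g y)⁻¹ k l * c l) * formGram e g y m k := by
      rw [formChr_apply]
      simp only [map_sum, map_smul, FunLike.coe_sum, Finset.sum_apply, smul_apply, smul_eq_mul]
      refine Finset.sum_congr rfl fun k _ => ?_
      rw [hsymm m k]; rfl
    rw [h1]
    have h2 : ∑ k, (∑ l, (formGram e g y)⁻¹ k l * c l) * formGram e g y m k
        = ∑ l, (formGram e g y * (formGram e g y)⁻¹) m l * c l := by
      simp only [Matrix.mul_apply, Fin.sum_univ_two]; ring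
    rw [h2, hmul]
    simp [Matrix.one_apply, hc]
  conv_lhs => rw [h.coord.eq z]
  conv_rhs => rw [h.coord.eq z]
  simp only [map_add, map_smul, add_apply, smul_apply, smul_eq_mul, key]
  ring

theorem chr_comm (h : IsChartMetric e x S g T) (hy : y ∈ T) (u w : P) :
    formChr e S g y u w = formChr e S g y w u := by
  rw [formChr_apply, formChr_apply]
  refine Finset.sum_congr rfl fun k _ => ?_
  congr 1
  refine Finset.sum_congr rfl fun l _ => ?_
  rw [h.formDeriv_comm hy (e l) u w]
  ring

/-- The Levi-Civita connection is metric. -/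
theorem compat (h : IsChartMetric e x S g T) (hy : y ∈ T) (z u w : P) :
    formDeriv S g y z u w = g y (formChr e S g y z u) w + g y u (formChr e S g y z w) := by
  rw [h.symm y u, h.koszul hy, h.koszul hy, h.formDeriv_comm hy u z w, h.formDeriv_comm hy z w u,
    h.formDeriv_comm hy w z u]
  ring

theorem eq_of_form_eq (h : IsChartMetric e x S g T) (hy : y ∈ T) {u w : P}
    (huw : ∀ z, g y u z = g y w z) : u = w := by
  by_contra hne
  have := h.pos y hy (u - w) (sub_ne_zero.2 hne)
  simp [huw] at this

theorem contDiffOn_gram (h : IsChartMetric e x S g T) (i j : Fin 2) :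
    ContDiffOn ℝ ∞ (fun y => formGram e g y i j) T :=
  (h.smooth.clm_apply contDiffOn_const).clm_apply contDiffOn_const

theorem contDiffOn_formDeriv (h : IsChartMetric e x S g T) : ContDiffOn ℝ ∞ (formDeriv S g) T :=
  fun _ hy => ((h.contDiffWithinAt hy).fderivWithin_right h.unique (by simp)
    (h.subset hy)).mono h.subset

theorem contDiffOn_formChr (h : IsChartMetric e x S g T) : ContDiffOn ℝ ∞ (formChr e S g) T := by
  have hdet : ContDiffOn ℝ ∞ (fun y => (formGram e g y).det) T := by
    simp only [Matrix.det_fin_two]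
    exact ((h.contDiffOn_gram 0 0).mul (h.contDiffOn_gram 1 1)).sub
      ((h.contDiffOn_gram 0 1).mul (h.contDiffOn_gram 1 0))
  have hinv : ∀ k l, ContDiffOn ℝ ∞ (fun y => (formGram e g y)⁻¹ k l) T := by
    -- By Cramer's rule the inverse matrix is polynomial in the entries and in the inverse of the
    -- determinant, which does not vanish on T.
    have hi := hdet.inv fun y hy => h.det_ne_zero hy
    intro k l
    simp only [Matrix.inv_def, Ring.inverse_eq_inv', Matrix.smul_apply, smul_eq_mul]
    refine hi.mul ?_
    simp only [Matrix.adjugate_fin_two]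
    fin_cases k <;> fin_cases l <;> simp [h.contDiffOn_gram, (h.contDiffOn_gram _ _).neg]
  have hd : ∀ a b c : P, ContDiffOn ℝ ∞ (fun y => formDeriv S g y a b c) T := fun a b c =>
    ((h.contDiffOn_formDeriv.clm_apply contDiffOn_const).clm_apply contDiffOn_const).clm_apply
      contDiffOn_const
  rw [contDiffOn_clm_apply]
  intro u
  rw [contDiffOn_clm_apply]
  intro w
  simp only [formChr_apply]
  refine ContDiffOn.sum fun k _ => ContDiffOn.smul (ContDiffOn.sum fun l _ => (hinv k l).mul
    (contDiffOn_const.mul (((hd _ _ _).add (hd _ _ _)).sub (hd _ _ _)))) contDiffOn_const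

end IsChartMetric

/-! ### Curvature in coordinates -/

/-- The derivative of the Christoffel symbols within `S`. -/
def formChrDeriv (e : Fin 2 → P) (S : Set P) (g
    : P → P →L[ℝ] P →L[ℝ] ℝ) (y : P) :
    P →L[ℝ] P →L[ℝ] P →L[ℝ] P :=
  fderivWithin ℝ (formChr e S g) S y

/-- The curvature of `g`. -/
def formCurv (e : Fin 2 → P) (S : Set P) (g
    : P → P →L[ℝ] P →L[ℝ] ℝ) (y u w z : P) : P :=
  formChrDeriv e S g y u w z - formChrDeriv e S g y w u z + formChr e S g y u (formChr e S g y w z)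
    - formChr e S g y w (formChr e S g y u z)

namespace IsChartMetric

theorem contDiffWithinAt_formChr (h : IsChartMetric e x S g T) (hy : y ∈ T) :
    ContDiffWithinAt ℝ ∞ (formChr e S g) S y :=
  (h.contDiffOn_formChr y hy).mono_of_mem_nhdsWithin (h.nhds y hy)

theorem hasFDerivWithinAt_formChr (h : IsChartMetric e x S g T) (hy : y ∈ T) :
    HasFDerivWithinAt (formChr e S g) (formChrDeriv e S g y) S y :=
  ((h.contDiffWithinAt_formChr hy).differentiableWithinAt (by simp)).hasFDerivWithinAt

theorem formChrDeriv_comm (h : IsChartMetric e x S g T) (hy : y ∈ T) (z u w : P) :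
    formChrDeriv e S g y z u w = formChrDeriv e S g y z w u := by
  have h1 : ∀ u w, HasFDerivWithinAt (fun y => formChr e S g y u w)
      (((formChrDeriv e S g y).flip u).flip w) S y := fun u w =>
    (((h.hasFDerivWithinAt_formChr hy).clm_apply (hasFDerivWithinAt_const u y _)).clm_apply
      (hasFDerivWithinAt_const w y _)).congr_fderiv (by ext; simp)
  have h2 : HasFDerivWithinAt (fun y => formChr e S g y u w)
      (((formChrDeriv e S g y).flip w).flip u) S y := by
    refine (h1 w u).congr_of_eventuallyEq ?_ (h.chr_comm hy u w)
    filter_upwards [h.nhds y hy] with y' hy' using h.chr_comm hy' u w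
  have := (h.unique y (h.subset hy)).eq (h1 u w) h2
  simpa using congrArg (fun L => L z) this

/-- The curvature operators are skew-symmetric. -/
theorem curv_skew (h : IsChartMetric e x S g T) (hy : y ∈ T) (a b u w : P) :
    g y (formCurv e S g y a b u) w + g y u (formCurv e S g y a b w) = 0 := by
  have hyH := h.subset hy
  have hsymm : ∀ a b, fderivWithin ℝ (formDeriv S g) S y a b
      = fderivWithin ℝ (formDeriv S g) S y b a := fun a b =>
    ((h.contDiffWithinAt hy).isSymmSndFDerivWithinAt (by simpa using ENat.LEInfty.out) h.unique
      (h.closure_interior hyH) hyH) a b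
  have hd : HasFDerivWithinAt (formDeriv S g) (fderivWithin ℝ (formDeriv S g) S y)
      S y :=
    (((h.contDiffOn_formDeriv y hy).mono_of_mem_nhdsWithin (h.nhds y hy)).differentiableWithinAt
      (by simp)).hasFDerivWithinAt
  -- Differentiate metric compatibility once more. The left side is a second derivative of g,
  -- symmetric in a and b; antisymmetrizing the right side leaves the two curvature terms.
  have key : ∀ a b, fderivWithin ℝ (formDeriv S g) S y a b u w
      = formDeriv S g y a (formChr e S g y b u) w + g y (formChrDeriv e S g y a b u) w
        + (formDeriv S g y a u (formChr e S g y b w) + g y u (formChrDeriv e S g y a b w)) := by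
    intro a b
    have h1 := ((hd.clm_apply (hasFDerivWithinAt_const b y _)).clm_apply
      (hasFDerivWithinAt_const u y _)).clm_apply (hasFDerivWithinAt_const w y _)
    have hΓ : ∀ u, HasFDerivWithinAt (fun y => formChr e S g y b u)
        (((formChrDeriv e S g y).flip b).flip u) S y := fun u =>
      (((h.hasFDerivWithinAt_formChr hy).clm_apply (hasFDerivWithinAt_const b y _)).clm_apply
      (hasFDerivWithinAt_const u y _)).congr_fderiv (by ext; simp)
    have h2 := (((h.hasFDerivWithinAt hy).clm_apply (hΓ u)).clm_apply
      (hasFDerivWithinAt_const w y _)).add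
      (((h.hasFDerivWithinAt hy).clm_apply (hasFDerivWithinAt_const u y _)).clm_apply (hΓ w))
    have h3 := h1.congr_of_eventuallyEq (f₁ := fun y => g y (formChr e S g y b u) w
        + g y u (formChr e S g y b w))
      (by filter_upwards [h.nhds y hy] with y' hy' using (h.compat hy' b u w).symm)
      (h.compat hy b u w).symm
    have := congrArg (fun L => L a) ((h.unique y hyH).eq h3 h2)
    simp at this
    rw [this]
    ring
  have h1 := key a b
  have h2 := key b a
  rw [hsymm b a] at h2
  rw [h2] at h1
  simp only [h.compat hy] at h1
  simp only [formCurv, map_sub, map_add, sub_apply, add_apply]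
  linarith

end IsChartMetric

end

noncomputable section

variable {P : Type*} [NormedAddCommGroup P] [NormedSpace ℝ P] [FiniteDimensional ℝ P]
variable {e : Fin 2 → P} {x : Fin 2 → P →L[ℝ] ℝ} {S : Set P} {g : P → P →L[ℝ] P →L[ℝ] ℝ}
  {T : Set P} {y : P}

/-! ### Change of coordinates -/

/-- The transformation law of the Christoffel symbols. -/
theorem IsChartMetric.map_formChr {g' : P → P →L[ℝ] P →L[ℝ] ℝ} {T' : Set P}
    (h : IsChartMetric e x S g T) (h' : IsChartMetric e x S g' T') (hy : y ∈ T) {φ : P → P}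
    (hφ : ContDiffWithinAt ℝ ∞ φ S y) (hφS : MapsTo φ S S) (hφy : φ y ∈ T')
    (hg : ∀ᶠ y' in 𝓝[S] y, ∀ u w, g y' u w
      = g' (φ y') (fderivWithin ℝ φ S y' u) (fderivWithin ℝ φ S y' w)) (u w : P) :
    fderivWithin ℝ φ S y (formChr e S g y u w)
      = formChr e S g' (φ y) (fderivWithin ℝ φ S y u) (fderivWithin ℝ φ S y w)
        + fderivWithin ℝ (fderivWithin ℝ φ S) S y u w := by
  have hyS := h.subset hy
  set D := fderivWithin ℝ φ S y with hD
  set D2 := fderivWithin ℝ (fderivWithin ℝ φ S) S y with hD2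
  have hgy : ∀ u w, g y u w = g' (φ y) (D u) (D w) := (hg.self_of_nhdsWithin hyS)
  have hD2s : ∀ u w, D2 u w = D2 w u := fun u w =>
    (hφ.isSymmSndFDerivWithinAt (by simpa using ENat.LEInfty.out) h.unique
      (h.closure_interior hyS) hyS) u w
  have hφd : HasFDerivWithinAt φ D S y :=
    (hφ.differentiableWithinAt (by simp)).hasFDerivWithinAt
  have hDd : HasFDerivWithinAt (fderivWithin ℝ φ S) D2 S y :=
    ((hφ.fderivWithin_right (m := ∞) h.unique (by simp) hyS).differentiableWithinAt
      (by simp)).hasFDerivWithinAt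
  -- Differentiating the isometry relation g(u, w) = g'(Du, Dw) brings in the second derivative of
  -- φ. In the Koszul formula its symmetry leaves a single such term.
  have key : ∀ z u w, formDeriv S g y z u w = formDeriv S g' (φ y) (D z) (D u) (D w)
      + g' (φ y) (D2 z u) (D w) + g' (φ y) (D u) (D2 z w) := by
    intro z u w
    have h1 := ((h.hasFDerivWithinAt hy).clm_apply (hasFDerivWithinAt_const u y _)).clm_apply
      (hasFDerivWithinAt_const w y _)
    have hDu : ∀ u, HasFDerivWithinAt (fun y' => fderivWithin ℝ φ S y' u) (D2.flip u) S y :=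
      fun u => (hDd.clm_apply (hasFDerivWithinAt_const u y _)).congr_fderiv (by ext; simp)
    have h2 := (((h'.hasFDerivWithinAt hφy).comp y hφd hφS).clm_apply (hDu u)).clm_apply (hDu w)
    have h3 := h2.congr_of_eventuallyEq (f₁ := fun y' => g y' u w)
      (by filter_upwards [hg] with y' hy' using hy' u w) (hgy u w)
    have := congrArg (fun L => L z) ((h.unique y hyS).eq h1 h3)
    simp at this
    rw [this]
    ring
  -- D preserves the metrics, hence is injective, hence surjective by dimension; so it suffices to
  -- test the identity against vectors of the form D z.
  have hinj : Function.Injective D := by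
    refine (injective_iff_map_eq_zero D).2 fun u hu => ?_
    by_contra hne
    have := h.pos y hy u hne
    simp [hgy, hu] at this
  have hsurj : Function.Surjective D :=
    (LinearMap.injective_iff_surjective (f := D.toLinearMap)).1 hinj
  refine h'.eq_of_form_eq hφy fun z' => ?_
  obtain ⟨z, rfl⟩ := hsurj z'
  rw [← hgy, h.koszul hy, map_add, add_apply, h'.koszul hφy, key, key, key, hD2s z u, hD2s z w,
    hD2s w u, h'.symm _ (D w) (D2 u z)]
  ring

/-! ### Geodesics and Jacobi fields -/

/-- The coordinate area form. -/
def coordArea (x : Fin 2 → P →L[ℝ] ℝ) (u w : P) : ℝ := x 0 u * x 1 w - x 1 u * x 0 w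

/-- The area form of the metric. -/
def formArea (e : Fin 2 → P) (x : Fin 2 → P →L[ℝ] ℝ) (g : P → P →L[ℝ] P →L[ℝ] ℝ)
    (y u w : P) : ℝ :=
  Real.sqrt (formGram e g y).det * coordArea x u w

/-- The Gauss curvature of the metric. -/
def formGauss (e : Fin 2 → P) (S : Set P) (g : P → P →L[ℝ] P →L[ℝ] ℝ) (y : P) : ℝ :=
  g y (formCurv e S g y (e 0) (e 1) (e 1)) (e 0) / (formGram e g y).det

/-- The derivative of a determinant is a trace: a linear map acts as a derivation on the
one-dimensional space of area forms through its trace. -/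
theorem coordArea_map (hx : IsCoord e x) (L : P →L[ℝ] P) (u w : P) :
    coordArea x (L u) w + coordArea x u (L w)
      = (x 0 (L (e 0)) + x 1 (L (e 1))) * coordArea x u w := by
  have hL : ∀ u i, x i (L u) = x 0 u * x i (L (e 0)) + x 1 u * x i (L (e 1)) := fun u i => by
    conv_lhs => rw [hx.eq u]
    simp
  simp only [coordArea, hL u, hL w]
  ring

namespace IsChartMetric

theorem hasDerivWithinAt_form (h : IsChartMetric e x S g T) {I : Set ℝ} {t : ℝ} {c A B : ℝ → P}
    {v A' B' : P} (hc : HasDerivWithinAt c v I t) (hcS : MapsTo c I S) (hct : c t ∈ T)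
    (hA : HasDerivWithinAt A A' I t) (hB : HasDerivWithinAt B B' I t) :
    HasDerivWithinAt (fun s => g (c s) (A s) (B s))
      (g (c t) (A' + formChr e S g (c t) v (A t)) (B t)
        + g (c t) (A t) (B' + formChr e S g (c t) v (B t))) I t := by
  have h1 : HasDerivWithinAt (fun s => g (c s)) (formDeriv S g (c t) v) I t :=
    (h.hasFDerivWithinAt hct).comp_hasDerivWithinAt t hc hcS
  have h2 := (h1.clm_apply hA).clm_apply hB
  refine h2.congr_deriv ?_
  simp only [add_apply, h.compat hct, map_add]
  ring

theorem hasDerivWithinAt_det (h : IsChartMetric e x S g T) {I : Set ℝ} {t : ℝ} {c : ℝ → P}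
    {v : P} (hc : HasDerivWithinAt c v I t) (hcS : MapsTo c I S) (hct : c t ∈ T) :
    HasDerivWithinAt (fun s => (formGram e g (c s)).det)
      (2 * (x 0 (formChr e S g (c t) v (e 0)) + x 1 (formChr e S g (c t) v (e 1)))
        * (formGram e g (c t)).det) I t := by
  have hg : ∀ i j, HasDerivWithinAt (fun s => formGram e g (c s) i j)
      (g (c t) (formChr e S g (c t) v (e i)) (e j)
        + g (c t) (e i) (formChr e S g (c t) v (e j))) I t := fun i j =>
    (h.hasDerivWithinAt_form hc hcS hct (hasDerivWithinAt_const t I (e i))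
      (hasDerivWithinAt_const t I (e j))).congr_deriv (by simp)
  simp only [Matrix.det_fin_two]
  refine (((hg 0 0).mul (hg 1 1)).sub ((hg 0 1).mul (hg 1 0))).congr_deriv ?_
  simp only [form_expand h.coord (c t) _ _, h.coord.apply, h.gram_comm]
  simp
  ring

/-- The area form is parallel. The derivative of √det g along the curve is √det g times the trace of
Γ(v, ·), and by `coordArea_map` this is exactly the contribution of the Christoffel terms on the
right. -/
theorem hasDerivWithinAt_area (h : IsChartMetric e x S g T) {I : Set ℝ} {t : ℝ} {c A B : ℝ → P}
    {v A' B' : P} (hc : HasDerivWithinAt c v I t) (hcS : MapsTo c I S) (hct : c t ∈ T)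
    (hA : HasDerivWithinAt A A' I t) (hB : HasDerivWithinAt B B' I t) :
    HasDerivWithinAt (fun s => formArea e x g (c s) (A s) (B s))
      (formArea e x g (c t) (A' + formChr e S g (c t) v (A t)) (B t)
        + formArea e x g (c t) (A t) (B' + formChr e S g (c t) v (B t))) I t := by
  have h1 := (h.hasDerivWithinAt_det hc hcS hct).sqrt (h.det_ne_zero hct)
  have hA' : ∀ i, HasDerivWithinAt (fun s => x i (A s)) (x i A') I t := fun i =>
    (x i).hasFDerivAt.comp_hasDerivWithinAt t hA
  have hB' : ∀ i, HasDerivWithinAt (fun s => x i (B s)) (x i B') I t := fun i =>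
    (x i).hasFDerivAt.comp_hasDerivWithinAt t hB
  have h2 := h1.mul (((hA' 0).mul (hB' 1)).sub ((hA' 1).mul (hB' 0)))
  refine h2.congr_deriv ?_
  have h3 := coordArea_map h.coord (formChr e S g (c t) v) (A t) (B t)
  have h4 : Real.sqrt (formGram e g (c t)).det ≠ 0 :=
    (Real.sqrt_pos.2 (h.det_pos hct)).ne'
  have h5 : 2 * (x 0 (formChr e S g (c t) v (e 0)) + x 1 (formChr e S g (c t) v (e 1)))
        * (formGram e g (c t)).det / (2 * Real.sqrt (formGram e g (c t)).det)
      = (x 0 (formChr e S g (c t) v (e 0)) + x 1 (formChr e S g (c t) v (e 1)))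
        * Real.sqrt (formGram e g (c t)).det := by
    rw [div_eq_iff (by positivity)]
    have := Real.mul_self_sqrt (h.det_pos hct).le
    linear_combination (-2 * (x 0 (formChr e S g (c t) v (e 0))
      + x 1 (formChr e S g (c t) v (e 1)))) * this
  rw [h5]
  simp only [coordArea, formArea, map_add, Pi.sub_apply, Pi.mul_apply] at h3 ⊢
  linear_combination (-Real.sqrt (formGram e g (c t)).det) * h3

/-- In dimension two R(v, w) is the coordinate area of (v, w) times the single operator R(e₀, e₁).
By `curv_skew` that operator is skew for g, hence a multiple of the rotation by a right angle, and
the multiple is the Gauss curvature up to normalization. -/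
theorem area_curv (h : IsChartMetric e x S g T) (hy : y ∈ T) (v w : P) :
    formArea e x g y v (formCurv e S g y v w v)
      = -(formGauss e S g y * formArea e x g y v w * g y v v) := by
  have hsk := h.curv_skew hy (e 0) (e 1)
  set R : P → P := formCurv e S g y (e 0) (e 1) with hR
  have hRadd : ∀ u, R u = x 0 u • R (e 0) + x 1 u • R (e 1) := fun u => by
    conv_lhs => rw [h.coord.eq u]
    simp only [hR, formCurv, map_add, map_smul]
    module
  have hRvw : formCurv e S g y v w v = coordArea x v w • R v := by
    have : ∀ z, formCurv e S g y v w z = coordArea x v w • R z := fun z => by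
      conv_lhs => rw [h.coord.eq v, h.coord.eq w]
      simp only [hR, formCurv, map_add, map_smul, add_apply, smul_apply, coordArea]
      module
    exact this v
  have h00 := hsk (e 0) (e 0)
  have h01 := hsk (e 0) (e 1)
  have h11 := hsk (e 1) (e 1)
  have hdet := h.det_ne_zero hy
  have hd := Matrix.det_fin_two (formGram e g y)
  rw [h.gram_comm] at hd
  have hRv : ∀ i, x i (R v) = x 0 v * x i (R (e 0)) + x 1 v * x i (R (e 1)) := fun i => by
    rw [hRadd]; simp
  rw [form_expand h.coord, form_expand h.coord] at h00 h01 h11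
  simp only [h.coord.apply, h.gram_comm] at h00 h01 h11
  simp at h00 h01 h11
  rw [hRvw, formArea, formArea, formGauss]
  change _ * coordArea x v (coordArea x v w • R v) = -(g y (R (e 1)) (e 0) / _ * _ * _)
  rw [form_expand h.coord y (R (e 1)), form_expand h.coord y v v]
  simp only [h.coord.apply, h.gram_comm]
  rw [div_mul_eq_mul_div, div_mul_eq_mul_div, ← neg_div, eq_div_iff hdet, hd]
  simp only [coordArea, map_smul, smul_eq_mul, hRv]
  simp
  generalize formGram e g y 0 0 = E at *
  generalize formGram e g y 0 1 = F at *
  generalize formGram e g y 1 1 = G at *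
  generalize x 0 (R (e 0)) = a at *
  generalize x 1 (R (e 0)) = b at *
  generalize x 0 (R (e 1)) = c at *
  generalize x 1 (R (e 1)) = d at *
  generalize x 0 v = v0 at *
  generalize x 1 v = v1 at *
  generalize √(E * G - F * F) = σ at *
  -- The identity is a combination of the three skewness relations of R(e₀, e₁) on the pairs of
  -- basis vectors.
  linear_combination σ * (v0 * x 1 w - v1 * x 0 w) * (v0 ^ 2 * (E * h01 - F * h00)
    + v1 ^ 2 * (F * h11) + v0 * v1 * (E * h11 - G * h00 + F * h01))

end IsChartMetric

theorem hasDerivWithinAt_fst_comp {z : ℝ → P × P} {z' : P × P} {I : Set ℝ} {t : ℝ}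
    (hz : HasDerivWithinAt z z' I t) : HasDerivWithinAt (fun s => (z s).1) z'.1 I t :=
  (ContinuousLinearMap.fst ℝ P P).hasFDerivAt.comp_hasDerivWithinAt t hz

theorem hasDerivWithinAt_snd_comp {z : ℝ → P × P} {z' : P × P} {I : Set ℝ} {t : ℝ}
    (hz : HasDerivWithinAt z z' I t) : HasDerivWithinAt (fun s => (z s).2) z'.2 I t :=
  (ContinuousLinearMap.snd ℝ P P).hasFDerivAt.comp_hasDerivWithinAt t hz

/-- The geodesic spray of the metric. -/
def formSpray (e : Fin 2 → P) (S : Set P) (g : P → P →L[ℝ] P →L[ℝ] ℝ) (z : P × P) : P × P :=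
  (z.2, -formChr e S g z.1 z.2 z.2)

/-- The linearization of the geodesic spray. -/
def formSprayDeriv (e : Fin 2 → P) (S : Set P) (g : P → P →L[ℝ] P →L[ℝ] ℝ) (z W : P × P) : P × P :=
  (W.2, -(formChrDeriv e S g z.1 W.1 z.2 z.2 + formChr e S g z.1 W.2 z.2
    + formChr e S g z.1 z.2 W.2))

namespace IsChartMetric

theorem contDiffOn_formSpray (h : IsChartMetric e x S g T) :
    ContDiffOn ℝ ∞ (formSpray e S g) (T ×ˢ univ) := by
  have h1 : ContDiffOn ℝ ∞ (fun z : P × P => formChr e S g z.1) (T ×ˢ univ) :=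
    h.contDiffOn_formChr.comp contDiff_fst.contDiffOn fun z hz => hz.1
  exact contDiff_snd.contDiffOn.prodMk
    ((h1.clm_apply contDiff_snd.contDiffOn).clm_apply contDiff_snd.contDiffOn).neg

theorem hasFDerivWithinAt_formSpray (h : IsChartMetric e x S g T) {z : P × P} (hz : z.1 ∈ T) :
    ∃ L : P × P →L[ℝ] P × P, (∀ W, L W = formSprayDeriv e S g z W) ∧
      HasFDerivWithinAt (formSpray e S g) L (S ×ˢ univ) z := by
  have h1 : HasFDerivWithinAt (fun z : P × P => formChr e S g z.1)
      ((formChrDeriv e S g z.1) ∘L ContinuousLinearMap.fst ℝ P P) (S ×ˢ univ) z :=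
    (h.hasFDerivWithinAt_formChr hz).comp z hasFDerivWithinAt_fst fun z hz => hz.1
  refine ⟨_, fun W => ?_, hasFDerivWithinAt_snd.prodMk
    ((h1.clm_apply hasFDerivWithinAt_snd).clm_apply hasFDerivWithinAt_snd).neg⟩
  simp only [formSprayDeriv, ContinuousLinearMap.prod_apply, Prod.mk.injEq]
  refine ⟨rfl, ?_⟩
  simp
  abel

/-- Here W is a variation of the geodesic z: its first component J is a Jacobi field, and the
vertical part W.2 + Γ(v, J) is the covariant derivative of J. Both the velocity v and the area form
are parallel, so area(v, ·) commutes with differentiation; the second derivative is area(v, R(v,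
J)v), which `area_curv` evaluates. -/
theorem hasDerivWithinAt_jacobi (h : IsChartMetric e x S g T) {I : Set ℝ} {t : ℝ}
    {z W : ℝ → P × P} (hz : HasDerivWithinAt z (formSpray e S g (z t)) I t)
    (hW : HasDerivWithinAt W (formSprayDeriv e S g (z t) (W t)) I t)
    (hzS : ∀ s ∈ I, (z s).1 ∈ S) (ht : (z t).1 ∈ T) :
    HasDerivWithinAt (fun s => formArea e x g (z s).1 (z s).2 (W s).1)
      (formArea e x g (z t).1 (z t).2 ((W t).2 + formChr e S g (z t).1 (z t).2 (W t).1)) I t ∧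
    HasDerivWithinAt (fun s => formArea e x g (z s).1 (z s).2
        ((W s).2 + formChr e S g (z s).1 (z s).2 (W s).1))
      (-(formGauss e S g (z t).1 * formArea e x g (z t).1 (z t).2 (W t).1
        * g (z t).1 (z t).2 (z t).2)) I t := by
  have hz1 : HasDerivWithinAt (fun s => (z s).1) (z t).2 I t :=
    hasDerivWithinAt_fst_comp hz
  have hz2 : HasDerivWithinAt (fun s => (z s).2) (-formChr e S g (z t).1 (z t).2 (z t).2) I t :=
    hasDerivWithinAt_snd_comp hz
  have hW1 : HasDerivWithinAt (fun s => (W s).1) (W t).2 I t :=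
    hasDerivWithinAt_fst_comp hW
  have hW2 : HasDerivWithinAt (fun s => (W s).2) (-(formChrDeriv e S g (z t).1 (W t).1 (z t).2
      (z t).2 + formChr e S g (z t).1 (W t).2 (z t).2 + formChr e S g (z t).1 (z t).2 (W t).2))
      I t :=
    hasDerivWithinAt_snd_comp hW
  have hΓ : HasDerivWithinAt (fun s => formChr e S g (z s).1)
      (formChrDeriv e S g (z t).1 (z t).2) I t :=
    (h.hasFDerivWithinAt_formChr ht).comp_hasDerivWithinAt (f := fun s => (z s).1) t hz1 hzS
  have h0 : ∀ w, formArea e x g (z t).1 0 w = 0 := fun w => by simp [formArea, coordArea]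
  constructor
  · refine (h.hasDerivWithinAt_area hz1 hzS ht hz2 hW1).congr_deriv ?_
    rw [neg_add_cancel, h0, zero_add]
  · refine (h.hasDerivWithinAt_area hz1 hzS ht hz2
      (hW2.fun_add ((hΓ.clm_apply hz2).clm_apply hW1))).congr_deriv ?_
    rw [neg_add_cancel, h0, zero_add, ← h.area_curv ht]
    congr 1
    simp only [formCurv, h.formChrDeriv_comm ht _ (W t).1, h.chr_comm ht (W t).1,
      h.chr_comm ht (W t).2, map_add, map_neg, add_apply, neg_apply]
    abel

/-- The speed of a geodesic is constant. -/
theorem hasDerivWithinAt_speed (h : IsChartMetric e x S g T) {I : Set ℝ} {t : ℝ}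
    {z : ℝ → P × P} (hz : HasDerivWithinAt z (formSpray e S g (z t)) I t)
    (hzS : ∀ s ∈ I, (z s).1 ∈ S) (ht : (z t).1 ∈ T) :
    HasDerivWithinAt (fun s => g (z s).1 (z s).2 (z s).2) 0 I t := by
  have hz1 : HasDerivWithinAt (fun s => (z s).1) (z t).2 I t :=
    hasDerivWithinAt_fst_comp hz
  have hz2 : HasDerivWithinAt (fun s => (z s).2) (-formChr e S g (z t).1 (z t).2 (z t).2) I t :=
    hasDerivWithinAt_snd_comp hz
  refine (h.hasDerivWithinAt_form hz1 hzS ht hz2 hz2).congr_deriv ?_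
  simp

end IsChartMetric

end

noncomputable section

/-! ### The metric and the Christoffel symbols in charts -/

/-- The closed half plane on which surfaces with boundary are modelled. -/
abbrev HalfPlane : Set Plane := range (𝓡∂ 2)

theorem mem_halfPlane {y : Plane} : y ∈ HalfPlane ↔ 0 ≤ y 0 := by
  rw [HalfPlane, range_modelWithCornersEuclideanHalfSpace]; rfl

theorem uniqueDiffOn_halfPlane : UniqueDiffOn ℝ HalfPlane := (𝓡∂ 2).uniqueDiffOn

theorem mem_closure_interior_halfPlane {y : Plane} (hy : y ∈ HalfPlane) :
    y ∈ closure (interior HalfPlane) := by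
  rw [(𝓡∂ 2).convex_range.closure_interior_eq_closure_of_nonempty_interior (𝓡∂ 2).nonempty_interior]
  exact subset_closure hy

variable {M : Type*} [TopologicalSpace M] [ChartedSpace (EuclideanHalfSpace 2) M]
  [IsManifold (𝓡∂ 2) ∞ M]

theorem chart_target_mem_nhdsWithin {x : M} {y : Plane} (hy : y ∈ (extChartAt (𝓡∂ 2) x).target) :
    (extChartAt (𝓡∂ 2) x).target ∈ 𝓝[HalfPlane] y :=
  extChartAt_target_mem_nhdsWithin_of_mem hy

theorem chart_target_subset (x : M) : (extChartAt (𝓡∂ 2) x).target ⊆ HalfPlane :=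
  extChartAt_target_subset_range x

/-- The trivialization of `TM` over the chart at `x₀`. -/
abbrev triv (x₀ : M) : Trivialization Plane (TotalSpace.proj : TM M → M) :=
  trivializationAt Plane (TangentSpace (𝓡∂ 2) : M → Type) x₀

theorem mem_triv_baseSet {x₀ z : M} : z ∈ (triv x₀).baseSet ↔ z ∈ (chartAt (EuclideanHalfSpace 2) x₀).source := by
  rw [TangentBundle.trivializationAt_baseSet]

theorem chart_symm_mem {x₀ : M} {y : Plane} (hy : y ∈ (extChartAt (𝓡∂ 2) x₀).target) :
    (extChartAt (𝓡∂ 2) x₀).symm y ∈ (chartAt (EuclideanHalfSpace 2) x₀).source := by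
  rw [← extChartAt_source (𝓡∂ 2)]; exact (extChartAt (𝓡∂ 2) x₀).map_target hy

theorem triv_symm_tangentCoordChange {x₀ z : M} (hz : z ∈ (chartAt (EuclideanHalfSpace 2) x₀).source)
    (u : TanM z) : (triv x₀).symm z (tangentCoordChange (𝓡∂ 2) z x₀ z u) = u := by
  exact (triv x₀).symm_apply_apply_mk (mem_triv_baseSet.2 hz) u

theorem tangentCoordChange_triv_symm {x₀ z : M} (hz : z ∈ (chartAt (EuclideanHalfSpace 2) x₀).source)
    (u : Plane) : tangentCoordChange (𝓡∂ 2) z x₀ z ((triv x₀).symm z u) = u := by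
  have := (triv x₀).apply_mk_symm (mem_triv_baseSet.2 hz) u
  exact congrArg Prod.snd this

theorem tangentCoordChange_center (x : M) (u : Plane) :
    tangentCoordChange (𝓡∂ 2) x x x u = u :=
  tangentCoordChange_self (mem_extChartAt_source x)

variable [RiemannianBundle (fun x : M => TangentSpace (𝓡∂ 2) x)]

theorem metricCoord_apply_chart {x₀ z : M} (hz : z ∈ (chartAt (EuclideanHalfSpace 2) x₀).source)
    (u w : TanM z) :
    metricCoord x₀ (extChartAt (𝓡∂ 2) x₀ z) (tangentCoordChange (𝓡∂ 2) z x₀ z u)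
      (tangentCoordChange (𝓡∂ 2) z x₀ z w) = inner ℝ u w := by
  have h : (extChartAt (𝓡∂ 2) x₀).symm (extChartAt (𝓡∂ 2) x₀ z) = z :=
    (extChartAt (𝓡∂ 2) x₀).left_inv (by rwa [extChartAt_source])
  unfold metricCoord
  rw [h]
  erw [triv_symm_tangentCoordChange hz, triv_symm_tangentCoordChange hz]

theorem metricCoord_center (x : M) (u w : TanM x) :
    metricCoord x (extChartAt (𝓡∂ 2) x x) u w = inner ℝ u w := by
  have := metricCoord_apply_chart (mem_chart_source (EuclideanHalfSpace 2) x) u w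
  erw [tangentCoordChange_center, tangentCoordChange_center] at this
  exact this

/-- The metric in the chart at `x₀`, as a bilinear form. -/
def metricForm (x₀ : M) (y : Plane) : Plane →L[ℝ] Plane →L[ℝ] ℝ :=
  LinearMap.toContinuousLinearMap
    (LinearMap.toContinuousLinearMap.toLinearMap ∘ₗ
      (innerₗ (TanM ((extChartAt (𝓡∂ 2) x₀).symm y))).compl₁₂
        ((triv x₀).symmₗ ℝ ((extChartAt (𝓡∂ 2) x₀).symm y))
        ((triv x₀).symmₗ ℝ ((extChartAt (𝓡∂ 2) x₀).symm y)))

theorem metricForm_apply {x₀ : M} {y : Plane} (hy : y ∈ (extChartAt (𝓡∂ 2) x₀).target)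
    (u w : Plane) : metricForm x₀ y u w = metricCoord x₀ y u w := by
  change inner ℝ ((triv x₀).symmₗ ℝ ((extChartAt (𝓡∂ 2) x₀).symm y) u)
    ((triv x₀).symmₗ ℝ ((extChartAt (𝓡∂ 2) x₀).symm y) w) = _
  have h := Trivialization.coe_symmₗ (R := ℝ) (triv x₀) (mem_triv_baseSet.2 (chart_symm_mem hy))
  rw [congrFun h u, congrFun h w]
  rfl

theorem metricCoord_self_pos {x₀ : M} {y : Plane} (hy : y ∈ (extChartAt (𝓡∂ 2) x₀).target)
    {u : Plane} (hu : u ≠ 0) : 0 < metricCoord x₀ y u u := by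
  have h : (triv x₀).symm ((extChartAt (𝓡∂ 2) x₀).symm y) u ≠ 0 := by
    intro h
    have h1 := tangentCoordChange_triv_symm (chart_symm_mem hy) u
    rw [h] at h1
    exact hu (by rw [← h1]; exact map_zero _)
  exact real_inner_self_pos.2 h

variable [IsContMDiffRiemannianBundle (𝓡∂ 2) ∞ Plane (fun x : M => TangentSpace (𝓡∂ 2) x)]

theorem contDiffOn_metricCoord (x₀ : M) (u w : Plane) :
    ContDiffOn ℝ ∞ (fun y => metricCoord x₀ y u w) (extChartAt (𝓡∂ 2) x₀).target := by
  have h1 : ∀ u : Plane, ContMDiffOn 𝓘(ℝ, Plane) (𝓡∂ 2).tangent ∞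
      (fun y => (⟨(extChartAt (𝓡∂ 2) x₀).symm y,
        (triv x₀).symm ((extChartAt (𝓡∂ 2) x₀).symm y) u⟩ : TM M))
      (extChartAt (𝓡∂ 2) x₀).target := by
    intro u
    have h2 : ContMDiffOn ((𝓡∂ 2).prod 𝓘(ℝ, Plane)) (𝓡∂ 2).tangent ∞ (triv x₀).toOpenPartialHomeomorph.symm
      (triv x₀).target := (triv x₀).contMDiffOn_symm
    have h3 : ContMDiffOn 𝓘(ℝ, Plane) ((𝓡∂ 2).prod 𝓘(ℝ, Plane)) ∞
        (fun y => ((extChartAt (𝓡∂ 2) x₀).symm y, u)) (extChartAt (𝓡∂ 2) x₀).target :=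
      (contMDiffOn_extChartAt_symm x₀).prodMk contMDiffOn_const
    refine (h2.comp h3 fun y hy => ?_).congr fun y hy => ?_
    · rw [mem_preimage, (triv x₀).mem_target]; exact mem_triv_baseSet.2 (chart_symm_mem hy)
    · exact (triv x₀).mk_symm (mem_triv_baseSet.2 (chart_symm_mem hy)) u
  rw [← contMDiffOn_iff_contDiffOn]
  exact ContMDiffOn.inner_bundle (F := Plane) (E := fun x : M => TangentSpace (𝓡∂ 2) x) (h1 u) (h1 w)

theorem contDiffOn_metricForm (x₀ : M) :
    ContDiffOn ℝ ∞ (metricForm x₀) (extChartAt (𝓡∂ 2) x₀).target := by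
  rw [contDiffOn_clm_apply]
  intro u
  rw [contDiffOn_clm_apply]
  exact fun w => (contDiffOn_metricCoord x₀ u w).congr fun y hy => metricForm_apply hy u w

/-- The coordinate functions of the model plane. -/
abbrev planeCoord (i : Fin 2) : Plane →L[ℝ] ℝ := EuclideanSpace.proj i

theorem isCoord_plane : IsCoord stdVec planeCoord where
  apply i j := by simp [stdVec]
  eq u := by
    ext i
    fin_cases i <;> simp [stdVec]

theorem isChartMetric (x₀ : M) : IsChartMetric stdVec planeCoord HalfPlane (metricForm x₀)
    (extChartAt (𝓡∂ 2) x₀).target where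
  coord := isCoord_plane
  unique := uniqueDiffOn_halfPlane
  closure_interior _ hy := mem_closure_interior_halfPlane hy
  subset := chart_target_subset x₀
  nhds _ hy := chart_target_mem_nhdsWithin hy
  smooth := contDiffOn_metricForm x₀
  symm y u w := real_inner_comm (F := TanM ((extChartAt (𝓡∂ 2) x₀).symm y)) _ _
  pos _ hy _ hu := by rw [metricForm_apply hy]; exact metricCoord_self_pos hy hu

/-- The Christoffel symbols in the chart at `x₀`, as a bilinear map. -/
abbrev chartChr (x₀ : M) : Plane → Plane →L[ℝ] Plane →L[ℝ] Plane :=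
  formChr stdVec HalfPlane (metricForm x₀)

/-- The geodesic spray in the chart at `x₀`. -/
abbrev chartSpray (x₀ : M) : Plane × Plane → Plane × Plane :=
  formSpray stdVec HalfPlane (metricForm x₀)

theorem gram_eq {x₀ : M} {y : Plane} (hy : y ∈ (extChartAt (𝓡∂ 2) x₀).target) :
    gram x₀ y = formGram stdVec (metricForm x₀) y := by
  ext i j
  simp [gram, formGram, metricForm_apply hy]

theorem dMetric_eq {x₀ : M} {y : Plane} (hy : y ∈ (extChartAt (𝓡∂ 2) x₀).target)
    (z u w : Plane) : dMetric x₀ y z u w = formDeriv HalfPlane (metricForm x₀) y z u w := by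
  have h := (((isChartMetric x₀).hasFDerivWithinAt hy).clm_apply
    (hasFDerivWithinAt_const u y _)).clm_apply (hasFDerivWithinAt_const w y _)
  have h3 := h.congr_of_eventuallyEq (f₁ := fun y' => metricCoord x₀ y' u w)
    (by filter_upwards [chart_target_mem_nhdsWithin hy] with y' hy' using
      (metricForm_apply hy' u w).symm) (metricForm_apply hy u w).symm
  unfold dMetric
  rw [h3.fderivWithin (uniqueDiffOn_halfPlane y (chart_target_subset x₀ hy))]
  simp

theorem christoffel_eq {x₀ : M} {y : Plane} (hy : y ∈ (extChartAt (𝓡∂ 2) x₀).target)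
    (u w : Plane) : christoffel x₀ y u w = chartChr x₀ y u w := by
  rw [formChr_apply]
  unfold christoffel
  simp only [dMetric_eq hy, gram_eq hy]

theorem christoffelAt_eq (x : M) (u w : TanM x) :
    christoffelAt x u w = chartChr x (extChartAt (𝓡∂ 2) x x) u w :=
  christoffel_eq (mem_extChartAt_target x) u w

theorem fderivWithin_christoffel {x₀ : M} {y : Plane} (hy : y ∈ (extChartAt (𝓡∂ 2) x₀).target)
    (z u w : Plane) : fderivWithin ℝ (fun y' => christoffel x₀ y' u w) HalfPlane y z
      = formChrDeriv stdVec HalfPlane (metricForm x₀) y z u w := by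
  have h := (((isChartMetric x₀).hasFDerivWithinAt_formChr hy).clm_apply
    (hasFDerivWithinAt_const u y _)).clm_apply (hasFDerivWithinAt_const w y _)
  have h3 := h.congr_of_eventuallyEq (f₁ := fun y' => christoffel x₀ y' u w)
    (by filter_upwards [chart_target_mem_nhdsWithin hy] with y' hy' using christoffel_eq hy' u w)
    (christoffel_eq hy u w)
  rw [h3.fderivWithin (uniqueDiffOn_halfPlane y (chart_target_subset x₀ hy))]
  simp

theorem curvatureAt_eq (x : M) (u w z : TanM x) : curvatureAt x u w z
    = formCurv stdVec HalfPlane (metricForm x) (extChartAt (𝓡∂ 2) x x) u w z := by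
  have hy := mem_extChartAt_target (I := 𝓡∂ 2) x
  have key : ∀ u w z : Plane,
      fderivWithin ℝ (fun y' => christoffel x y' w z) (range (𝓡∂ 2)) (extChartAt (𝓡∂ 2) x x) u
    - fderivWithin ℝ (fun y' => christoffel x y' u z) (range (𝓡∂ 2)) (extChartAt (𝓡∂ 2) x x) w
    + christoffel x (extChartAt (𝓡∂ 2) x x) u (christoffel x (extChartAt (𝓡∂ 2) x x) w z)
    - christoffel x (extChartAt (𝓡∂ 2) x x) w (christoffel x (extChartAt (𝓡∂ 2) x x) u z)
    = formCurv stdVec HalfPlane (metricForm x) (extChartAt (𝓡∂ 2) x x) u w z := fun u w z => by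
    simp only [formCurv, ← fderivWithin_christoffel hy, ← christoffel_eq hy]
  exact key u w z

theorem gaussCurvature_eq (x : M) : gaussCurvature x
    = formGauss stdVec HalfPlane (metricForm x) (extChartAt (𝓡∂ 2) x x) := by
  unfold gaussCurvature formGauss
  rw [gram_eq (mem_extChartAt_target x), metricForm_apply (mem_extChartAt_target x)]
  congr 1
  refine Eq.trans ?_ (metricCoord_center x _ _).symm
  exact congrArg (fun u : TanM x => inner ℝ u (stdVec 0 : TanM x))
    (curvatureAt_eq x (stdVec 0) (stdVec 1) (stdVec 1))

end

noncomputable section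

variable {M : Type*} [TopologicalSpace M] [ChartedSpace (EuclideanHalfSpace 2) M]
  [IsManifold (𝓡∂ 2) ∞ M]

/-! ### The chart of the tangent bundle over a chart of the surface -/

/-- The chart of `TM` over the chart at `x₀`. -/
abbrev tchart (x₀ : M) : PartialEquiv (TM M) (Plane × Plane) :=
  extChartAt (𝓡∂ 2).tangent (⟨x₀, 0⟩ : TM M)

theorem tchart_apply (x₀ : M) (p : TM M) : tchart x₀ p
    = (extChartAt (𝓡∂ 2) x₀ p.1, tangentCoordChange (𝓡∂ 2) p.1 x₀ p.1 p.2) := rfl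

theorem tchart_source (x₀ : M) : (tchart x₀).source
    = {p : TM M | p.1 ∈ (chartAt (EuclideanHalfSpace 2) x₀).source} := by
  rw [extChartAt_source]
  ext p
  exact TangentBundle.mem_chart_source_iff p ⟨x₀, 0⟩

theorem mem_tchart_source {x₀ : M} {p : TM M} : p ∈ (tchart x₀).source
    ↔ p.1 ∈ (chartAt (EuclideanHalfSpace 2) x₀).source := by
  rw [tchart_source]; rfl

theorem tchart_target (x₀ : M) : (tchart x₀).target = (extChartAt (𝓡∂ 2) x₀).target ×ˢ univ := by
  have := FiberBundle.extChartAt_target (IB := 𝓡∂ 2) (F := Plane)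
    (E := (TangentSpace (𝓡∂ 2) : M → Type)) (⟨x₀, 0⟩ : TM M)
  rw [tchart, this]
  ext z
  simp only [mem_prod, mem_inter_iff, mem_preimage, mem_univ, and_true]
  exact ⟨fun h => h.1, fun h => ⟨h, mem_triv_baseSet.2 (chart_symm_mem h)⟩⟩

theorem range_tangent : range (𝓡∂ 2).tangent = HalfPlane ×ˢ (univ : Set Plane) := by
  ext z
  constructor
  · rintro ⟨a, rfl⟩
    exact ⟨⟨a.1, rfl⟩, mem_univ _⟩
  · rintro ⟨⟨a, ha⟩, -⟩
    exact ⟨(a, z.2), Prod.ext ha rfl⟩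

theorem tchart_symm_fst {x₀ : M} {z : Plane × Plane} (hz : z.1 ∈ (extChartAt (𝓡∂ 2) x₀).target) :
    ((tchart x₀).symm z).1 = (extChartAt (𝓡∂ 2) x₀).symm z.1 := by
  have h1 : z ∈ (tchart x₀).target := by rw [tchart_target]; exact ⟨hz, mem_univ _⟩
  have h2 := congrArg Prod.fst ((tchart x₀).right_inv h1)
  have h3 := (tchart x₀).map_target h1
  rw [tchart_source] at h3
  rw [tchart_apply] at h2
  simp only at h2
  rw [← h2, (extChartAt (𝓡∂ 2) x₀).left_inv (by rwa [extChartAt_source])]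

theorem mem_extChartAt_target_of_mem_source {x₀ : M} {p : TM M} (hp : p ∈ (tchart x₀).source) :
    (tchart x₀ p).1 ∈ (extChartAt (𝓡∂ 2) x₀).target := by
  have := (tchart x₀).map_source hp
  rw [tchart_target] at this
  exact this.1

/-- The change of coordinates from the chart at `x` to the chart at `x₀`. -/
abbrev transition (x x₀ : M) : Plane → Plane := extChartAt (𝓡∂ 2) x₀ ∘ (extChartAt (𝓡∂ 2) x).symm

theorem mapsTo_transition (x x₀ : M) : MapsTo (transition x x₀) HalfPlane HalfPlane :=
  fun _ _ => mem_range_self _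

/-- The points of the chart at `x` that lie in the chart at `x₀`. -/
def overlap (x x₀ : M) : Set Plane :=
  (extChartAt (𝓡∂ 2) x).target ∩
    (extChartAt (𝓡∂ 2) x).symm ⁻¹' (chartAt (EuclideanHalfSpace 2) x₀).source

theorem overlap_mem_nhdsWithin {x x₀ : M} {y : Plane} (hy : y ∈ overlap x x₀) :
    overlap x x₀ ∈ 𝓝[HalfPlane] y := by
  refine Filter.inter_mem (chart_target_mem_nhdsWithin hy.1) ?_
  have h1 : ContinuousWithinAt (extChartAt (𝓡∂ 2) x).symm (extChartAt (𝓡∂ 2) x).target y :=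
    continuousOn_extChartAt_symm x y hy.1
  have h2 := h1.preimage_mem_nhdsWithin
    ((chartAt (EuclideanHalfSpace 2) x₀).open_source.mem_nhds hy.2)
  rwa [nhdsWithin_extChartAt_target_eq_of_mem hy.1] at h2

theorem contDiffWithinAt_transition {x x₀ : M} {y : Plane} (hy : y ∈ overlap x x₀) :
    ContDiffWithinAt ℝ ∞ (transition x x₀) HalfPlane y := by
  refine contDiffWithinAt_ext_coord_change x₀ x ?_
  rw [PartialEquiv.trans_source, PartialEquiv.symm_source, extChartAt_source]
  exact hy

theorem fderivWithin_transition {x x₀ : M} {y : Plane} (hy : y ∈ overlap x x₀) :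
    fderivWithin ℝ (transition x x₀) HalfPlane y
      = tangentCoordChange (𝓡∂ 2) x x₀ ((extChartAt (𝓡∂ 2) x).symm y) := by
  rw [tangentCoordChange_def, (extChartAt (𝓡∂ 2) x).right_inv hy.1]

theorem fderivWithin_transition_apply {x x₀ : M} {y : Plane} (hy : y ∈ overlap x x₀) (u : Plane) :
    fderivWithin ℝ (transition x x₀) HalfPlane y u
      = tangentCoordChange (𝓡∂ 2) ((extChartAt (𝓡∂ 2) x).symm y) x₀ ((extChartAt (𝓡∂ 2) x).symm y)
        ((triv x).symm ((extChartAt (𝓡∂ 2) x).symm y) u) := by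
  rw [fderivWithin_transition hy]
  have hz := chart_symm_mem hy.1
  set z := (extChartAt (𝓡∂ 2) x).symm y
  conv_lhs => rw [← tangentCoordChange_triv_symm hz u]
  refine tangentCoordChange_comp ⟨⟨mem_extChartAt_source z, ?_⟩, ?_⟩
  · rwa [extChartAt_source]
  · rw [extChartAt_source]; exact hy.2

theorem tchart_transition {x x₀ : M} {z : Plane × Plane} (hz : z.1 ∈ overlap x x₀) :
    tchart x₀ ((tchart x).symm z)
      = (transition x x₀ z.1, fderivWithin ℝ (transition x x₀) HalfPlane z.1 z.2) := by
  have h1 : z ∈ (tchart x).target := by rw [tchart_target]; exact ⟨hz.1, mem_univ _⟩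
  have h2 := congrArg Prod.snd ((tchart x).right_inv h1)
  have h3 := tchart_symm_fst hz.1
  have h4 := (tchart x).map_target h1
  rw [mem_tchart_source] at h4
  rw [tchart_apply] at h2 ⊢
  simp only at h2
  rw [fderivWithin_transition hz, ← h3]
  refine Prod.ext (congrArg (extChartAt (𝓡∂ 2) x₀) h3) ?_
  rw [← h2]
  refine (tangentCoordChange_comp ⟨⟨mem_extChartAt_source _, ?_⟩, ?_⟩).symm
  · rwa [extChartAt_source]
  · rw [extChartAt_source, h3]; exact hz.2

theorem extChartAt_mem_overlap {x₀ x : M} (hx : x ∈ (chartAt (EuclideanHalfSpace 2) x₀).source) :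
    extChartAt (𝓡∂ 2) x x ∈ overlap x x₀ :=
  ⟨mem_extChartAt_target x, by rwa [mem_preimage, extChartAt_to_inv]⟩

theorem hasFDerivWithinAt_tchart_transition {x x₀ : M} {z : Plane × Plane}
    (hz : z.1 ∈ overlap x x₀) : ∃ L : Plane × Plane →L[ℝ] Plane × Plane,
    (∀ W, L W = (fderivWithin ℝ (transition x x₀) HalfPlane z.1 W.1,
      fderivWithin ℝ (fderivWithin ℝ (transition x x₀) HalfPlane) HalfPlane z.1 W.1 z.2
        + fderivWithin ℝ (transition x x₀) HalfPlane z.1 W.2)) ∧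
    HasFDerivWithinAt (tchart x₀ ∘ (tchart x).symm) L (range (𝓡∂ 2).tangent) z := by
  have hzS : z.1 ∈ HalfPlane := chart_target_subset x hz.1
  have hφ := contDiffWithinAt_transition hz
  have h1 : HasFDerivWithinAt (fun z : Plane × Plane => transition x x₀ z.1)
      (fderivWithin ℝ (transition x x₀) HalfPlane z.1 ∘L ContinuousLinearMap.fst ℝ Plane Plane)
      (HalfPlane ×ˢ univ) z :=
    (hφ.differentiableWithinAt (by simp)).hasFDerivWithinAt.comp z hasFDerivWithinAt_fst
      fun z hz => hz.1
  have h2 : HasFDerivWithinAt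
      (fun z : Plane × Plane => fderivWithin ℝ (transition x x₀) HalfPlane z.1)
      (fderivWithin ℝ (fderivWithin ℝ (transition x x₀) HalfPlane) HalfPlane z.1
        ∘L ContinuousLinearMap.fst ℝ Plane Plane) (HalfPlane ×ˢ univ) z :=
    HasFDerivWithinAt.comp z
      ((hφ.fderivWithin_right (m := ∞) uniqueDiffOn_halfPlane (by simp)
        hzS).differentiableWithinAt (by simp)).hasFDerivWithinAt hasFDerivWithinAt_fst
      fun z hz => hz.1
  have h3 := h1.prodMk (h2.clm_apply hasFDerivWithinAt_snd)
  rw [range_tangent]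
  refine ⟨_, fun W => ?_, h3.congr_of_eventuallyEq ?_ (tchart_transition hz)⟩
  · refine Prod.ext rfl ?_
    simp [add_comm]
  · have : overlap x x₀ ×ˢ univ ∈ 𝓝[HalfPlane ×ˢ (univ : Set Plane)] z := by
      rw [← Prod.mk.eta (p := z), nhdsWithin_prod_eq]
      exact Filter.prod_mem_prod (overlap_mem_nhdsWithin hz) Filter.univ_mem
    filter_upwards [this] with z' hz' using tchart_transition hz'.1

variable [RiemannianBundle (fun x : M => TangentSpace (𝓡∂ 2) x)]
  [IsContMDiffRiemannianBundle (𝓡∂ 2) ∞ Plane (fun x : M => TangentSpace (𝓡∂ 2) x)]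

theorem metricForm_transition {x x₀ : M} {y : Plane} (hy : y ∈ overlap x x₀) (u w : Plane) :
    metricForm x y u w = metricForm x₀ (transition x x₀ y)
      (fderivWithin ℝ (transition x x₀) HalfPlane y u)
      (fderivWithin ℝ (transition x x₀) HalfPlane y w) := by
  have h1 : transition x x₀ y ∈ (extChartAt (𝓡∂ 2) x₀).target :=
    (extChartAt (𝓡∂ 2) x₀).map_source (by rw [extChartAt_source]; exact hy.2)
  rw [metricForm_apply hy.1, metricForm_apply h1, fderivWithin_transition_apply hy,
    fderivWithin_transition_apply hy]
  exact (metricCoord_apply_chart hy.2 _ _).symm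

/-- The second derivative of the transition map, which appears because the fibre coordinate is moved
by a derivative depending on the base point, cancels the inhomogeneous term of the transformation
law `map_formChr`. Hence the spray is a well-defined vector field on TM. -/
theorem chartSpray_transition {x x₀ : M} (hx : x ∈ (chartAt (EuclideanHalfSpace 2) x₀).source)
    (v : Plane) : ∃ L : Plane × Plane →L[ℝ] Plane × Plane,
    HasFDerivWithinAt (tchart x₀ ∘ (tchart x).symm) L (range (𝓡∂ 2).tangent)
      (extChartAt (𝓡∂ 2) x x, v) ∧
    L (v, -chartChr x (extChartAt (𝓡∂ 2) x x) v v)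
      = chartSpray x₀ (tchart x₀ ((tchart x).symm (extChartAt (𝓡∂ 2) x x, v))) := by
  have hy := extChartAt_mem_overlap hx
  obtain ⟨L, hL, hL'⟩ := hasFDerivWithinAt_tchart_transition
    (z := (extChartAt (𝓡∂ 2) x x, v)) hy
  have h2 := (isChartMetric x).map_formChr (isChartMetric x₀) (mem_extChartAt_target x)
    (contDiffWithinAt_transition hy) (mapsTo_transition x x₀)
    ((extChartAt (𝓡∂ 2) x₀).map_source (by rw [extChartAt_source]; exact hy.2))
    (by filter_upwards [overlap_mem_nhdsWithin hy] with y' hy' using metricForm_transition hy')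
    v v
  refine ⟨L, hL', ?_⟩
  rw [hL, tchart_transition (z := (extChartAt (𝓡∂ 2) x x, v)) hy]
  refine Prod.ext rfl ?_
  simp only [map_neg, h2, formSpray]
  abel

theorem tchart_self (p : TM M) : tchart p.1 p = (extChartAt (𝓡∂ 2) p.1 p.1, p.2) :=
  Prod.ext rfl (tangentCoordChange_center p.1 p.2)

theorem geodesicField_eq (p : TM M) : geodesicField p
    = ((p.2, -chartChr p.1 (extChartAt (𝓡∂ 2) p.1 p.1) p.2 p.2) : Plane × Plane) :=
  Prod.ext rfl (congrArg (fun u : Plane => -u) (christoffelAt_eq p.1 p.2 p.2))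

/-- In the chart at `x₀`, the geodesic field is the geodesic spray. -/
theorem tangentCoordChange_geodesicField {x₀ : M} {p : TM M} (hp : p ∈ (tchart x₀).source) :
    tangentCoordChange (𝓡∂ 2).tangent p ⟨x₀, 0⟩ p (geodesicField p)
      = chartSpray x₀ (tchart x₀ p) := by
  obtain ⟨L, hL, hL'⟩ := chartSpray_transition (mem_tchart_source.1 hp) p.2
  have h1 : (tchart p.1).symm (extChartAt (𝓡∂ 2) p.1 p.1, p.2) = p :=
    (congrArg (tchart p.1).symm (tchart_self p).symm).trans
      ((tchart p.1).left_inv (mem_tchart_source.2 (mem_chart_source _ _)))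
  rw [h1] at hL'
  have h2 : fderivWithin ℝ (tchart x₀ ∘ (tchart p.1).symm) (range (𝓡∂ 2).tangent) (tchart p.1 p)
      = L := by
    rw [tchart_self]
    exact hL.fderivWithin ((𝓡∂ 2).tangent.uniqueDiffOn _ ⟨_, tchart_self p⟩)
  rw [geodesicField_eq, tangentCoordChange_def]
  exact (congrArg (fun L : Plane × Plane →L[ℝ] Plane × Plane =>
    L (p.2, -chartChr p.1 (extChartAt (𝓡∂ 2) p.1 p.1) p.2 p.2)) h2).trans hL'

end

noncomputable section

variable {M : Type*} [TopologicalSpace M] [ChartedSpace (EuclideanHalfSpace 2) M]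
  [IsManifold (𝓡∂ 2) ∞ M]

/-! ### Geodesics in charts -/

theorem hasMFDerivAt_tchart {x₀ : M} {p : TM M} (hp : p ∈ (tchart x₀).source) :
    HasMFDerivAt (𝓡∂ 2).tangent 𝓘(ℝ, Plane × Plane) (tchart x₀) p
      (tangentCoordChange (𝓡∂ 2).tangent p ⟨x₀, 0⟩ p) := by
  have hp' : p ∈ (chartAt (ModelProd (EuclideanHalfSpace 2) Plane) (⟨x₀, 0⟩ : TM M)).source := by
    rwa [← extChartAt_source (𝓡∂ 2).tangent]
  rw [← mfderiv_chartAt_eq_tangentCoordChange (I := (𝓡∂ 2).tangent) hp']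
  exact hasMFDerivAt_extChartAt hp'

theorem tangentCoordChange_tangent_symm {x₀ : M} {p : TM M} (hp : p ∈ (tchart x₀).source)
    (X : Plane × Plane) : tangentCoordChange (𝓡∂ 2).tangent ⟨x₀, 0⟩ p p
      (tangentCoordChange (𝓡∂ 2).tangent p ⟨x₀, 0⟩ p X) = X := by
  rw [tangentCoordChange_comp ⟨⟨mem_extChartAt_source p, hp⟩, mem_extChartAt_source p⟩,
    tangentCoordChange_self (mem_extChartAt_source p)]

theorem hasMFDerivWithinAt_tchart_symm_comp {x₀ : M} {ζ : ℝ → Plane × Plane} {I : Set ℝ} {t : ℝ}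
    {Z : Plane × Plane} (hζ : HasDerivWithinAt ζ Z I t) (hζt : ∀ s ∈ I, ζ s ∈ (tchart x₀).target)
    (ht : t ∈ I) :
    HasMFDerivWithinAt 𝓘(ℝ, ℝ) (𝓡∂ 2).tangent (fun s => (tchart x₀).symm (ζ s)) I t
      ((1 : ℝ →L[ℝ] ℝ).smulRight (tangentCoordChange (𝓡∂ 2).tangent ⟨x₀, 0⟩
        ((tchart x₀).symm (ζ t)) ((tchart x₀).symm (ζ t)) Z)) := by
  set p := (tchart x₀).symm (ζ t) with hp
  have hps : p ∈ (tchart x₀).source := (tchart x₀).map_target (hζt t ht)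
  refine ⟨?_, ?_⟩
  · exact (continuousOn_extChartAt_symm _ _ (hζt t ht)).comp hζ.continuousWithinAt hζt
  · have h1 := hasFDerivWithinAt_tangentCoordChange (I := (𝓡∂ 2).tangent) (x := (⟨x₀, 0⟩ : TM M))
      (y := p) (z := p) ⟨hps, mem_extChartAt_source p⟩
    have h2 : tchart x₀ p = ζ t := (tchart x₀).right_inv (hζt t ht)
    rw [h2] at h1
    have h3 := h1.comp_hasDerivWithinAt t hζ (fun s hs => by
      have := hζt s hs
      exact extChartAt_target_subset_range _ this)
    have h4 : HasFDerivWithinAt (fun s => tchart p.1 ((tchart x₀).symm (ζ s)))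
        ((1 : ℝ →L[ℝ] ℝ).smulRight (tangentCoordChange (𝓡∂ 2).tangent ⟨x₀, 0⟩ p p Z)) I t :=
      h3.hasFDerivWithinAt.congr_fderiv (by apply ContinuousLinearMap.ext_ring; simp)
    exact HasFDerivWithinAt.mono (t := I) h4 fun s hs => hs.1

variable [RiemannianBundle (fun x : M => TangentSpace (𝓡∂ 2) x)]
  [IsContMDiffRiemannianBundle (𝓡∂ 2) ∞ Plane (fun x : M => TangentSpace (𝓡∂ 2) x)]

/-- An integral curve is defined through the preferred chart at each of its own points; this passes
to one fixed chart, where the theory of ordinary differential equations applies. -/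
theorem hasDerivWithinAt_tchart {c : ℝ → TM M} {I : Set ℝ} (hc : IsMIntegralCurveOn c geodesicField I)
    {t : ℝ} (ht : t ∈ I) {x₀ : M} (hx₀ : c t ∈ (tchart x₀).source) :
    HasDerivWithinAt (fun s => tchart x₀ (c s)) (chartSpray x₀ (tchart x₀ (c t))) I t := by
  have h := ((hasMFDerivAt_tchart hx₀).comp_hasMFDerivWithinAt t (hc t ht)).hasFDerivWithinAt
  have h' : HasFDerivWithinAt (fun s => tchart x₀ (c s))
      ((tangentCoordChange (𝓡∂ 2).tangent (c t) ⟨x₀, 0⟩ (c t)) ∘L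
        ((1 : ℝ →L[ℝ] ℝ).smulRight (geodesicField (c t) : Plane × Plane))) I t := h
  rw [← tangentCoordChange_geodesicField hx₀]
  refine h'.hasDerivWithinAt.congr_deriv ?_
  rw [ContinuousLinearMap.comp_apply]
  exact congrArg _ (one_smul ℝ (geodesicField (c t) : Plane × Plane))

theorem isMIntegralCurveOn_of_hasDerivWithinAt {x₀ : M} {ζ : ℝ → Plane × Plane} {I : Set ℝ}
    (hζ : ∀ t ∈ I, HasDerivWithinAt ζ (chartSpray x₀ (ζ t)) I t)
    (hζt : ∀ s ∈ I, ζ s ∈ (tchart x₀).target) :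
    IsMIntegralCurveOn (fun s => (tchart x₀).symm (ζ s)) geodesicField I := by
  intro t ht
  have h := hasMFDerivWithinAt_tchart_symm_comp (hζ t ht) hζt ht
  have hps : (tchart x₀).symm (ζ t) ∈ (tchart x₀).source := (tchart x₀).map_target (hζt t ht)
  have h2 := tangentCoordChange_geodesicField hps
  rw [(tchart x₀).right_inv (hζt t ht)] at h2
  have h3 := tangentCoordChange_tangent_symm hps (geodesicField ((tchart x₀).symm (ζ t)))
  rw [h2] at h3
  rw [h3] at h
  exact h

end

noncomputable section

variable {M : Type*} [TopologicalSpace M] [ChartedSpace (EuclideanHalfSpace 2) M]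
  [IsManifold (𝓡∂ 2) ∞ M]

/-! ### Uniqueness of geodesics -/

theorem continuousAt_tchart {x₀ : M} {p : TM M} (hp : p ∈ (tchart x₀).source) :
    ContinuousAt (tchart x₀) p :=
  continuousAt_extChartAt' hp

theorem tchart_source_mem_nhds {x₀ : M} {p : TM M} (hp : p ∈ (tchart x₀).source) :
    (tchart x₀).source ∈ 𝓝 p :=
  (isOpen_extChartAt_source _).mem_nhds hp

theorem mem_tchart_source_self (p : TM M) : p ∈ (tchart p.1).source :=
  mem_tchart_source.2 (mem_chart_source _ _)

theorem continuous_proj_TM : Continuous (fun p : TM M => p.1) :=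
  FiberBundle.continuous_proj Plane (TangentSpace (𝓡∂ 2) : M → Type)

/-- Vectors over different points are separated by the base, vectors over the same point by a chart.
The Hausdorff property makes the set where two geodesics agree closed. -/
instance t2Space_TM [T2Space M] : T2Space (TM M) := by
  refine ⟨fun p q hpq => ?_⟩
  by_cases h : p.1 = q.1
  · have hp := mem_tchart_source_self p
    have hq : q ∈ (tchart p.1).source := by rw [h]; exact mem_tchart_source_self q
    have hne : tchart p.1 p ≠ tchart p.1 q := fun h => hpq ((tchart p.1).injOn hp hq h)
    obtain ⟨U, V, hU, hV, hpU, hqV, hUV⟩ := t2_separation hne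
    have hc := continuousOn_extChartAt (I := (𝓡∂ 2).tangent) (⟨p.1, 0⟩ : TM M)
    refine ⟨_, _, hc.isOpen_inter_preimage (isOpen_extChartAt_source _) hU,
      hc.isOpen_inter_preimage (isOpen_extChartAt_source _) hV, ⟨hp, hpU⟩, ⟨hq, hqV⟩, ?_⟩
    exact Set.disjoint_left.2 fun z hz hz' => Set.disjoint_left.1 hUV hz.2 hz'.2
  · obtain ⟨U, V, hU, hV, hpU, hqV, hUV⟩ := t2_separation h
    exact ⟨_, _, hU.preimage continuous_proj_TM, hV.preimage continuous_proj_TM, hpU, hqV,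
      hUV.preimage _⟩

/-- The first coordinate of the base point, which vanishes on the boundary. -/
def boundaryCoord : Plane × Plane →L[ℝ] ℝ :=
  planeCoord 0 ∘L ContinuousLinearMap.fst ℝ Plane Plane

theorem boundaryCoord_apply (z : Plane × Plane) : boundaryCoord z = z.1 0 := rfl

/-- A vector transverse to the boundary. -/
def transverseVec : Plane × Plane := (stdVec 0, 0)

theorem boundaryCoord_transverseVec : boundaryCoord transverseVec = 1 := by
  simp [boundaryCoord_apply, transverseVec, stdVec]

theorem mem_halfPlane_prod {z : Plane × Plane} :
    z ∈ HalfPlane ×ˢ (univ : Set Plane) ↔ 0 ≤ boundaryCoord z := by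
  rw [mem_prod, mem_halfPlane]
  simp [boundaryCoord_apply]

theorem tchart_mem_halfPlane {x₀ : M} {p : TM M} : 0 ≤ boundaryCoord (tchart x₀ p) :=
  mem_halfPlane_prod.1 (range_tangent ▸ mem_range_self _)

variable [RiemannianBundle (fun x : M => TangentSpace (𝓡∂ 2) x)]
  [IsContMDiffRiemannianBundle (𝓡∂ 2) ∞ Plane (fun x : M => TangentSpace (𝓡∂ 2) x)]

theorem contDiffWithinAt_chartSpray {x₀ : M} {z : Plane × Plane} (hz : z ∈ (tchart x₀).target) :
    ContDiffWithinAt ℝ ∞ (chartSpray x₀) (HalfPlane ×ˢ univ) z := by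
  rw [tchart_target] at hz
  refine ((isChartMetric x₀).contDiffOn_formSpray z hz).mono_of_mem_nhdsWithin ?_
  rw [← Prod.mk.eta (p := z), nhdsWithin_prod_eq]
  exact Filter.prod_mem_prod (chart_target_mem_nhdsWithin hz.1) Filter.univ_mem

/-- The geodesic spray extends across the boundary of the half plane. -/
theorem exists_extension_chartSpray {x₀ : M} {z : Plane × Plane} (hz : z ∈ (tchart x₀).target) :
    ∃ f : Plane × Plane → Plane × Plane, ContDiffAt ℝ 1 f z ∧
      ∀ z', 0 ≤ boundaryCoord z' → f z' = chartSpray x₀ z' := by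
  have h := (contDiffWithinAt_chartSpray hz).of_le (m := 1) ENat.LEInfty.out
  have hS : HalfPlane ×ˢ (univ : Set Plane) = {z | 0 ≤ boundaryCoord z} := by
    ext z; exact mem_halfPlane_prod
  rw [hS] at h
  have h0 : 0 ≤ boundaryCoord z := by
    rw [tchart_target] at hz
    exact mem_halfPlane_prod.1 ⟨chart_target_subset x₀ hz.1, mem_univ _⟩
  rcases h0.eq_or_lt with h0 | h0
  · exact exists_contDiffAt_extension boundaryCoord_transverseVec h0.symm h
  · refine ⟨chartSpray x₀, h.contDiffAt ?_, fun _ _ => rfl⟩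
    filter_upwards [(isOpen_lt continuous_const boundaryCoord.continuous).mem_nhds h0] with z' hz'
      using hz'.le

/-- In a chart both curves take values in the half plane, so they also solve the equation of the C¹,
hence locally Lipschitz, extension of the spray. This covers boundary points and endpoints of the
interval. -/
theorem eventually_eq_of_geodesic {c c' : ℝ → TM M} {a b t : ℝ} (ht : t ∈ Icc a b)
    (hc : IsMIntegralCurveOn c geodesicField (Icc a b))
    (hc' : IsMIntegralCurveOn c' geodesicField (Icc a b)) (h : c t = c' t) :
    ∀ᶠ s in 𝓝[Icc a b] t, c s = c' s := by
  set x₀ := (c t).1 with hx₀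
  have hs := mem_tchart_source_self (c t)
  have hs' : c' t ∈ (tchart x₀).source := h ▸ hs
  obtain ⟨f, hf, hf'⟩ := exists_extension_chartSpray ((tchart x₀).map_source hs)
  obtain ⟨K, U, hU, hK⟩ := hf.exists_lipschitzOnWith
  have key : ∀ γ : ℝ → TM M, IsMIntegralCurveOn γ geodesicField (Icc a b) → γ t = c t →
      ∀ᶠ s in 𝓝[Icc a b] t, γ s ∈ (tchart x₀).source ∧ tchart x₀ (γ s) ∈ U := by
    intro γ hγ hγt
    have h1 : ContinuousWithinAt γ (Icc a b) t := hγ.continuousWithinAt ht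
    have h2 : ContinuousAt (tchart x₀) (γ t) := continuousAt_tchart (hγt ▸ hs)
    exact (Filter.Tendsto.eventually_mem h1 (tchart_source_mem_nhds (hγt ▸ hs))).and
      (Filter.Tendsto.eventually_mem (h2.comp_continuousWithinAt h1)
        (by rw [Function.comp_apply, hγt]; exact hU))
  obtain ⟨δ, hδ, hδ'⟩ := Metric.mem_nhdsWithin_iff.1 ((key c hc rfl).and (key c' hc' h.symm))
  have hball : Metric.ball t δ ∩ Icc a b ∈ 𝓝[Icc a b] t :=
    Filter.inter_mem (mem_nhdsWithin_of_mem_nhds (Metric.ball_mem_nhds t hδ)) self_mem_nhdsWithin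
  filter_upwards [hball] with s hs
  have hsub : uIcc t s ⊆ Metric.ball t δ ∩ Icc a b := by
    intro u hu
    refine ⟨?_, (ordConnected_Icc.uIcc_subset ht hs.2) hu⟩
    exact (Real.ball_eq_Ioo t δ ▸ ordConnected_Ioo).uIcc_subset (Metric.mem_ball_self hδ) hs.1 hu
  have hd : ∀ γ : ℝ → TM M, IsMIntegralCurveOn γ geodesicField (Icc a b) →
      (∀ u ∈ uIcc t s, γ u ∈ (tchart x₀).source) → ∀ u ∈ uIcc t s,
      HasDerivWithinAt (fun u => tchart x₀ (γ u)) (f (tchart x₀ (γ u))) (uIcc t s) u := by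
    intro γ hγ hγs u hu
    rw [hf' _ tchart_mem_halfPlane]
    exact (hasDerivWithinAt_tchart hγ (hsub hu).2 (hγs u hu)).mono fun u hu => (hsub hu).2
  have := eqOn_Icc_of_hasDerivWithinAt hK (left_mem_uIcc (a := t) (b := s))
    (hd c hc fun u hu => (hδ' (hsub hu)).1.1) (fun u hu => (hδ' (hsub hu)).1.2)
    (hd c' hc' fun u hu => (hδ' (hsub hu)).2.1) (fun u hu => (hδ' (hsub hu)).2.2) (by rw [h])
  exact (tchart x₀).injOn (hδ' hs).1.1 (hδ' hs).2.1 (this right_mem_uIcc)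

/-- The set of agreement is relatively open by `eventually_eq_of_geodesic` and relatively closed
because TM is Hausdorff; the interval is connected. -/
theorem eqOn_of_geodesic [T2Space M] {c c' : ℝ → TM M} {a b t : ℝ} (ht : t ∈ Icc a b)
    (hc : IsMIntegralCurveOn c geodesicField (Icc a b))
    (hc' : IsMIntegralCurveOn c' geodesicField (Icc a b)) (h : c t = c' t) :
    EqOn c c' (Icc a b) := by
  intro s hs
  refine (isPreconnected_Icc.induction₂ (fun s t => c s = c' s ↔ c t = c' t) (fun u hu => ?_)
    (fun _ _ _ _ _ _ => Iff.trans) (fun _ _ _ _ => Iff.symm) ht hs).1 h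
  by_cases hu' : c u = c' u
  · filter_upwards [eventually_eq_of_geodesic hu hc hc' hu'] with v hv
    simp [hu', hv]
  · have h1 := ((hc.continuousWithinAt hu).prodMk_nhds (hc'.continuousWithinAt hu))
    have h2 : {q : TM M × TM M | q.1 ≠ q.2} ∈ 𝓝 (c u, c' u) :=
      isOpen_ne_fun continuous_fst continuous_snd |>.mem_nhds hu'
    filter_upwards [h1 h2] with v hv
    simp only [hu', false_iff]
    exact hv

end

noncomputable section

variable {M : Type*} [TopologicalSpace M] [ChartedSpace (EuclideanHalfSpace 2) M]
  [IsManifold (𝓡∂ 2) ∞ M]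

/-! ### Operations on geodesics -/

/-- The reversal of the velocity. -/
def negTM (p : TM M) : TM M := ⟨p.1, -p.2⟩

theorem negTM_fst (p : TM M) : (negTM p).1 = p.1 := rfl

theorem negTM_negTM (p : TM M) : negTM (negTM p) = p := by
  obtain ⟨x, v⟩ := p
  exact congrArg (fun w => (⟨x, w⟩ : TM M)) (neg_neg v)

theorem tchart_negTM (x₀ : M) (p : TM M) :
    tchart x₀ (negTM p) = ((tchart x₀ p).1, -(tchart x₀ p).2) :=
  Prod.ext rfl (map_neg (tangentCoordChange (𝓡∂ 2) p.1 x₀ p.1) p.2)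

theorem continuous_negTM : Continuous (negTM : TM M → TM M) := by
  refine continuous_iff_continuousAt.2 fun p => ?_
  rw [FiberBundle.continuousAt_totalSpace (F := Plane)]
  refine ⟨continuous_proj_TM.continuousAt, ?_⟩
  have h : ContinuousAt (fun q : TM M => -(tchart p.1 q).2) p :=
    (continuous_snd.continuousAt.comp (continuousAt_tchart (mem_tchart_source_self p))).neg
  exact h.congr (Filter.Eventually.of_forall fun q => congrArg Prod.snd (tchart_negTM p.1 q).symm)

variable [RiemannianBundle (fun x : M => TangentSpace (𝓡∂ 2) x)]
  [IsContMDiffRiemannianBundle (𝓡∂ 2) ∞ Plane (fun x : M => TangentSpace (𝓡∂ 2) x)]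

theorem formSpray_neg (x₀ : M) (y v : Plane) : chartSpray x₀ (y, -v)
    = (-(chartSpray x₀ (y, v)).1, (chartSpray x₀ (y, v)).2) := by
  simp [formSpray]

theorem geodesicField_eq_chartSpray (p : TM M) :
    (geodesicField p : Plane × Plane) = chartSpray p.1 (tchart p.1 p) := by
  rw [← tangentCoordChange_geodesicField (mem_tchart_source_self p)]
  exact (tangentCoordChange_self (I := (𝓡∂ 2).tangent) (mem_extChartAt_source p)).symm

theorem isMIntegralCurveOn_of_tchart {c : ℝ → TM M} {I : Set ℝ} (hc : ContinuousOn c I)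
    (h : ∀ t ∈ I, HasDerivWithinAt (fun s => tchart (c t).1 (c s))
      (chartSpray (c t).1 (tchart (c t).1 (c t))) I t) :
    IsMIntegralCurveOn c geodesicField I := by
  intro t ht
  refine ⟨hc t ht, ?_⟩
  have h1 := h t ht
  rw [← geodesicField_eq_chartSpray] at h1
  have h4 : HasFDerivWithinAt (fun s => tchart (c t).1 (c s))
      ((1 : ℝ →L[ℝ] ℝ).smulRight (geodesicField (c t) : Plane × Plane)) I t :=
    h1.hasFDerivWithinAt.congr_fderiv (by
      apply ContinuousLinearMap.ext_ring
      rfl)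
  exact HasFDerivWithinAt.mono (t := I) h4 fun s hs => hs.1

theorem isMIntegralCurveOn_congr {c c' : ℝ → TM M} {I : Set ℝ}
    (hc : IsMIntegralCurveOn c geodesicField I) (h : EqOn c' c I) :
    IsMIntegralCurveOn c' geodesicField I := by
  refine isMIntegralCurveOn_of_tchart (hc.continuousOn.congr h) fun t ht => ?_
  rw [h ht]
  exact (hasDerivWithinAt_tchart hc ht (mem_tchart_source_self _)).congr
    (fun s hs => by rw [h hs]) (by rw [h ht])

/-- Christoffel symbols enter the spray quadratically in the velocity, so reversing time and
velocity together preserves the equation. -/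
theorem isMIntegralCurveOn_reverse {c : ℝ → TM M} {I : Set ℝ}
    (hc : IsMIntegralCurveOn c geodesicField I) (a : ℝ) :
    IsMIntegralCurveOn (fun s => negTM (c (a - s))) geodesicField ((fun s => a - s) ⁻¹' I) := by
  refine isMIntegralCurveOn_of_tchart ?_ fun t ht => ?_
  · exact continuous_negTM.comp_continuousOn (hc.continuousOn.comp (by fun_prop) fun s hs => hs)
  · rw [negTM_fst]
    have h1 := hasDerivWithinAt_tchart hc ht (mem_tchart_source_self (c (a - t)))
    have h2 : HasDerivWithinAt (fun s => a - s) (-1) ((fun s => a - s) ⁻¹' I) t := by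
      simpa using ((hasDerivAt_id t).const_sub a).hasDerivWithinAt
    have h3 := HasDerivWithinAt.scomp t h1 h2 fun s hs => hs
    have h4 := (hasDerivWithinAt_fst_comp h3).prodMk (hasDerivWithinAt_snd_comp h3).neg
    simp only [tchart_negTM]
    refine h4.congr_deriv ?_
    rw [formSpray_neg]
    simp only [neg_smul, one_smul, Prod.fst_neg, Prod.snd_neg, neg_neg]

theorem isMIntegralCurveOn_union {c : ℝ → TM M} {I J : Set ℝ} (hI : IsClosed I) (hJ : IsClosed J)
    (hcI : IsMIntegralCurveOn c geodesicField I) (hcJ : IsMIntegralCurveOn c geodesicField J) :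
    IsMIntegralCurveOn c geodesicField (I ∪ J) := by
  have key : ∀ {I J : Set ℝ}, IsClosed J → ∀ t ∈ I, t ∉ J → I ∈ 𝓝[I ∪ J] t := by
    intro I J hJ t _ htJ
    rw [nhdsWithin_union]
    refine ⟨self_mem_nhdsWithin, ?_⟩
    rw [notMem_closure_iff_nhdsWithin_eq_bot.1 (by rwa [hJ.closure_eq])]
    trivial
  intro t ht
  by_cases htI : t ∈ I <;> by_cases htJ : t ∈ J
  · exact (hcI t htI).union (hcJ t htJ)
  · exact (hcI t htI).mono_of_mem_nhdsWithin (key hJ t htI htJ)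
  · exact (hcJ t htJ).mono_of_mem_nhdsWithin (union_comm I J ▸ key hI t htJ htI)
  · exact (ht.elim htI htJ).elim

/-- Two geodesics that agree at the time `b` may be glued. -/
theorem isMIntegralCurveOn_ite {c c' : ℝ → TM M} {a b d : ℝ} (hab : a ≤ b) (hbd : b ≤ d)
    (hc : IsMIntegralCurveOn c geodesicField (Icc a b))
    (hc' : IsMIntegralCurveOn c' geodesicField (Icc b d)) (h : c b = c' b) :
    IsMIntegralCurveOn (fun s => if s ≤ b then c s else c' s) geodesicField (Icc a d) := by
  rw [← Icc_union_Icc_eq_Icc hab hbd]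
  refine isMIntegralCurveOn_union isClosed_Icc isClosed_Icc
    (isMIntegralCurveOn_congr hc fun s hs => if_pos hs.2)
    (isMIntegralCurveOn_congr hc' fun s hs => ?_)
  rcases hs.1.eq_or_lt with rfl | hs'
  · simpa using h
  · exact if_neg (not_le.2 hs')

theorem norm_sq_eq_metricForm {x₀ : M} {p : TM M} (hp : p ∈ (tchart x₀).source) :
    ‖p.2‖ ^ 2 = metricForm x₀ (tchart x₀ p).1 (tchart x₀ p).2 (tchart x₀ p).2 := by
  rw [metricForm_apply (mem_extChartAt_target_of_mem_source hp), ← real_inner_self_eq_norm_sq]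
  exact (metricCoord_apply_chart (mem_tchart_source.1 hp) p.2 p.2).symm

theorem norm_eq_of_geodesic {c : ℝ → TM M} {a b : ℝ}
    (hc : IsMIntegralCurveOn c geodesicField (Icc a b)) {s t : ℝ} (hs : s ∈ Icc a b)
    (ht : t ∈ Icc a b) : ‖(c s).2‖ = ‖(c t).2‖ := by
  have h : ∀ t ∈ Icc a b, HasDerivWithinAt (fun s => ‖(c s).2‖ ^ 2) 0 (Icc a b) t := by
    intro t ht
    have hp := mem_tchart_source_self (c t)
    have h1 := (isChartMetric (c t).1).hasDerivWithinAt_speed (hasDerivWithinAt_tchart hc ht hp)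
      (fun s _ => mem_halfPlane.2 tchart_mem_halfPlane) (mem_extChartAt_target_of_mem_source hp)
    refine h1.congr_of_eventuallyEq ?_ (norm_sq_eq_metricForm hp)
    filter_upwards [Filter.Tendsto.eventually_mem (hc.continuousWithinAt ht)
      (tchart_source_mem_nhds hp)] with s hs using norm_sq_eq_metricForm hs
  have h2 : ∀ t ∈ Icc a b, ‖(c t).2‖ ^ 2 = ‖(c a).2‖ ^ 2 :=
    constant_of_has_deriv_right_zero (f := fun s => ‖(c s).2‖ ^ 2)
      (fun t ht => (h t ht).continuousWithinAt)
      (fun t ht => (h t (Ico_subset_Icc_self ht)).mono_of_mem_nhdsWithin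
        (Filter.mem_of_superset (Icc_mem_nhdsGE ht.2) (Icc_subset_Icc_left ht.1)))
  have h3 := (h2 s hs).trans (h2 t ht).symm
  exact (sq_eq_sq₀ (norm_nonneg _) (norm_nonneg _)).1 h3

end

noncomputable section

variable {M : Type*} [TopologicalSpace M] [ChartedSpace (EuclideanHalfSpace 2) M]
  [IsManifold (𝓡∂ 2) ∞ M]

/-! ### Interior and boundary in charts -/

theorem mem_interior_target_iff {x₀ : M} {y : Plane} (hy : y ∈ (extChartAt (𝓡∂ 2) x₀).target) :
    y ∈ interior (extChartAt (𝓡∂ 2) x₀).target ↔ 0 < y 0 := by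
  constructor
  · intro h
    have := interior_mono (chart_target_subset x₀) h
    rw [HalfPlane, interior_range_modelWithCornersEuclideanHalfSpace] at this
    exact this
  · intro h
    rw [mem_interior_iff_mem_nhds]
    have h1 : HalfPlane ∈ 𝓝 y := by
      filter_upwards [(isOpen_lt continuous_const (planeCoord 0).continuous).mem_nhds h] with y' hy'
        using mem_halfPlane.2 (le_of_lt hy')
    have h2 := chart_target_mem_nhdsWithin hy
    rwa [nhdsWithin_eq_nhds.2 h1] at h2

theorem mem_interior_iff {x₀ : M} {p : TM M} (hp : p ∈ (tchart x₀).source) :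
    p.1 ∈ (𝓡∂ 2).interior M ↔ 0 < boundaryCoord (tchart x₀ p) :=
  ((𝓡∂ 2).isInteriorPoint_iff_of_mem_atlas (n := ∞) (by simp) (chart_mem_atlas _ x₀)
    (mem_tchart_source.1 hp)).trans
    (mem_interior_target_iff (mem_extChartAt_target_of_mem_source hp))

theorem mem_boundary_iff_not_mem_interior {x : M} :
    x ∈ (𝓡∂ 2).boundary M ↔ x ∉ (𝓡∂ 2).interior M :=
  (𝓡∂ 2).isBoundaryPoint_iff_not_isInteriorPoint x

theorem mem_boundary_iff {x₀ : M} {p : TM M} (hp : p ∈ (tchart x₀).source) :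
    p.1 ∈ (𝓡∂ 2).boundary M ↔ boundaryCoord (tchart x₀ p) = 0 := by
  rw [mem_boundary_iff_not_mem_interior, mem_interior_iff hp, not_lt,
    tchart_mem_halfPlane.ge_iff_eq']

theorem tchart_target_mem_nhds {x₀ : M} {z : Plane × Plane} (hz : z ∈ (tchart x₀).target)
    (h : 0 < boundaryCoord z) : (tchart x₀).target ∈ 𝓝 z := by
  rw [tchart_target] at hz ⊢
  refine prod_mem_nhds ?_ Filter.univ_mem
  exact mem_interior_iff_mem_nhds.1 ((mem_interior_target_iff hz.1).2 h)

variable [RiemannianBundle (fun x : M => TangentSpace (𝓡∂ 2) x)]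
  [IsContMDiffRiemannianBundle (𝓡∂ 2) ∞ Plane (fun x : M => TangentSpace (𝓡∂ 2) x)]

/-! ### The base point map -/

theorem isGeodesicFrom_of_le {p : TM M} {t : ℝ} (ht : 0 ≤ t) {c : ℝ → TM M} :
    IsGeodesicFrom p t c ↔ c 0 = p ∧ IsMIntegralCurveOn c geodesicField (Icc 0 t) := by
  rw [IsGeodesicFrom, uIcc_of_le ht]

/-- The flow is defined by choosing a geodesic; by uniqueness any other one computes it. -/
theorem geodesicFlow_eq [T2Space M] {p : TM M} {t : ℝ} {c : ℝ → TM M} (hc : IsGeodesicFrom p t c) :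
    geodesicFlow t p = c t := by
  have h : ∃ c, IsGeodesicFrom p t c := ⟨c, hc⟩
  rw [geodesicFlow, dif_pos h]
  exact eqOn_of_geodesic (left_mem_uIcc (a := (0 : ℝ)) (b := t)) h.choose_spec.2 hc.2
    (h.choose_spec.1.trans hc.1.symm) right_mem_uIcc

/-- The geodesic issued from the boundary point `q` reaches `p` at the time `T` and stays in the
interior of `M` in between. -/
def Reaches (q p : TM M) (T : ℝ) : Prop :=
  0 < T ∧ q.1 ∈ (𝓡∂ 2).boundary M ∧ ∃ c : ℝ → TM M, IsMIntegralCurveOn c geodesicField (Icc 0 T) ∧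
    c 0 = q ∧ c T = p ∧ ∀ s ∈ Ioc 0 T, (c s).1 ∈ (𝓡∂ 2).interior M

theorem Reaches.norm_eq {q p : TM M} {T : ℝ} (h : Reaches q p T) : ‖q.2‖ = ‖p.2‖ := by
  obtain ⟨hT, -, c, hc, rfl, rfl, -⟩ := h
  exact norm_eq_of_geodesic hc (left_mem_Icc.2 hT.le) (right_mem_Icc.2 hT.le)

theorem isMIntegralCurveOn_comp_add_Icc {c : ℝ → TM M} {a b : ℝ}
    (hc : IsMIntegralCurveOn c geodesicField (Icc a b)) (d : ℝ) :
    IsMIntegralCurveOn (fun s => c (s + d)) geodesicField (Icc (a - d) (b - d)) := by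
  refine (hc.comp_add d).mono fun s hs => ?_
  rw [mem_ofPred_eq]
  exact ⟨by linarith [hs.1], by linarith [hs.2]⟩

/-- The reversed geodesic issues from p with opposite velocity and meets the boundary at time T. By
uniqueness an earlier hit would be a boundary point of the original geodesic at a positive time,
where it is interior. -/
theorem Reaches.exitTime_eq [T2Space M] {q p : TM M} {T : ℝ} (h : Reaches q p T) :
    exitTime (negTM p) = T := by
  obtain ⟨hT, hq, c, hc, rfl, rfl, hi⟩ := h
  have hr : IsMIntegralCurveOn (fun s => negTM (c (T - s))) geodesicField (Icc 0 T) :=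
    (isMIntegralCurveOn_reverse hc T).mono fun s hs => ⟨by simp [hs.2], by simp [hs.1]⟩
  refine IsLeast.csInf_eq ⟨⟨hT, fun s => negTM (c (T - s)),
    (isGeodesicFrom_of_le hT.le).2 ⟨by simp, hr⟩, by simpa [negTM_fst] using hq⟩, ?_⟩
  rintro t ⟨ht, c', hc', hb⟩
  by_contra! hlt
  rw [isGeodesicFrom_of_le ht.le] at hc'
  have := eqOn_of_geodesic (left_mem_Icc.2 ht.le) hc'.2 (hr.mono (Icc_subset_Icc_right hlt.le))
    (by simp [hc'.1]) (right_mem_Icc.2 ht.le)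
  rw [this] at hb
  exact mem_boundary_iff_not_mem_interior.1 hb (hi (T - t) ⟨by linarith, by linarith⟩)

theorem Reaches.baseMap_eq [T2Space M] {q p : TM M} {T : ℝ} (h : Reaches q p T) :
    baseMap p = q := by
  have hE := h.exitTime_eq
  obtain ⟨hT, hq, c, hc, rfl, rfl, hi⟩ := h
  change geodesicFlow (-exitTime (negTM (c T))) (c T) = c 0
  rw [hE]
  have : IsGeodesicFrom (c T) (-T) (fun s => c (s + T)) := by
    refine ⟨by simp, ?_⟩
    rw [uIcc_of_ge (by linarith)]
    simpa using isMIntegralCurveOn_comp_add_Icc hc T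
  simpa using geodesicFlow_eq this

/-- The two points are joined by a geodesic in the interior of `M`. -/
def Linked (p p' : TM M) : Prop :=
  ∃ (c : ℝ → TM M) (s : ℝ), 0 ≤ s ∧ IsMIntegralCurveOn c geodesicField (Icc 0 s) ∧
    (∀ u ∈ Icc 0 s, (c u).1 ∈ (𝓡∂ 2).interior M) ∧
    (c 0 = p ∧ c s = p' ∨ c 0 = p' ∧ c s = p)

/-- If p' lies ahead of p, the geodesics are glued. If it lies behind, the link follows the geodesic
from q to p backwards and, staying in the interior, cannot reach q. -/
theorem Reaches.of_linked [T2Space M] {q p p' : TM M} {T : ℝ} (h : Reaches q p T)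
    (hl : Linked p p') : ∃ T', Reaches q p' T' := by
  obtain ⟨hT, hq, γ, hγ, hγ0, hγT, hγi⟩ := h
  obtain ⟨c, s, hs, hc, hi, ⟨hc0, hcs⟩ | ⟨hc0, hcs⟩⟩ := hl
  · have h1 : IsMIntegralCurveOn (fun u => c (u - T)) geodesicField (Icc T (T + s)) := by
      have := isMIntegralCurveOn_comp_add_Icc hc (-T)
      simpa [sub_eq_add_neg, add_comm] using this
    refine ⟨T + s, by linarith, hq, _, isMIntegralCurveOn_ite hT.le (by linarith) hγ h1
      (by simp [hγT, hc0]), by simp [hT.le, hγ0], ?_, fun u hu => ?_⟩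
    · rcases hs.eq_or_lt with rfl | hs
      · simp [hγT, ← hcs, hc0]
      · simp [hs, hcs]
    · by_cases hu' : u ≤ T
      · simp only [hu', if_true]
        exact hγi u ⟨hu.1, hu'⟩
      · simp only [hu', if_false]
        exact hi _ ⟨by linarith [not_le.1 hu'], by linarith [hu.2]⟩
  -- Both geodesics run backwards from p and agree for the time m. If T ≤ s, the link would contain
  -- the boundary point q; otherwise p' is the point at time T - s.
  · set m := min s T with hm
    have hm0 : 0 ≤ m := le_min hs hT.le
    have h1 : IsMIntegralCurveOn (fun u => c (u + s)) geodesicField (Icc (-m) 0) :=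
      (isMIntegralCurveOn_comp_add_Icc hc s).mono
        (Icc_subset_Icc (by linarith [min_le_left s T]) (by simp))
    have h2 : IsMIntegralCurveOn (fun u => γ (u + T)) geodesicField (Icc (-m) 0) :=
      (isMIntegralCurveOn_comp_add_Icc hγ T).mono
        (Icc_subset_Icc (by linarith [min_le_right s T]) (by simp))
    have h3 := eqOn_of_geodesic (right_mem_Icc.2 (by linarith)) h1 h2 (by simp [hcs, hγT])
      (left_mem_Icc.2 (by linarith))
    simp only at h3
    rcases le_or_gt T s with hsT | hsT
    · rw [hm, min_eq_right hsT, neg_add_cancel, hγ0] at h3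
      refine absurd (hi (-T + s) ⟨by linarith, by linarith⟩) ?_
      rw [h3]
      exact mem_boundary_iff_not_mem_interior.1 hq
    · rw [hm, min_eq_left hsT.le, neg_add_cancel, hc0] at h3
      exact ⟨T - s, by linarith, hq, γ, hγ.mono (Icc_subset_Icc_right (by linarith)), hγ0,
        by rw [h3]; congr 1; ring, fun u hu => hγi u ⟨hu.1, by linarith [hu.2]⟩⟩

/-- Near `p`, the base point map is defined by geodesics issued from the boundary, it is
continuous at `p` with value `q`, and it has the derivative `D` at `p`, in the chart at `q`. -/
structure IsBaseDeriv (q p : TM M) (D : Plane × Plane →L[ℝ] Plane × Plane) : Prop where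
  reaches : ∃ T, Reaches q p T
  eventually : ∀ᶠ p' in 𝓝 p, ∃ T, Reaches (baseMap p') p' T
  continuousAt : ContinuousAt baseMap p
  hasMFDerivAt : HasMFDerivAt (𝓡∂ 2).tangent 𝓘(ℝ, Plane × Plane)
    (fun p' => tchart q.1 (baseMap p')) p D

namespace IsBaseDeriv

theorem baseMap_eq [T2Space M] {q p : TM M} {D : Plane × Plane →L[ℝ] Plane × Plane}
    (h : IsBaseDeriv q p D) : baseMap p = q :=
  h.reaches.elim fun _ => Reaches.baseMap_eq

theorem unique {q p : TM M} {D D' : Plane × Plane →L[ℝ] Plane × Plane}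
    (h : IsBaseDeriv q p D) (h' : IsBaseDeriv q p D') : D = D' :=
  hasMFDerivAt_unique h.hasMFDerivAt h'.hasMFDerivAt

/-- The base point map is constant along geodesics in the interior. So if Ψ moves points along such
geodesics, then F = F ∘ Ψ near p', and the chain rule applies. This is how derivatives of F are
carried from one point of a geodesic to another. -/
theorem comp [T2Space M] {q p p' : TM M} {D L : Plane × Plane →L[ℝ] Plane × Plane}
    (h : IsBaseDeriv q p D) {Ψ : TM M → TM M} (hΨ : Ψ p' = p)
    (hL : HasMFDerivAt (𝓡∂ 2).tangent (𝓡∂ 2).tangent Ψ p' L)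
    (hl : ∀ᶠ a in 𝓝 p', Linked (Ψ a) a) : IsBaseDeriv q p' (D ∘L L) := by
  have hc : Filter.Tendsto Ψ (𝓝 p') (𝓝 p) := hΨ ▸ hL.continuousAt
  have h1 : ∀ᶠ a in 𝓝 p', (∃ T, Reaches (baseMap a) a T) ∧ baseMap a = baseMap (Ψ a) := by
    filter_upwards [hc.eventually h.eventually, hl] with a ⟨T, ha⟩ hla
    obtain ⟨T', hT'⟩ := ha.of_linked hla
    rw [hT'.baseMap_eq]
    exact ⟨⟨T', hT'⟩, rfl⟩
  refine ⟨?_, h1.mono fun a ha => ha.1, ?_, ?_⟩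
  · obtain ⟨T, hT⟩ := h.reaches
    exact hT.of_linked (hΨ ▸ hl.self_of_nhds)
  · have : ContinuousAt (fun a => baseMap (Ψ a)) p' :=
      ContinuousAt.comp (g := baseMap) (f := Ψ) (hΨ.symm ▸ h.continuousAt) hL.continuousAt
    exact this.congr (h1.mono fun a ha => ha.2.symm)
  · have h2 : HasMFDerivAt (𝓡∂ 2).tangent 𝓘(ℝ, Plane × Plane)
        (fun p' => tchart q.1 (baseMap p')) (Ψ p') D := hΨ.symm ▸ h.hasMFDerivAt
    have h3 := h2.comp p' hL
    refine h3.congr_of_eventuallyEq ?_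
    exact h1.mono fun a ha => congrArg (tchart q.1) ha.2

end IsBaseDeriv

end

noncomputable section

variable {M : Type*} [TopologicalSpace M] [ChartedSpace (EuclideanHalfSpace 2) M]
  [IsManifold (𝓡∂ 2) ∞ M]

/-! ### Flow boxes in the interior -/

theorem hasMFDerivAt_tchart_symm {x₀ : M} {z : Plane × Plane} (hz : (tchart x₀).target ∈ 𝓝 z) :
    HasMFDerivAt 𝓘(ℝ, Plane × Plane) (𝓡∂ 2).tangent (tchart x₀).symm z
      (tangentCoordChange (𝓡∂ 2).tangent ⟨x₀, 0⟩ ((tchart x₀).symm z) ((tchart x₀).symm z)) := by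
  have hzt := mem_of_mem_nhds hz
  set p := (tchart x₀).symm z with hp
  have hps : p ∈ (tchart x₀).source := (tchart x₀).map_target hzt
  refine ⟨(continuousOn_extChartAt_symm _).continuousAt hz, ?_⟩
  have h1 := hasFDerivWithinAt_tangentCoordChange (I := (𝓡∂ 2).tangent) (x := (⟨x₀, 0⟩ : TM M))
    (y := p) (z := p) ⟨hps, mem_extChartAt_source p⟩
  have h2 : tchart x₀ p = z := (tchart x₀).right_inv hzt
  rw [h2] at h1
  have h3 : HasFDerivAt (tchart p.1 ∘ (tchart x₀).symm)
      (tangentCoordChange (𝓡∂ 2).tangent ⟨x₀, 0⟩ p p) z :=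
    h1.hasFDerivAt (Filter.mem_of_superset hz (extChartAt_target_subset_range _))
  exact HasFDerivAt.hasFDerivWithinAt h3

theorem tangentCoordChange_tangent_injective {x₀ : M} {p : TM M} (hp : p ∈ (tchart x₀).source) :
    Function.Injective (tangentCoordChange (𝓡∂ 2).tangent ⟨x₀, 0⟩ p p) := by
  refine Function.LeftInverse.injective
    (g := tangentCoordChange (𝓡∂ 2).tangent p ⟨x₀, 0⟩ p) fun X => ?_
  rw [tangentCoordChange_comp ⟨⟨hp, mem_extChartAt_source p⟩, hp⟩, tangentCoordChange_self hp]

variable [RiemannianBundle (fun x : M => TangentSpace (𝓡∂ 2) x)]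
  [IsContMDiffRiemannianBundle (𝓡∂ 2) ∞ Plane (fun x : M => TangentSpace (𝓡∂ 2) x)]

theorem contDiffAt_chartSpray {x₀ : M} {z : Plane × Plane} (hz : z ∈ (tchart x₀).target)
    (h : 0 < boundaryCoord z) : ContDiffAt ℝ ∞ (chartSpray x₀) z := by
  refine (contDiffWithinAt_chartSpray hz).contDiffAt ?_
  filter_upwards [(isOpen_lt continuous_const boundaryCoord.continuous).mem_nhds h] with z' hz'
    using mem_halfPlane_prod.2 (le_of_lt hz')

variable {x₀ : M} {z₀ : Plane × Plane} {U : Set (Plane × Plane)} {r ε : ℝ}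
  {φ : Plane × Plane → ℝ → Plane × Plane} {A : Plane × Plane → ℝ → Plane × Plane →L[ℝ] Plane × Plane}

theorem isMIntegralCurveOn_localFlow (h : IsLocalFlow (chartSpray x₀) z₀ U r ε φ A)
    (hU : U ⊆ (tchart x₀).target) {z : Plane × Plane} (hz : z ∈ Metric.ball z₀ r) {I : Set ℝ}
    (hI : I ⊆ Ioo (-ε) ε) :
    IsMIntegralCurveOn (fun s => (tchart x₀).symm (φ z s)) geodesicField I :=
  isMIntegralCurveOn_of_hasDerivWithinAt
    (fun t ht => (h.hasDerivAt z hz t (hI ht)).hasDerivWithinAt)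
    fun t ht => hU (h.mem z hz t (hI ht))

theorem linked_localFlow (h : IsLocalFlow (chartSpray x₀) z₀ U r ε φ A)
    (hU : U ⊆ (tchart x₀).target) (hU' : ∀ z ∈ U, 0 < boundaryCoord z) {z : Plane × Plane}
    (hz : z ∈ Metric.ball z₀ r) {s : ℝ} (hs : s ∈ Ioo (-ε) ε) :
    Linked ((tchart x₀).symm (φ z s)) ((tchart x₀).symm z) := by
  have h0 := h.zero_mem
  have h_inside : ∀ u ∈ Ioo (-ε) ε, ((tchart x₀).symm (φ z u)).1 ∈ (𝓡∂ 2).interior M := by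
    intro u hu
    have hm := h.mem z hz u hu
    rw [mem_interior_iff ((tchart x₀).map_target (hU hm)), (tchart x₀).right_inv (hU hm)]
    exact hU' _ hm
  rcases le_total 0 s with hs0 | hs0
  · have hsub : Icc 0 s ⊆ Ioo (-ε) ε := ordConnected_Ioo.out h0 hs
    exact ⟨_, s, hs0, isMIntegralCurveOn_localFlow h hU hz hsub, fun u hu => h_inside u (hsub hu),
      Or.inr ⟨by rw [h.apply_zero z hz], rfl⟩⟩
  · have hsub : Icc s 0 ⊆ Ioo (-ε) ε := ordConnected_Ioo.out hs h0
    have h1 := isMIntegralCurveOn_comp_add_Icc (isMIntegralCurveOn_localFlow h hU hz hsub) s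
    rw [sub_self, zero_sub] at h1
    refine ⟨_, -s, by linarith, h1, fun u hu => h_inside _ (hsub ⟨?_, ?_⟩),
      Or.inl ⟨by simp, by simp [h.apply_zero z hz]⟩⟩
    · linarith [hu.1]
    · linarith [hu.2]

theorem IsBaseDeriv.localFlow [T2Space M] (h : IsLocalFlow (chartSpray x₀) z₀ U r ε φ A)
    (hU : U ⊆ (tchart x₀).target) (hU' : ∀ z ∈ U, 0 < boundaryCoord z) {q p p' : TM M} {s : ℝ}
    (hs : s ∈ Ioo (-ε) ε) (hp' : p' ∈ (tchart x₀).source) (hz : tchart x₀ p' ∈ Metric.ball z₀ r)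
    (hp : (tchart x₀).symm (φ (tchart x₀ p') s) = p) {D : Plane × Plane →L[ℝ] Plane × Plane}
    (hD : IsBaseDeriv q p D) :
    IsBaseDeriv q p' (D ∘L tangentCoordChange (𝓡∂ 2).tangent ⟨x₀, 0⟩ p p ∘L A (tchart x₀ p') s
      ∘L tangentCoordChange (𝓡∂ 2).tangent p' ⟨x₀, 0⟩ p') := by
  have hm := h.mem _ hz s hs
  refine hD.comp (Ψ := fun a => (tchart x₀).symm (φ (tchart x₀ a) s)) hp ?_ ?_
  · have h1 : HasMFDerivAt 𝓘(ℝ, Plane × Plane) 𝓘(ℝ, Plane × Plane) (fun w => φ w s)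
        (tchart x₀ p') (A (tchart x₀ p') s) := (h.hasFDerivAt _ hz s hs).hasMFDerivAt
    have h2 := hasMFDerivAt_tchart_symm (tchart_target_mem_nhds (hU hm) (hU' _ hm))
    rw [hp] at h2
    exact h2.comp p' (h1.comp p' (hasMFDerivAt_tchart hp'))
  · filter_upwards [tchart_source_mem_nhds hp',
      continuousAt_tchart hp' (Metric.isOpen_ball.mem_nhds hz)] with a ha haz
    have := linked_localFlow h hU hU' haz hs
    rwa [(tchart x₀).left_inv ha] at this

/-- Along a geodesic, the derivatives of the base point map at nearby interior points are related
by the linearized geodesic flow. -/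
theorem exists_flow_box [T2Space M] {c : ℝ → TM M} {a b t₀ : ℝ}
    (hc : IsMIntegralCurveOn c geodesicField (Icc a b)) (ht₀ : t₀ ∈ Ioo a b)
    (hi : (c t₀).1 ∈ (𝓡∂ 2).interior M) :
    ∃ δ > 0, ∃ W : ℝ → Plane × Plane →L[ℝ] Plane × Plane, W 0 = ContinuousLinearMap.id ℝ _ ∧
      ∀ s ∈ Ioo (-δ) δ, t₀ + s ∈ Ioo a b ∧ c (t₀ + s) ∈ (tchart (c t₀).1).source ∧
        0 < boundaryCoord (tchart (c t₀).1 (c (t₀ + s))) ∧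
        HasDerivAt W (fderiv ℝ (chartSpray (c t₀).1) (tchart (c t₀).1 (c (t₀ + s))) ∘L W s) s ∧
        Function.Injective (W s) ∧
        ∀ q, (∀ D, IsBaseDeriv q (c t₀) D → ∃ D', IsBaseDeriv q (c (t₀ + s)) D') ∧
          ∀ D', IsBaseDeriv q (c (t₀ + s)) D' → IsBaseDeriv q (c t₀)
            (D' ∘L tangentCoordChange (𝓡∂ 2).tangent ⟨(c t₀).1, 0⟩ (c (t₀ + s)) (c (t₀ + s))
              ∘L W s) := by
  set p₀ := c t₀ with hp₀
  set x₀ := p₀.1 with hx₀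
  set z₀ := tchart x₀ p₀ with hz₀
  have hs₀ : p₀ ∈ (tchart x₀).source := mem_tchart_source_self p₀
  have hzt : z₀ ∈ (tchart x₀).target := (tchart x₀).map_source hs₀
  have hzpos : 0 < boundaryCoord z₀ := (mem_interior_iff hs₀).1 hi
  -- The local flow takes its values in this set, so its trajectories are geodesics in the interior.
  have hV : (tchart x₀).target ∩ {z | 0 < boundaryCoord z} ∈ 𝓝 z₀ :=
    Filter.inter_mem (tchart_target_mem_nhds hzt hzpos)
      ((isOpen_lt continuous_const boundaryCoord.continuous).mem_nhds hzpos)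
  obtain ⟨U, hUV, r, ε, φ, A, h⟩ := exists_isLocalFlow
    ((contDiffAt_chartSpray hzt hzpos).of_le (m := 1) ENat.LEInfty.out) hV
  have hU : U ⊆ (tchart x₀).target := fun z hz => (hUV hz).1
  have hU' : ∀ z ∈ U, 0 < boundaryCoord z := fun z hz => (hUV hz).2
  have hcont : ContinuousAt (φ z₀) 0 := (h.hasDerivAt z₀ h.center_mem 0 h.zero_mem).continuousAt
  have hball : ∀ᶠ s in 𝓝 (0 : ℝ), φ z₀ s ∈ Metric.ball z₀ r := by
    refine hcont (Metric.isOpen_ball.mem_nhds ?_)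
    rw [h.apply_zero z₀ h.center_mem]; exact h.center_mem
  have hev : ∀ᶠ s in 𝓝 (0 : ℝ), s ∈ Ioo (-ε) ε ∧ t₀ + s ∈ Ioo a b ∧ φ z₀ s ∈ Metric.ball z₀ r := by
    refine (isOpen_Ioo.eventually_mem h.zero_mem).and (Filter.Eventually.and ?_ hball)
    have : ContinuousAt (fun s : ℝ => t₀ + s) 0 := by fun_prop
    exact this (isOpen_Ioo.mem_nhds (by simpa using ht₀))
  obtain ⟨δ, hδ, hδ'⟩ := Metric.eventually_nhds_iff_ball.1 hev
  rw [Real.ball_eq_Ioo, zero_sub, zero_add] at hδ'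
  -- Uniqueness of geodesics identifies c near t₀ with the trajectory of the local flow through z₀.
  have hcφ : ∀ s ∈ Ioo (-δ) δ, c (t₀ + s) = (tchart x₀).symm (φ z₀ s) := by
    intro s hs
    have hsub : uIcc 0 s ⊆ Ioo (-δ) δ := ordConnected_Ioo.uIcc_subset ⟨by linarith, hδ⟩ hs
    have h1 : IsMIntegralCurveOn (fun u => c (u + t₀)) geodesicField (uIcc 0 s) :=
      (isMIntegralCurveOn_comp_add_Icc hc t₀).mono fun u hu => by
        have := (hδ' u (hsub hu)).2.1
        exact ⟨by linarith [this.1], by linarith [this.2]⟩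
    have h2 := isMIntegralCurveOn_localFlow h hU h.center_mem fun u hu => (hδ' u (hsub hu)).1
    have h3 := eqOn_of_geodesic (left_mem_uIcc (a := (0 : ℝ)) (b := s)) h1 h2
      (by simp only [zero_add, h.apply_zero z₀ h.center_mem]
          exact ((tchart x₀).left_inv hs₀).symm) right_mem_uIcc
    rw [add_comm]
    exact h3
  refine ⟨δ, hδ, A z₀, h.deriv_zero z₀ h.center_mem, fun s hs => ?_⟩
  obtain ⟨hsε, hsab, hsr⟩ := hδ' s hs
  have hm := h.mem z₀ h.center_mem s hsε
  have hsrc : c (t₀ + s) ∈ (tchart x₀).source := by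
    rw [hcφ s hs]; exact (tchart x₀).map_target (hU hm)
  have htc : tchart x₀ (c (t₀ + s)) = φ z₀ s := by
    rw [hcφ s hs]; exact (tchart x₀).right_inv (hU hm)
  refine ⟨hsab, hsrc, by rw [htc]; exact hU' _ hm, ?_, ?_, fun q => ⟨fun D hD => ?_, fun D' hD' => ?_⟩⟩
  · rw [htc]; exact h.hasDerivAt_deriv z₀ h.center_mem s hsε
  · refine Function.LeftInverse.injective (g := A (φ z₀ s) (-s)) fun X => ?_
    exact congrArg (fun L : Plane × Plane →L[ℝ] Plane × Plane => L X)
      (h.deriv_comp_deriv_neg h.center_mem hsε hsr)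
  · have hs' : -s ∈ Ioo (-ε) ε := ⟨by linarith [hsε.2], by linarith [hsε.1]⟩
    refine ⟨_, hD.localFlow h hU hU' hs' hsrc (by rwa [htc]) ?_⟩
    rw [htc, h.apply_apply h.center_mem hsε hs' (by simpa using h.zero_mem) hsr, add_neg_cancel,
      h.apply_zero z₀ h.center_mem]
    exact (tchart x₀).left_inv hs₀
  · have h1 := hD'.localFlow h hU hU' hsε hs₀ h.center_mem (hcφ s hs).symm
    convert h1 using 1
    have h2 : tangentCoordChange (𝓡∂ 2).tangent p₀ ⟨x₀, 0⟩ p₀ = ContinuousLinearMap.id ℝ _ :=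
      ContinuousLinearMap.ext fun X =>
        tangentCoordChange_self (I := (𝓡∂ 2).tangent) (mem_extChartAt_source p₀)
    rw [h2]
    rfl

end

noncomputable section

/-! ### Flow boxes at the boundary -/

section Footpoint

variable {E : Type*} [NormedAddCommGroup E] [NormedSpace ℝ E] [FiniteDimensional ℝ E]
  {f : E → E} {z₀ : E} {U : Set E} {r ε : ℝ} {φ : E → ℝ → E} {A : E → ℝ → E →L[ℝ] E}

/-- The flow of a vector field that is transverse at `z₀` to the hyperplane `ℓ = 0` defines near
`z₀` a projection `P` to that hyperplane. -/
theorem IsLocalFlow.exists_footpoint (h : IsLocalFlow f z₀ U r ε φ A) {ℓ : E →L[ℝ] ℝ} {e : E}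
    (he : ℓ e = 1) (hz₀ : ℓ z₀ = 0) (hf : ℓ (f z₀) ≠ 0) :
    ∃ (P : E → E) (τ : E → ℝ), ∃ δ > 0, ∀ s ∈ Ioo 0 δ, s ∈ Ioo (-ε) ε ∧
      φ z₀ s ∈ Metric.ball z₀ r ∧ P (φ z₀ s) = z₀ ∧ τ (φ z₀ s) = s ∧
      (∀ᶠ z in 𝓝 (φ z₀ s), ℓ (P z) = 0 ∧ P z ∈ Metric.ball z₀ r ∧ τ z ∈ Ioo 0 ε ∧
        φ (P z) (τ z) = z) ∧
      ∃ D : E →L[ℝ] E, HasFDerivAt P D (φ z₀ s) ∧ ∀ Y, ℓ Y = 0 → D (A z₀ s Y) = Y := by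
  have : CompleteSpace E := FiniteDimensional.complete ℝ E
  set Q := hyperProj ℓ e with hQ
  have hQz₀ : Q z₀ = z₀ := by simp [hQ, hz₀]
  have hQe : Q e = 0 := by simp [hQ, he]
  have hℓQ : ∀ w, ℓ (Q w) = 0 := fun w => by simp [hQ, he]
  -- Flow-box coordinates: start at the projection of w to the hyperplane and flow for the time ℓ w.
  -- The projection P and the time τ are read off from the inverse of G.
  set G : E → E := fun w => φ (Q w) (ℓ w) with hG
  set v := f z₀ with hv
  -- The derivative of G at z₀ is w ↦ Q w + ℓ(w) v. It is a rank one perturbation of the identity,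
  -- invertible because ℓ v ≠ 0.
  set B : E →L[ℝ] E := ContinuousLinearMap.id ℝ E + ℓ.smulRight (v - e) with hB
  set B' : E →L[ℝ] E := ContinuousLinearMap.id ℝ E - (ℓ v)⁻¹ • ℓ.smulRight (v - e) with hB'
  set L : E ≃L[ℝ] E := ContinuousLinearEquiv.equivOfInverse B B'
    (fun w => by
      simp only [hB, hB', add_apply, sub_apply, smul_apply, ContinuousLinearMap.id_apply,
        ContinuousLinearMap.smulRight_apply, map_add, map_smul, map_sub, he]
      match_scalars <;> field_simp <;> ring)
    (fun w => by
      simp only [hB, hB', add_apply, sub_apply, smul_apply, ContinuousLinearMap.id_apply,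
        ContinuousLinearMap.smulRight_apply, map_smul, map_sub, he]
      match_scalars <;> field_simp <;> ring) with hL
  have hGd : HasStrictFDerivAt G (L : E →L[ℝ] E) z₀ := by
    have h1 : HasStrictFDerivAt (fun w => (Q w, ℓ w)) (Q.prod ℓ) z₀ :=
      Q.hasStrictFDerivAt.prodMk ℓ.hasStrictFDerivAt
    have h2 : HasStrictFDerivAt (Function.uncurry φ) (ContinuousLinearMap.fst ℝ E ℝ
        + (ContinuousLinearMap.snd ℝ E ℝ).smulRight v) ((fun w => (Q w, ℓ w)) z₀) := by
      simp only [hQz₀, hz₀]; exact h.hasStrictFDerivAt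
    refine (h2.comp z₀ h1).congr_fderiv ?_
    ext w
    simp [hL, hB, hQ]
    module
  set Gh := hGd.toOpenPartialHomeomorph G with hGh
  have hGhc : ∀ w, Gh w = G w := fun w => congrFun hGd.toOpenPartialHomeomorph_coe w
  have hsrc : z₀ ∈ Gh.source := hGd.mem_toOpenPartialHomeomorph_source
  have hGz₀ : G z₀ = z₀ := by simp only [hG, hQz₀, hz₀, h.apply_zero z₀ h.center_mem]
  have hinv : HasFDerivAt Gh.symm B' z₀ := by
    have := hGd.to_localInverse.hasFDerivAt
    rw [hGz₀] at this
    exact this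
  set P : E → E := fun z => Q (Gh.symm z) with hP
  have hPd : HasFDerivAt P (Q ∘L B') z₀ := Q.hasFDerivAt.comp z₀ hinv
  have hQB : ∀ Y, ℓ Y = 0 → (Q ∘L B') Y = Y := fun Y hY => by simp [hQ, hB', hY]
  have hcont : ContinuousAt (φ z₀) 0 := (h.hasDerivAt z₀ h.center_mem 0 h.zero_mem).continuousAt
  have hev : ∀ᶠ s in 𝓝 (0 : ℝ), s ∈ Ioo (-ε) ε ∧ φ z₀ s ∈ Metric.ball z₀ r
      ∧ z₀ + s • e ∈ Gh.source := by
    refine (isOpen_Ioo.eventually_mem h.zero_mem).and (Filter.Eventually.and ?_ ?_)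
    · refine hcont (Metric.isOpen_ball.mem_nhds ?_)
      rw [h.apply_zero z₀ h.center_mem]; exact h.center_mem
    · have : ContinuousAt (fun s : ℝ => z₀ + s • e) 0 := by fun_prop
      exact this (Gh.open_source.mem_nhds (by simpa using hsrc))
  obtain ⟨δ, hδ, hδ'⟩ := Metric.eventually_nhds_iff_ball.1 hev
  rw [Real.ball_eq_Ioo, zero_sub, zero_add] at hδ'
  refine ⟨P, fun z => ℓ (Gh.symm z), δ, hδ, fun s hs => ?_⟩
  obtain ⟨hsε, hsr, hsN⟩ := hδ' s ⟨by linarith [hs.1], hs.2⟩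
  have hs' : -s ∈ Ioo (-ε) ε := ⟨by linarith [hsε.2], by linarith [hsε.1]⟩
  have hGs : Gh (z₀ + s • e) = φ z₀ s := by
    rw [hGhc]; simp [hG, hQz₀, hQe, hz₀, he]
  have hsym : Gh.symm (φ z₀ s) = z₀ + s • e := by rw [← hGs, Gh.left_inv hsN]
  have hmem : φ z₀ s ∈ Gh.target := by rw [← hGs]; exact Gh.map_source hsN
  have hsc : Filter.Tendsto Gh.symm (𝓝 (φ z₀ s)) (𝓝 (z₀ + s • e)) := by
    have := Gh.continuousAt_symm hmem
    rwa [ContinuousAt, hsym] at this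
  have hev2 : ∀ᶠ w in 𝓝 (z₀ + s • e), w - s • e ∈ Gh.source ∧ Q w ∈ Metric.ball z₀ r ∧
      ℓ w ∈ Ioo 0 ε ∧ ℓ w - s ∈ Ioo (-ε) ε := by
    have h1 : ContinuousAt (fun w => w - s • e) (z₀ + s • e) := by fun_prop
    have h2 : ContinuousAt Q (z₀ + s • e) := Q.continuous.continuousAt
    have h3 : ContinuousAt ℓ (z₀ + s • e) := ℓ.continuous.continuousAt
    have h4 : ContinuousAt (fun w => ℓ w - s) (z₀ + s • e) := h3.sub continuousAt_const
    refine Filter.Eventually.and (h1 (Gh.open_source.mem_nhds (by simpa using hsrc)))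
      (Filter.Eventually.and (h2 (Metric.isOpen_ball.mem_nhds ?_))
      (Filter.Eventually.and (h3 (isOpen_Ioo.mem_nhds ?_)) (h4 (isOpen_Ioo.mem_nhds ?_))))
    · simpa [hQz₀, hQe] using h.r_pos
    · simpa [hz₀, he] using ⟨hs.1, hsε.2⟩
    · simpa [hz₀, he] using h.ε_pos
  have hev3 := (hsc.eventually hev2).and ((Gh.open_target.eventually_mem hmem).and
    (Metric.isOpen_ball.eventually_mem hsr))
  have hGw : ∀ z ∈ Gh.target, φ (Q (Gh.symm z)) (ℓ (Gh.symm z)) = z := fun z hz => by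
    have := Gh.right_inv hz
    rwa [hGhc] at this
  have hφs : φ (φ z₀ s) (-s) = z₀ := by
    rw [h.apply_apply h.center_mem hsε hs' (by simpa using h.zero_mem) hsr, add_neg_cancel,
      h.apply_zero z₀ h.center_mem]
  refine ⟨hsε, hsr, by simp [hP, hsym, hQz₀, hQe], by simp [hsym, hz₀, he], ?_,
    (Q ∘L B') ∘L A (φ z₀ s) (-s), ?_, fun Y hY => ?_⟩
  · filter_upwards [hev3] with z hz
    exact ⟨hℓQ _, hz.1.2.1, hz.1.2.2.1, hGw z hz.2.1⟩
  -- The inverse function theorem gives the derivative of P at z₀ only. Near φ z₀ s the projection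
  -- is unchanged by flowing back for the time s, so the derivative there follows by the chain rule.
  · have h1 : HasFDerivAt (fun z => P (φ z (-s))) ((Q ∘L B') ∘L A (φ z₀ s) (-s)) (φ z₀ s) :=
      HasFDerivAt.comp (g := P) (φ z₀ s) (by rw [hφs]; exact hPd) (h.hasFDerivAt _ hsr _ hs')
    refine h1.congr_of_eventuallyEq ?_
    filter_upwards [hev3] with z ⟨⟨hz1, hz2, hz3, hz4⟩, hz5, hz6⟩
    set w := Gh.symm z with hw
    have hzw : φ (Q w) (ℓ w) = z := hGw z hz5
    have h2 : φ z (-s) = Gh (w - s • e) := by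
      rw [hGhc, hG]
      simp only [map_sub, map_smul, hQe, he, smul_zero, sub_zero, smul_eq_mul, mul_one]
      conv_lhs => rw [← hzw]
      rw [h.apply_apply hz2 ⟨by linarith [hz3.1, h.ε_pos], hz3.2⟩ hs' hz4 (by rwa [hzw]),
        sub_eq_add_neg]
    simp only [hP]
    rw [h2, Gh.left_inv hz1, map_sub, map_smul, hQe, smul_zero, sub_zero]
  · rw [ContinuousLinearMap.comp_apply]
    have := congrArg (fun L : E →L[ℝ] E => L Y) (h.deriv_comp_deriv_neg h.center_mem hsε hsr)
    simp only [ContinuousLinearMap.comp_apply, ContinuousLinearMap.id_apply] at this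
    rw [this, hQB Y hY]

end Footpoint

end

/-! ### The geodesic flow at an inward boundary vector -/

noncomputable section

variable {M : Type*} [TopologicalSpace M] [ChartedSpace (EuclideanHalfSpace 2) M]
  [IsManifold (𝓡∂ 2) ∞ M]

variable [RiemannianBundle (fun x : M => TangentSpace (𝓡∂ 2) x)]
  [IsContMDiffRiemannianBundle (𝓡∂ 2) ∞ Plane (fun x : M => TangentSpace (𝓡∂ 2) x)]

/-- The linearized geodesic spray in the chart at `x₀`. -/
abbrev chartSprayDeriv (x₀ : M) : Plane × Plane → Plane × Plane → Plane × Plane :=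
  formSprayDeriv stdVec HalfPlane (metricForm x₀)

/-- The half space has unique derivatives even at its boundary points, so all differentiable
extensions of the spray have the same linearization there. -/
theorem fderiv_extension_chartSpray {x₀ : M} {z : Plane × Plane} (hz : z ∈ (tchart x₀).target)
    {f : Plane × Plane → Plane × Plane} (hf : DifferentiableAt ℝ f z)
    (hf' : ∀ z', 0 ≤ boundaryCoord z' → f z' = chartSpray x₀ z') (Y : Plane × Plane) :
    fderiv ℝ f z Y = chartSprayDeriv x₀ z Y := by
  have hz1 : z.1 ∈ (extChartAt (𝓡∂ 2) x₀).target := by rw [tchart_target] at hz; exact hz.1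
  obtain ⟨L, hL, hL'⟩ := (isChartMetric x₀).hasFDerivWithinAt_formSpray hz1
  have hzS : z ∈ HalfPlane ×ˢ (univ : Set Plane) := ⟨chart_target_subset x₀ hz1, mem_univ _⟩
  have h1 : HasFDerivWithinAt f L (HalfPlane ×ˢ univ) z :=
    hL'.congr (fun z' hz' => hf' z' (mem_halfPlane_prod.1 hz')) (hf' z (mem_halfPlane_prod.1 hzS))
  have h2 : UniqueDiffWithinAt ℝ (HalfPlane ×ˢ (univ : Set Plane)) z :=
    uniqueDiffOn_halfPlane.prod uniqueDiffOn_univ z hzS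
  rw [h2.eq hf.hasFDerivAt.hasFDerivWithinAt h1, hL]

/-- Near the boundary, the base point map follows the geodesics back to the boundary. -/
theorem exists_boundary_box [T2Space M] {c : ℝ → TM M} {b : ℝ} (hb : 0 < b)
    (hc : IsMIntegralCurveOn c geodesicField (Icc 0 b)) (hq : (c 0).1 ∈ (𝓡∂ 2).boundary M)
    (hv : 0 < (tchart (c 0).1 (c 0)).2 0) :
    ∃ δ > 0, ∃ W : ℝ → Plane × Plane →L[ℝ] Plane × Plane, W 0 = ContinuousLinearMap.id ℝ _ ∧
      ∀ s ∈ Ico 0 δ, s ∈ Ico 0 b ∧ c s ∈ (tchart (c 0).1).source ∧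
        (∀ Y, HasDerivWithinAt (fun s => W s Y)
          (chartSprayDeriv (c 0).1 (tchart (c 0).1 (c s)) (W s Y)) (Ico 0 δ) s) ∧
        (0 < s → ∃ D, IsBaseDeriv (c 0) (c s) D ∧ ∀ Y, boundaryCoord Y = 0 →
          D (tangentCoordChange (𝓡∂ 2).tangent ⟨(c 0).1, 0⟩ (c s) (c s) (W s Y)) = Y) := by
  set q := c 0 with hq₀
  set x₀ := q.1 with hx₀
  set z₀ := tchart x₀ q with hz₀
  have hs₀ : q ∈ (tchart x₀).source := mem_tchart_source_self q
  have hzt : z₀ ∈ (tchart x₀).target := (tchart x₀).map_source hs₀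
  have hℓ : boundaryCoord z₀ = 0 := (mem_boundary_iff hs₀).1 hq
  obtain ⟨f, hf, hf'⟩ := exists_extension_chartSpray hzt
  have hfz₀ : 0 < boundaryCoord (f z₀) := by rw [hf' z₀ hℓ.ge]; exact hv
  have hV1 : ∀ᶠ z in 𝓝 z₀, 0 ≤ boundaryCoord z → z ∈ (tchart x₀).target := by
    have h1 : (tchart x₀).target ∈ 𝓝[range (𝓡∂ 2).tangent] z₀ :=
      extChartAt_target_mem_nhdsWithin_of_mem hzt
    rw [range_tangent, mem_nhdsWithin_iff_eventually] at h1
    filter_upwards [h1] with z hz hz0 using hz (mem_halfPlane_prod.2 hz0)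
  -- The chart target is no neighbourhood of the boundary point z₀, so membership in it is only
  -- required on the half space. The other two conditions say that the extended spray points inwards
  -- and is C¹ along the trajectories.
  have hV : {z | (0 ≤ boundaryCoord z → z ∈ (tchart x₀).target) ∧ 0 < boundaryCoord (f z) ∧
      ContDiffAt ℝ 1 f z} ∈ 𝓝 z₀ := by
    refine hV1.and (Filter.Eventually.and ?_ (hf.eventually (by simp)))
    exact (boundaryCoord.continuous.continuousAt.comp hf.continuousAt)
      ((isOpen_lt continuous_const continuous_id).mem_nhds hfz₀)
  obtain ⟨U, hUV, r, ε, φ, A, h⟩ := exists_isLocalFlow hf hV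
  obtain ⟨P, τ, δ₁, hδ₁, hP⟩ := h.exists_footpoint boundaryCoord_transverseVec hℓ hfz₀.ne'
  -- The extended spray points inwards throughout U, so the boundary coordinate increases strictly
  -- along trajectories: those from the boundary enter the interior at once, and there they are true
  -- geodesics.
  have hpos : ∀ z ∈ Metric.ball z₀ r, boundaryCoord z = 0 → ∀ s ∈ Ioo 0 ε,
      0 < boundaryCoord (φ z s) := by
    intro z hz hz0 s hs
    have hd : ∀ u ∈ Ioo (-ε) ε, HasDerivAt (fun u => boundaryCoord (φ z u))
        (boundaryCoord (f (φ z u))) u := fun u hu =>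
      boundaryCoord.hasFDerivAt.comp_hasDerivAt u (h.hasDerivAt z hz u hu)
    have hsub : Ico 0 ε ⊆ Ioo (-ε) ε := fun u hu => ⟨by linarith [hu.1, h.ε_pos], hu.2⟩
    have hm : StrictMonoOn (fun u => boundaryCoord (φ z u)) (Ico 0 ε) := by
      refine strictMonoOn_of_deriv_pos (convex_Ico 0 ε)
        (fun u hu => (hd u (hsub hu)).continuousAt.continuousWithinAt) fun u hu => ?_
      have hu' := hsub (interior_subset hu)
      rw [(hd u hu').deriv]
      exact (hUV (h.mem z hz u hu')).2.1
    have := hm (left_mem_Ico.2 h.ε_pos) (Ioo_subset_Ico_self hs) hs.1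
    simpa only [h.apply_zero z hz, hz0] using this
  have hnn : ∀ z ∈ Metric.ball z₀ r, boundaryCoord z = 0 → ∀ s ∈ Ico 0 ε,
      0 ≤ boundaryCoord (φ z s) := by
    intro z hz hz0 s hs
    rcases hs.1.eq_or_lt with rfl | hs0
    · rw [h.apply_zero z hz, hz0]
    · exact (hpos z hz hz0 s ⟨hs0, hs.2⟩).le
  have hsub : ∀ T ∈ Ioo 0 ε, Icc 0 T ⊆ Ico 0 ε := fun T hT u hu => ⟨hu.1, hu.2.trans_lt hT.2⟩
  have hIco : Ico 0 ε ⊆ Ioo (-ε) ε := fun u hu => ⟨by linarith [hu.1, h.ε_pos], hu.2⟩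
  have htar : ∀ z ∈ Metric.ball z₀ r, boundaryCoord z = 0 → ∀ s ∈ Ico 0 ε,
      φ z s ∈ (tchart x₀).target := fun z hz hz0 s hs =>
    (hUV (h.mem z hz s (hIco hs))).1 (hnn z hz hz0 s hs)
  have hgeo : ∀ z ∈ Metric.ball z₀ r, boundaryCoord z = 0 → ∀ T ∈ Ioo 0 ε,
      IsMIntegralCurveOn (fun s => (tchart x₀).symm (φ z s)) geodesicField (Icc 0 T) := by
    intro z hz hz0 T hT
    refine isMIntegralCurveOn_of_hasDerivWithinAt (fun s hs => ?_)
      fun s hs => htar z hz hz0 s (hsub T hT hs)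
    rw [← hf' _ (hnn z hz hz0 s (hsub T hT hs))]
    exact (h.hasDerivAt z hz s (hIco (hsub T hT hs))).hasDerivWithinAt
  have hreach : ∀ z ∈ Metric.ball z₀ r, boundaryCoord z = 0 → ∀ T ∈ Ioo 0 ε,
      Reaches ((tchart x₀).symm z) ((tchart x₀).symm (φ z T)) T := by
    intro z hz hz0 T hT
    have hzt' : z ∈ (tchart x₀).target := by
      have := htar z hz hz0 0 (left_mem_Ico.2 h.ε_pos)
      rwa [h.apply_zero z hz] at this
    refine ⟨hT.1, ?_, _, hgeo z hz hz0 T hT, by rw [h.apply_zero z hz], rfl, fun s hs => ?_⟩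
    · rw [mem_boundary_iff ((tchart x₀).map_target hzt'), (tchart x₀).right_inv hzt', hz0]
    · have hs' := hsub T hT (Ioc_subset_Icc_self hs)
      rw [mem_interior_iff ((tchart x₀).map_target (htar z hz hz0 s hs')),
        (tchart x₀).right_inv (htar z hz hz0 s hs')]
      exact hpos z hz hz0 s ⟨hs.1, hs'.2⟩
  set δ := min (min δ₁ ε) b with hδ
  have hδpos : 0 < δ := lt_min (lt_min hδ₁ h.ε_pos) hb
  have hδb : δ ≤ b := min_le_right _ _
  have hδε : δ ≤ ε := (min_le_left _ _).trans (min_le_right _ _)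
  have hδδ₁ : δ ≤ δ₁ := (min_le_left _ _).trans (min_le_left _ _)
  have hcφ : ∀ s ∈ Ico 0 δ, c s = (tchart x₀).symm (φ z₀ s) := by
    intro s hs
    rcases hs.1.eq_or_lt with rfl | hs0
    · rw [h.apply_zero z₀ h.center_mem]; exact ((tchart x₀).left_inv hs₀).symm
    · refine eqOn_of_geodesic (left_mem_Icc.2 hs.1)
        (hc.mono (Icc_subset_Icc_right (hs.2.le.trans hδb)))
        (hgeo z₀ h.center_mem hℓ s ⟨hs0, hs.2.trans_le hδε⟩) ?_ (right_mem_Icc.2 hs.1)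
      simp only [h.apply_zero z₀ h.center_mem]
      exact ((tchart x₀).left_inv hs₀).symm
  refine ⟨δ, hδpos, A z₀, h.deriv_zero z₀ h.center_mem, fun s hs => ?_⟩
  have hsI : s ∈ Ico 0 ε := ⟨hs.1, hs.2.trans_le hδε⟩
  have hst := htar z₀ h.center_mem hℓ s hsI
  have hsrc : c s ∈ (tchart x₀).source := by rw [hcφ s hs]; exact (tchart x₀).map_target hst
  have htc : tchart x₀ (c s) = φ z₀ s := by rw [hcφ s hs]; exact (tchart x₀).right_inv hst
  refine ⟨⟨hs.1, hs.2.trans_le hδb⟩, hsrc, fun Y => ?_, fun hs0 => ?_⟩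
  · have h1 := (h.hasDerivAt_deriv z₀ h.center_mem s (hIco hsI)).clm_apply (hasDerivAt_const s Y)
    rw [htc, ← fderiv_extension_chartSpray hst
      ((hUV (h.mem z₀ h.center_mem s (hIco hsI))).2.2.differentiableAt (by simp)) hf']
    refine (h1.congr_deriv ?_).hasDerivWithinAt
    simp
  · obtain ⟨-, hsr, hPs, hτs, hev, D, hD, hDA⟩ := hP s ⟨hs0, hs.2.trans_le hδδ₁⟩
    refine ⟨D ∘L tangentCoordChange (𝓡∂ 2).tangent (c s) ⟨x₀, 0⟩ (c s), ?_, fun Y hY => ?_⟩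
    · have hct := continuousAt_tchart hsrc
      -- Every point near c s is reached by the geodesic issued from its footpoint, so the base
      -- point map is the footpoint projection there.
      have hz : ∀ᶠ p in 𝓝 (c s), p ∈ (tchart x₀).source ∧ P (tchart x₀ p) ∈ (tchart x₀).target ∧
          ∃ T, Reaches ((tchart x₀).symm (P (tchart x₀ p))) p T := by
        rw [ContinuousAt, htc] at hct
        filter_upwards [tchart_source_mem_nhds hsrc, hct.eventually hev] with p hp ⟨h1, h2, h3, h4⟩
        have h5 := hreach _ h2 h1 _ h3
        rw [h4, (tchart x₀).left_inv hp] at h5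
        have h6 := htar _ h2 h1 0 (left_mem_Ico.2 h.ε_pos)
        rw [h.apply_zero _ h2] at h6
        exact ⟨hp, h6, _, h5⟩
      have hbase : ∀ᶠ p in 𝓝 (c s), baseMap p = (tchart x₀).symm (P (tchart x₀ p)) :=
        hz.mono fun p hp => hp.2.2.elim fun _ => Reaches.baseMap_eq
      have hPc : ContinuousAt (fun p => P (tchart x₀ p)) (c s) := by
        refine ContinuousAt.comp (g := P) ?_ hct
        rw [htc]; exact hD.continuousAt
      refine ⟨?_, ?_, ?_, ?_⟩
      · obtain ⟨-, -, T, hT⟩ := hz.self_of_nhds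
        rw [htc, hPs, hz₀, (tchart x₀).left_inv hs₀] at hT
        exact ⟨T, hT⟩
      · filter_upwards [hz, hbase] with p hp hp'
        rw [hp']; exact hp.2.2
      · have h1 : ContinuousAt (fun p => (tchart x₀).symm (P (tchart x₀ p))) (c s) := by
          have h2 := continuousOn_extChartAt_symm (I := (𝓡∂ 2).tangent) (⟨x₀, 0⟩ : TM M) _
            (hz.self_of_nhds).2.1
          exact Filter.Tendsto.comp h2 (tendsto_nhdsWithin_iff.2 ⟨hPc, hz.mono fun p hp => hp.2.1⟩)
        exact h1.congr (hbase.mono fun p hp => hp.symm)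
      · have h1 : HasMFDerivAt 𝓘(ℝ, Plane × Plane) 𝓘(ℝ, Plane × Plane) P (tchart x₀ (c s)) D := by
          rw [htc]; exact hD.hasMFDerivAt
        refine (h1.comp (c s) (hasMFDerivAt_tchart hsrc)).congr_of_eventuallyEq ?_
        filter_upwards [hz, hbase] with p hp hp'
        rw [hp']
        exact (tchart x₀).right_inv hp.2.1
    · rw [ContinuousLinearMap.comp_apply,
        tangentCoordChange_comp ⟨⟨hsrc, mem_extChartAt_source (c s)⟩, hsrc⟩,
        tangentCoordChange_self hsrc]
      exact hDA Y hY

end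

noncomputable section

variable {M : Type*} [TopologicalSpace M] [ChartedSpace (EuclideanHalfSpace 2) M]
  [IsManifold (𝓡∂ 2) ∞ M]

variable [RiemannianBundle (fun x : M => TangentSpace (𝓡∂ 2) x)]
  [IsContMDiffRiemannianBundle (𝓡∂ 2) ∞ Plane (fun x : M => TangentSpace (𝓡∂ 2) x)]

/-! ### The normal component of a Jacobi field -/

/-- The polarized Lagrange identity: a product of areas is a Gram determinant. It converts the
component along v_⊥ into an area and back. -/
theorem IsChartMetric.area_mul_area {P : Type*} [NormedAddCommGroup P] [NormedSpace ℝ P]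
    [FiniteDimensional ℝ P] {e : Fin 2 → P} {x : Fin 2 → P →L[ℝ] ℝ} {S T : Set P}
    {g : P → P →L[ℝ] P →L[ℝ] ℝ} {y : P} (h : IsChartMetric e x S g T) (hy : y ∈ T) (u w w' : P) :
    formArea e x g y u w * formArea e x g y u w' = g y u u * g y w w' - g y u w * g y u w' := by
  have h1 := Real.mul_self_sqrt (h.det_pos hy).le
  have h2 : formArea e x g y u w * formArea e x g y u w'
      = (formGram e g y).det * (coordArea x u w * coordArea x u w') := by
    rw [← h1, formArea, formArea]; ring
  rw [h2, Matrix.det_fin_two, h.gram_comm, form_expand h.coord y u u, form_expand h.coord y w w',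
    form_expand h.coord y u w, form_expand h.coord y u w', h.gram_comm, coordArea, coordArea]
  ring

theorem fst_tangentCoordChange {x₀ : M} {p : TM M} (hp : p ∈ (tchart x₀).source)
    (Y : Plane × Plane) : (tangentCoordChange (𝓡∂ 2).tangent p ⟨x₀, 0⟩ p Y : Plane × Plane).1
      = tangentCoordChange (𝓡∂ 2) p.1 x₀ p.1 Y.1 := by
  have hy := extChartAt_mem_overlap (mem_tchart_source.1 hp)
  obtain ⟨L, hL, hL'⟩ := hasFDerivWithinAt_tchart_transition
    (z := (extChartAt (𝓡∂ 2) p.1 p.1, p.2)) hy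
  have h2 : fderivWithin ℝ (tchart x₀ ∘ (tchart p.1).symm) (range (𝓡∂ 2).tangent) (tchart p.1 p)
      = L := by
    rw [tchart_self]
    exact hL'.fderivWithin ((𝓡∂ 2).tangent.uniqueDiffOn _ ⟨_, tchart_self p⟩)
  rw [tangentCoordChange_def]
  refine (congrArg (fun L : Plane × Plane →L[ℝ] Plane × Plane => (L Y).1) h2).trans ?_
  rw [hL]
  have h3 := fderivWithin_transition hy
  rw [extChartAt_to_inv] at h3
  exact congrArg (fun L : Plane →L[ℝ] Plane => L Y.1) h3

theorem inner_eq_metricForm {x₀ : M} {p : TM M} (hp : p ∈ (tchart x₀).source) (u w : TanM p.1) :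
    inner ℝ u w = metricForm x₀ (tchart x₀ p).1 (tangentCoordChange (𝓡∂ 2) p.1 x₀ p.1 u)
      (tangentCoordChange (𝓡∂ 2) p.1 x₀ p.1 w) := by
  rw [metricForm_apply (mem_extChartAt_target_of_mem_source hp)]
  exact (metricCoord_apply_chart (mem_tchart_source.1 hp) u w).symm

/-- The rotation by `+π/2` in the tangent planes, as a map of the tangent bundle. -/
def perpTM (o : ∀ x : M, Orientation ℝ (TanM x) (Fin 2)) (p : TM M) : TM M :=
  ⟨p.1, perp o p.1 p.2⟩

theorem inner_perp_self (o : ∀ x : M, Orientation ℝ (TanM x) (Fin 2)) (x : M) (v : TanM x) :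
    inner ℝ (perp o x v) v = 0 :=
  (o x).inner_rightAngleRotation_self v

theorem norm_perp (o : ∀ x : M, Orientation ℝ (TanM x) (Fin 2)) (x : M) (v : TanM x) :
    ‖perp o x v‖ = ‖v‖ :=
  (o x).rightAngleRotation.norm_map v

/-- The normal component `⟨v_⊥, dπ Y⟩` of `Y ∈ T_p (TM)`, `p = (x, v)`. -/
def jacobiComp (o : ∀ x : M, Orientation ℝ (TanM x) (Fin 2)) (p : TM M) (Y : Plane × Plane) : ℝ :=
  inner ℝ (perp o p.1 p.2) (Y.1 : TanM p.1)

/-- The normal component of the vertical part of `Y ∈ T_p (TM)`, `p = (x, v)`. -/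
def jacobiVel (o : ∀ x : M, Orientation ℝ (TanM x) (Fin 2)) (p : TM M) (Y : Plane × Plane) : ℝ :=
  inner ℝ (perp o p.1 p.2) (Y.2 + chartChr p.1 (extChartAt (𝓡∂ 2) p.1 p.1) p.2 Y.1 : Plane)

/-- The area form in the chart at `x₀`. -/
abbrev chartArea (x₀ : M) : Plane → Plane → Plane → ℝ :=
  formArea stdVec planeCoord (metricForm x₀)

/-- The sign of the orientation in the chart at `x₀`, over `p`. -/
def chartSign (o : ∀ x : M, Orientation ℝ (TanM x) (Fin 2)) (x₀ : M) (p : TM M) : ℝ :=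
  chartArea x₀ (tchart x₀ p).1 (tchart x₀ p).2 (tchart x₀ (perpTM o p)).2

/-- Apply `area_mul_area` with u = v of length 1 and w = v_⊥ orthogonal to v. The factor area(v,
v_⊥) is ±1, according to whether the chart is positively oriented at the point. -/
theorem inner_perp_eq_area (o : ∀ x : M, Orientation ℝ (TanM x) (Fin 2)) {x₀ : M} {p : TM M}
    (hp : p ∈ (tchart x₀).source) (hu : ‖p.2‖ = 1) (w : TanM p.1) :
    inner ℝ (perp o p.1 p.2) w = chartSign o x₀ p * chartArea x₀ (tchart x₀ p).1 (tchart x₀ p).2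
      (tangentCoordChange (𝓡∂ 2) p.1 x₀ p.1 w) := by
  have h := (isChartMetric x₀).area_mul_area (mem_extChartAt_target_of_mem_source hp)
    (tchart x₀ p).2 (tchart x₀ (perpTM o p)).2 (tangentCoordChange (𝓡∂ 2) p.1 x₀ p.1 w)
  have h1 := norm_sq_eq_metricForm hp
  have h2 : metricForm x₀ (tchart x₀ p).1 (tchart x₀ p).2 (tchart x₀ (perpTM o p)).2 = 0 :=
    (inner_eq_metricForm hp p.2 (perp o p.1 p.2)).symm.trans
      ((real_inner_comm _ _).trans (inner_perp_self o p.1 p.2))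
  rw [← h1, hu, h2] at h
  rw [chartSign, h, one_pow, one_mul, zero_mul, sub_zero]
  exact inner_eq_metricForm hp _ _

theorem chartSign_sq (o : ∀ x : M, Orientation ℝ (TanM x) (Fin 2)) {x₀ : M} {p : TM M}
    (hp : p ∈ (tchart x₀).source) (hu : ‖p.2‖ = 1) : chartSign o x₀ p ^ 2 = 1 := by
  have h := inner_perp_eq_area o hp hu (perp o p.1 p.2)
  rw [real_inner_self_eq_norm_sq, norm_perp, hu] at h
  rw [sq]
  exact h.symm.trans (one_pow 2)

theorem continuousOn_chartSign {o : ∀ x : M, Orientation ℝ (TanM x) (Fin 2)}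
    (ho : IsSurfaceOrientation o) (x₀ : M) :
    ContinuousOn (chartSign o x₀) (tchart x₀).source := by
  have h1 : ContinuousOn (tchart x₀) (tchart x₀).source := continuousOn_extChartAt _
  have h2 : ContinuousOn (fun p => tchart x₀ (perpTM o p)) (tchart x₀).source :=
    h1.comp (Continuous.continuousOn ho) fun p hp => mem_tchart_source.2 (mem_tchart_source.1 hp)
  have h3 : ∀ i j, ContinuousOn
      (fun p => formGram stdVec (metricForm x₀) (tchart x₀ p).1 i j) (tchart x₀).source :=
    fun i j => ((isChartMetric x₀).contDiffOn_gram i j).continuousOn.comp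
      (continuous_fst.comp_continuousOn h1) fun p hp => mem_extChartAt_target_of_mem_source hp
  have h4 : ∀ i : Fin 2, ContinuousOn (fun p => planeCoord i (tchart x₀ p).2) (tchart x₀).source :=
    fun i => (planeCoord i).continuous.comp_continuousOn (continuous_snd.comp_continuousOn h1)
  have h5 : ∀ i : Fin 2, ContinuousOn (fun p => planeCoord i (tchart x₀ (perpTM o p)).2)
      (tchart x₀).source :=
    fun i => (planeCoord i).continuous.comp_continuousOn (continuous_snd.comp_continuousOn h2)
  refine ContinuousOn.mul (ContinuousOn.sqrt ?_)
    (((h4 0).mul (h5 1)).sub ((h4 1).mul (h5 0)))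
  simp only [Matrix.det_fin_two]
  exact ((h3 0 0).mul (h3 1 1)).sub ((h3 0 1).mul (h3 1 0))

theorem jacobiComp_tangentCoordChange (o : ∀ x : M, Orientation ℝ (TanM x) (Fin 2)) {x₀ : M}
    {p : TM M} (hp : p ∈ (tchart x₀).source) (hu : ‖p.2‖ = 1) (Y : Plane × Plane) :
    jacobiComp o p (tangentCoordChange (𝓡∂ 2).tangent ⟨x₀, 0⟩ p p Y)
      = chartSign o x₀ p * chartArea x₀ (tchart x₀ p).1 (tchart x₀ p).2 Y.1 := by
  refine (inner_perp_eq_area o hp hu _).trans ?_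
  have h := fst_tangentCoordChange hp (tangentCoordChange (𝓡∂ 2).tangent ⟨x₀, 0⟩ p p Y)
  rw [tangentCoordChange_comp ⟨⟨hp, mem_extChartAt_source p⟩, hp⟩, tangentCoordChange_self hp] at h
  exact congrArg (fun w => chartSign o x₀ p * chartArea x₀ (tchart x₀ p).1 (tchart x₀ p).2 w) h.symm

/-- In the chart the normal component is a sign times area(v, J). The sign is continuous along c
because the orientation is, and has square 1, so it is constant on the connected set I. What remains
is `hasDerivWithinAt_jacobi` at unit speed. The value and the derivative of k are only identified at
t, where the chart is the preferred one. -/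
theorem exists_hasDerivWithinAt_jacobiComp {o : ∀ x : M, Orientation ℝ (TanM x) (Fin 2)}
    (ho : IsSurfaceOrientation o) {c : ℝ → TM M} {I : Set ℝ} (hI : IsPreconnected I)
    (hc : IsMIntegralCurveOn c geodesicField I) (hu : ∀ s ∈ I, ‖(c s).2‖ = 1) {t : ℝ} (ht : t ∈ I)
    (hs : ∀ s ∈ I, c s ∈ (tchart (c t).1).source) {W : ℝ → Plane × Plane}
    (hW : ∀ s ∈ I, HasDerivWithinAt W (chartSprayDeriv (c t).1 (tchart (c t).1 (c s)) (W s)) I s) :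
    ∃ k : ℝ → ℝ, k t = jacobiVel o (c t) (W t) ∧
      (∀ s ∈ I, HasDerivWithinAt (fun s => jacobiComp o (c s)
        (tangentCoordChange (𝓡∂ 2).tangent ⟨(c t).1, 0⟩ (c s) (c s) (W s))) (k s) I s) ∧
      HasDerivWithinAt k (-(gaussCurvature (c t).1 * jacobiComp o (c t) (W t))) I t := by
  set x₀ := (c t).1 with hx₀
  set σ := chartSign o x₀ (c t) with hσ
  have hσc : ∀ s ∈ I, chartSign o x₀ (c s) = σ := by
    intro s hsI
    have h1 : ContinuousOn (fun s => chartSign o x₀ (c s)) I :=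
      (continuousOn_chartSign ho x₀).comp hc.continuousOn hs
    have h2 : EqOn ((fun s => chartSign o x₀ (c s)) ^ 2) ((fun _ => σ) ^ 2) I := fun s hsI =>
      (chartSign_sq o (hs s hsI) (hu s hsI)).trans (chartSign_sq o (hs t ht) (hu t ht)).symm
    exact hI.eq_of_sq_eq h1 continuousOn_const h2
      (fun {s} _ h0 => by
        have := chartSign_sq o (hs t ht) (hu t ht)
        rw [← hσ, h0] at this
        norm_num at this) ht rfl hsI
  have hj := fun s (hsI : s ∈ I) => (isChartMetric x₀).hasDerivWithinAt_jacobi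
    (hasDerivWithinAt_tchart hc hsI (hs s hsI)) (hW s hsI)
    (fun s _ => mem_halfPlane.2 tchart_mem_halfPlane)
    (mem_extChartAt_target_of_mem_source (hs s hsI))
  have hcen : ∀ w : TanM (c t).1, inner ℝ (perp o (c t).1 (c t).2) w
      = σ * chartArea x₀ (tchart x₀ (c t)).1 (tchart x₀ (c t)).2 w := fun w =>
    (inner_perp_eq_area o (hs t ht) (hu t ht) w).trans
      (congrArg (fun w => σ * chartArea x₀ (tchart x₀ (c t)).1 (tchart x₀ (c t)).2 w)
        (tangentCoordChange_center x₀ w))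
  have hself := tchart_self (c t)
  refine ⟨fun s => σ * chartArea x₀ (tchart x₀ (c s)).1 (tchart x₀ (c s)).2 ((W s).2
    + chartChr x₀ (tchart x₀ (c s)).1 (tchart x₀ (c s)).2 (W s).1), ?_, fun s hsI => ?_, ?_⟩
  · refine Eq.trans ?_ (hcen _).symm
    have h2 : (W t).2 + chartChr x₀ (tchart x₀ (c t)).1 (tchart x₀ (c t)).2 (W t).1
        = (W t).2 + chartChr x₀ (extChartAt (𝓡∂ 2) x₀ x₀) (c t).2 (W t).1 := by
      rw [hself]
    exact congrArg (fun w => σ * chartArea x₀ (tchart x₀ (c t)).1 (tchart x₀ (c t)).2 w) h2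
  · refine ((hj s hsI).1.const_mul σ).congr (fun s hsI => ?_) ?_ <;>
    · rw [jacobiComp_tangentCoordChange o (hs s hsI) (hu s hsI), hσc s hsI]
  · refine ((hj t ht).2.const_mul σ).congr_deriv ?_
    have h1 : metricForm x₀ (tchart x₀ (c t)).1 (tchart x₀ (c t)).2 (tchart x₀ (c t)).2 = 1 := by
      rw [← norm_sq_eq_metricForm (hs t ht), hu t ht, one_pow]
    have h2 : formGauss stdVec HalfPlane (metricForm x₀) (tchart x₀ (c t)).1
        = gaussCurvature (c t).1 := (gaussCurvature_eq _).symm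
    have h3 : jacobiComp o (c t) (W t)
      = σ * chartArea x₀ (tchart x₀ (c t)).1 (tchart x₀ (c t)).2 (W t).1 := hcen _
    rw [h1, h2, h3]
    ring

end

noncomputable section

variable {M : Type*} [TopologicalSpace M] [ChartedSpace (EuclideanHalfSpace 2) M]
  [IsManifold (𝓡∂ 2) ∞ M]

variable [RiemannianBundle (fun x : M => TangentSpace (𝓡∂ 2) x)]
  [IsContMDiffRiemannianBundle (𝓡∂ 2) ∞ Plane (fun x : M => TangentSpace (𝓡∂ 2) x)]

/-! ### The derivative of the base point map along a geodesic -/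

/-- `c` is a unit speed geodesic on `[0, b]` which starts at the boundary, with a velocity that
points inwards, and stays in the interior for the times in `(0, b)`. -/
structure IsEntering (c : ℝ → TM M) (b : ℝ) : Prop where
  pos : 0 < b
  geodesic : IsMIntegralCurveOn c geodesicField (Icc 0 b)
  boundary : (c 0).1 ∈ (𝓡∂ 2).boundary M
  inward : 0 < planeCoord 0 (c 0).2
  interior : ∀ s ∈ Ioo 0 b, (c s).1 ∈ (𝓡∂ 2).interior M
  unit : ‖(c 0).2‖ = 1

theorem IsBaseDeriv.hasMFDerivAt_baseMap [T2Space M] {q p : TM M}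
    {D : Plane × Plane →L[ℝ] Plane × Plane} (h : IsBaseDeriv q p D) :
    HasMFDerivAt (𝓡∂ 2).tangent (𝓡∂ 2).tangent baseMap p D := by
  refine ⟨h.continuousAt, ?_⟩
  have h1 := h.hasMFDerivAt.2
  rw [← h.baseMap_eq] at h1
  exact h1

/-- Near p the base point map takes values over the boundary, so the boundary coordinate of its
values vanishes identically. -/
theorem IsBaseDeriv.boundaryCoord_apply [T2Space M] {q p : TM M}
    {D : Plane × Plane →L[ℝ] Plane × Plane} (h : IsBaseDeriv q p D) (Y : Plane × Plane) :
    boundaryCoord (D Y) = 0 := by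
  have h1 := (boundaryCoord.hasMFDerivAt (x := tchart q.1 (baseMap p))).comp p h.hasMFDerivAt
  have h2 : (boundaryCoord ∘ fun p' => tchart q.1 (baseMap p')) =ᶠ[𝓝 p] fun _ => (0 : ℝ) := by
    have hm : (tchart q.1).source ∈ 𝓝 (baseMap p) := by
      rw [h.baseMap_eq]; exact tchart_source_mem_nhds (mem_tchart_source_self q)
    filter_upwards [h.eventually, h.continuousAt hm] with p' ⟨T, hT⟩ hp'
    exact (mem_boundary_iff hp').1 hT.2.1
  have h3 := h1.congr_of_eventuallyEq h2.symm
  have h4 := hasMFDerivAt_unique h3 (hasMFDerivAt_const (0 : ℝ) p)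
  exact congrArg (fun L : Plane × Plane →L[ℝ] ℝ => L Y) h4

namespace IsEntering

variable {c : ℝ → TM M} {b : ℝ}

theorem norm_eq (h : IsEntering c b) {s : ℝ} (hs : s ∈ Icc 0 b) : ‖(c s).2‖ = 1 :=
  (norm_eq_of_geodesic h.geodesic hs (left_mem_Icc.2 h.pos.le)).trans h.unit

theorem reaches (h : IsEntering c b) {t : ℝ} (ht : t ∈ Ioo 0 b) : Reaches (c 0) (c t) t :=
  ⟨ht.1, h.boundary, c, h.geodesic.mono (Icc_subset_Icc_right ht.2.le), rfl, rfl,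
    fun s hs => h.interior s ⟨hs.1, hs.2.trans_lt ht.2⟩⟩

/-- The base point map is constantly c 0 along c, and the geodesic field is the velocity of c. -/
theorem apply_geodesicField [T2Space M] (h : IsEntering c b) {t : ℝ} (ht : t ∈ Ioo 0 b)
    {D : Plane × Plane →L[ℝ] Plane × Plane} (hD : IsBaseDeriv (c 0) (c t) D) :
    D (geodesicField (c t)) = 0 := by
  have h0 := hD.hasMFDerivAt.comp t
    ((h.geodesic t (Ioo_subset_Icc_self ht)).hasMFDerivAt (Icc_mem_nhds ht.1 ht.2))
  have h2 : ((fun p' => tchart (c 0).1 (baseMap p')) ∘ c) =ᶠ[𝓝 t]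
      fun _ => tchart (c 0).1 (c 0) := by
    filter_upwards [isOpen_Ioo.mem_nhds ht] with s hs
    exact congrArg (tchart (c 0).1) (h.reaches hs).baseMap_eq
  have h3 := h0.congr_of_eventuallyEq h2.symm
  have h4 := hasMFDerivAt_unique h3 (hasMFDerivAt_const (tchart (c 0).1 (c 0)) t)
  have h5 := congrArg (fun L : ℝ →L[ℝ] Plane × Plane => L 1) h4
  refine Eq.trans ?_ h5
  exact congrArg D (one_smul ℝ (geodesicField (c t) : Plane × Plane)).symm

/-- For small times the boundary box gives a derivative with a right inverse on the hyperplane of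
vectors tangent to the boundary. Flow boxes carry existence and surjectivity of the derivative in
both directions, so the property is locally constant on the connected interval (0, b). -/
theorem exists_surjective [T2Space M] (h : IsEntering c b) {t : ℝ} (ht : t ∈ Ioo 0 b) :
    ∃ D, IsBaseDeriv (c 0) (c t) D ∧ ∀ Y, boundaryCoord Y = 0 → ∃ Y', D Y' = Y := by
  set R : ℝ → Prop := fun t =>
    ∃ D, IsBaseDeriv (c 0) (c t) D ∧ ∀ Y, boundaryCoord Y = 0 → ∃ Y', D Y' = Y with hR
  have hloc : ∀ t₀ ∈ Ioo 0 b, ∀ᶠ t in 𝓝[Ioo 0 b] t₀, (R t₀ ↔ R t) := by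
    intro t₀ ht₀
    obtain ⟨δ, hδ, W, -, hW⟩ := exists_flow_box h.geodesic ht₀ (h.interior t₀ ht₀)
    have hev : ∀ᶠ t in 𝓝 t₀, t - t₀ ∈ Ioo (-δ) δ := by
      have : ContinuousAt (fun t => t - t₀) t₀ := by fun_prop
      exact this (isOpen_Ioo.mem_nhds (by simp [hδ]))
    filter_upwards [hev.filter_mono nhdsWithin_le_nhds] with t ht
    obtain ⟨-, hsrc, -, -, hinj, hq⟩ := hW _ ht
    rw [add_sub_cancel] at hsrc hq
    obtain ⟨hq1, hq2⟩ := hq (c 0)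
    constructor
    · rintro ⟨D, hD, hsurj⟩
      obtain ⟨D', hD'⟩ := hq1 D hD
      refine ⟨D', hD', fun Y hY => ?_⟩
      obtain ⟨Y', rfl⟩ := hsurj Y hY
      rw [hD.unique (hq2 D' hD')]
      exact ⟨_, rfl⟩
    · rintro ⟨D', hD', hsurj⟩
      refine ⟨_, hq2 D' hD', fun Y hY => ?_⟩
      obtain ⟨Y', rfl⟩ := hsurj Y hY
      have hinj' : Function.Injective (tangentCoordChange (𝓡∂ 2).tangent ⟨(c t₀).1, 0⟩ (c t) (c t)
          ∘L W (t - t₀) : Plane × Plane →L[ℝ] Plane × Plane).toLinearMap :=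
        (tangentCoordChange_tangent_injective hsrc).comp hinj
      obtain ⟨Z, hZ⟩ := LinearMap.injective_iff_surjective.1 hinj' Y'
      exact ⟨Z, congrArg D' hZ⟩
  have hin : 0 < (tchart (c 0).1 (c 0)).2 0 := by
    rw [tchart_self]; exact h.inward
  obtain ⟨δ, hδ, W, -, hW⟩ := exists_boundary_box h.pos h.geodesic h.boundary hin
  obtain ⟨s, hs0, hsδ⟩ := exists_between hδ
  obtain ⟨hsb, -, -, hD⟩ := hW s ⟨hs0.le, hsδ⟩
  obtain ⟨D, hD, hD'⟩ := hD hs0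
  have hRs : R s := ⟨D, hD, fun Y hY => ⟨_, hD' Y hY⟩⟩
  have hiff : R s ↔ R t := isPreconnected_Ioo.induction₂ (fun s t => R s ↔ R t) hloc
    (fun _ _ _ _ _ _ h1 h2 => h1.trans h2) (fun _ _ _ _ h1 => h1.symm) ⟨hs0, hsb.2⟩ ht
  exact hiff.1 hRs

theorem _root_.RiemSurface.finrank_ker_boundaryCoord :
    Module.finrank ℝ (LinearMap.ker boundaryCoord.toLinearMap) = 3 := by
  have h1 := boundaryCoord.toLinearMap.finrank_range_add_finrank_ker
  have h2 : LinearMap.range boundaryCoord.toLinearMap = ⊤ := by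
    rw [LinearMap.range_eq_top]
    intro a
    exact ⟨(a • stdVec 0, 0), by simp [boundaryCoord, stdVec]⟩
  rw [h2, finrank_top] at h1
  simp at h1
  omega

/-- Rank and nullity: T(TM) has dimension 4 and the range of D contains a space of dimension 3, so
the kernel is at most a line. It contains the geodesic field, which is nonzero at unit speed. -/
theorem exists_smul_of_apply_eq_zero [T2Space M] (h : IsEntering c b) {t : ℝ} (ht : t ∈ Ioo 0 b)
    {D : Plane × Plane →L[ℝ] Plane × Plane} (hD : IsBaseDeriv (c 0) (c t) D) {Y : Plane × Plane}
    (hY : D Y = 0) : ∃ a : ℝ, Y = a • (geodesicField (c t) : Plane × Plane) := by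
  obtain ⟨D', hD', hsurj⟩ := h.exists_surjective ht
  obtain rfl := hD.unique hD'
  have h1 := D.toLinearMap.finrank_range_add_finrank_ker
  have h2 : Module.finrank ℝ (LinearMap.ker boundaryCoord.toLinearMap)
      ≤ Module.finrank ℝ (LinearMap.range D.toLinearMap) :=
    Submodule.finrank_mono fun Y hY => hsurj Y hY
  rw [finrank_ker_boundaryCoord] at h2
  have h3 : Module.finrank ℝ (Plane × Plane) = 4 := by simp
  have h4 : Module.finrank ℝ (LinearMap.ker D.toLinearMap) ≤ 1 := by omega
  have hX : (geodesicField (c t) : Plane × Plane) ≠ 0 := by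
    intro h0
    have h5 : (c t).2 = 0 := congrArg Prod.fst h0
    have h6 := h.norm_eq (Ioo_subset_Icc_self ht)
    rw [h5, norm_zero] at h6
    exact zero_ne_one h6
  obtain ⟨v, hv⟩ := finrank_le_one_iff.1 h4
  obtain ⟨a, ha⟩ := hv ⟨Y, hY⟩
  obtain ⟨d, hd⟩ := hv ⟨geodesicField (c t), h.apply_geodesicField ht hD⟩
  have key : ∀ X : Plane × Plane, X ≠ 0 → d • (v : Plane × Plane) = X → Y = (a * d⁻¹) • X := by
    rintro X hX rfl
    have hd0 : d ≠ 0 := fun h0 => hX (by rw [h0, zero_smul])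
    rw [smul_smul, mul_assoc, inv_mul_cancel₀ hd0, mul_one]
    exact (congrArg Subtype.val ha).symm
  exact ⟨_, key _ hX (congrArg Subtype.val hd)⟩

end IsEntering

end

noncomputable section

variable {M : Type*} [TopologicalSpace M] [ChartedSpace (EuclideanHalfSpace 2) M]
  [IsManifold (𝓡∂ 2) ∞ M]

variable [RiemannianBundle (fun x : M => TangentSpace (𝓡∂ 2) x)]
  [IsContMDiffRiemannianBundle (𝓡∂ 2) ∞ Plane (fun x : M => TangentSpace (𝓡∂ 2) x)]

/-! ### The Jacobi fields given by the base point map -/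

theorem tangentCoordChange_tangent_center (p : TM M) (Y : Plane × Plane) :
    tangentCoordChange (𝓡∂ 2).tangent ⟨p.1, 0⟩ p p Y = Y :=
  tangentCoordChange_self (I := (𝓡∂ 2).tangent) (mem_extChartAt_source p)

theorem jacobiComp_add_smul_geodesicField (o : ∀ x : M, Orientation ℝ (TanM x) (Fin 2)) (p : TM M)
    (Y : Plane × Plane) (a : ℝ) {X : Plane × Plane} (hX : X = geodesicField p) :
    jacobiComp o p (Y + a • X) = jacobiComp o p Y := by
  subst hX
  have h : ∀ u w : TanM p.1, inner ℝ (perp o p.1 p.2) (u + a • p.2) = inner ℝ (perp o p.1 p.2) u := by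
    intro u w
    rw [inner_add_right, real_inner_smul_right, inner_perp_self, mul_zero, add_zero]
  exact h Y.1 p.2

namespace IsEntering

variable {c : ℝ → TM M} {b : ℝ} {o : ∀ x : M, Orientation ℝ (TanM x) (Fin 2)}

/-- Two preimages differ by a multiple of the geodesic field, whose projection v is orthogonal to
v_⊥. Hence the normal component depends only on the image. -/
theorem jacobiComp_eq [T2Space M] (h : IsEntering c b) {t : ℝ} (ht : t ∈ Ioo 0 b)
    {D D' : Plane × Plane →L[ℝ] Plane × Plane} {Y Y' : Plane × Plane}
    (hD : IsBaseDeriv (c 0) (c t) D) (hD' : IsBaseDeriv (c 0) (c t) D') (hY : D Y = D' Y') :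
    jacobiComp o (c t) Y = jacobiComp o (c t) Y' := by
  obtain rfl := hD.unique hD'
  obtain ⟨a, ha⟩ := h.exists_smul_of_apply_eq_zero ht hD (Y := Y - Y')
    (by rw [map_sub, hY, sub_self])
  rw [sub_eq_iff_eq_add'.1 ha]
  exact jacobiComp_add_smul_geodesicField o (c t) Y' a rfl

theorem hasDerivAt_of_flow_box {x₀ : M} {z : Plane × Plane} (hz : z ∈ (tchart x₀).target)
    (hb : 0 < boundaryCoord z) {W : ℝ → Plane × Plane →L[ℝ] Plane × Plane} {s : ℝ}
    (hW : HasDerivAt W (fderiv ℝ (chartSpray x₀) z ∘L W s) s) (Y : Plane × Plane) :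
    HasDerivAt (fun s => W s Y) (chartSprayDeriv x₀ z (W s Y)) s := by
  have h1 := hW.clm_apply (hasDerivAt_const s Y)
  rw [← fderiv_extension_chartSpray hz
    ((contDiffAt_chartSpray hz hb).differentiableAt (by simp)) (fun _ _ => rfl)]
  simpa using h1

/-- The normal component of the preimages of `Y₀` under the derivative of the base point map is a
solution of the scalar Jacobi equation. -/
theorem exists_jacobi [T2Space M] (ho : IsSurfaceOrientation o) (h : IsEntering c b)
    {Y₀ : Plane × Plane} (hY₀ : boundaryCoord Y₀ = 0) :
    ∃ j k : ℝ → ℝ, j 0 = jacobiComp o (c 0) Y₀ ∧ k 0 = jacobiVel o (c 0) Y₀ ∧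
      (∀ t ∈ Ico 0 b, HasDerivWithinAt j (k t) (Ico 0 b) t ∧
        HasDerivWithinAt k (-(gaussCurvature (c t).1 * j t)) (Ico 0 b) t) ∧
      ∀ t ∈ Ioo 0 b, ∀ D Y, IsBaseDeriv (c 0) (c t) D → D Y = Y₀ → jacobiComp o (c t) Y = j t := by
  -- At each interior time the function j is the normal component of an arbitrary preimage of Y₀.
  -- Its value at time 0 is prescribed, since the base point map is only differentiated at interior
  -- points.
  have hex : ∀ t : ℝ, ∃ r : ℝ, (t = 0 → r = jacobiComp o (c 0) Y₀) ∧ (t ∈ Ioo 0 b →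
      ∀ D Y, IsBaseDeriv (c 0) (c t) D → D Y = Y₀ → jacobiComp o (c t) Y = r) := by
    intro t
    by_cases ht : t ∈ Ioo 0 b
    · obtain ⟨D, hD, hsurj⟩ := h.exists_surjective ht
      obtain ⟨Y, hY⟩ := hsurj Y₀ hY₀
      exact ⟨jacobiComp o (c t) Y, fun h0 => absurd ht.1 (by simp [h0]), fun _ D' Y' hD' hY' =>
        h.jacobiComp_eq ht hD' hD (hY'.trans hY.symm)⟩
    · exact ⟨_, fun _ => rfl, fun h' => absurd h' ht⟩
  choose j hj0 hj using hex
  have hloc : ∀ t ∈ Ico 0 b, ∃ k : ℝ → ℝ, (t = 0 → k t = jacobiVel o (c 0) Y₀) ∧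
      (∀ᶠ s in 𝓝[Ico 0 b] t, HasDerivWithinAt j (k s) (Ico 0 b) s) ∧
      HasDerivWithinAt k (-(gaussCurvature (c t).1 * j t)) (Ico 0 b) t := by
    have key : ∀ {t : ℝ} {I : Set ℝ} {V : ℝ → Plane × Plane}, IsPreconnected I → t ∈ I →
        I ⊆ Ico 0 b → (∀ s ∈ I, I ∈ 𝓝[Ico 0 b] s) →
        (∀ s ∈ I, c s ∈ (tchart (c t).1).source) →
        (∀ s ∈ I, HasDerivWithinAt V
          (chartSprayDeriv (c t).1 (tchart (c t).1 (c s)) (V s)) I s) →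
        (∀ s ∈ I, j s = jacobiComp o (c s)
          (tangentCoordChange (𝓡∂ 2).tangent ⟨(c t).1, 0⟩ (c s) (c s) (V s))) →
        ∃ k : ℝ → ℝ, k t = jacobiVel o (c t) (V t) ∧
          (∀ᶠ s in 𝓝[Ico 0 b] t, HasDerivWithinAt j (k s) (Ico 0 b) s) ∧
          HasDerivWithinAt k (-(gaussCurvature (c t).1 * j t)) (Ico 0 b) t := by
      intro t I V hI ht hIb hIn hs hV hjI
      obtain ⟨k, hk1, hk2, hk3⟩ := exists_hasDerivWithinAt_jacobiComp ho hI
        (h.geodesic.mono (hIb.trans Ico_subset_Icc_self))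
        (fun s hs => h.norm_eq (Ico_subset_Icc_self (hIb hs))) ht hs hV
      refine ⟨k, hk1, ?_, ?_⟩
      · filter_upwards [hIn t ht] with s hsI
        exact ((hk2 s hsI).congr hjI (hjI s hsI)).mono_of_mem_nhdsWithin (hIn s hsI)
      · rw [hjI t ht, tangentCoordChange_tangent_center]
        exact hk3.mono_of_mem_nhdsWithin (hIn t ht)
    intro t ht
    -- At time 0 the vectors W s Y₀ of the boundary box represent the preimages of Y₀ for all small
    -- s > 0 and equal Y₀ at s = 0. This yields the initial values.
    rcases ht.1.eq_or_lt with rfl | ht0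
    · have hin : 0 < (tchart (c 0).1 (c 0)).2 0 := by
        rw [tchart_self]; exact h.inward
      obtain ⟨δ, hδ, W, hW0, hW⟩ := exists_boundary_box h.pos h.geodesic h.boundary hin
      obtain ⟨k, hk1, hk2⟩ := key (t := 0) (I := Ico 0 δ) (V := fun s => W s Y₀)
        isPreconnected_Ico ⟨le_rfl, hδ⟩ (fun s hs => (hW s hs).1)
        (fun s hs => Filter.mem_of_superset
          (Filter.inter_mem self_mem_nhdsWithin (nhdsWithin_le_nhds (isOpen_Iio.mem_nhds hs.2)))
          fun r hr => ⟨hr.1.1, hr.2⟩)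
        (fun s hs => (hW s hs).2.1) (fun s hs => (hW s hs).2.2.1 Y₀)
        (fun s hs => by
          rcases hs.1.eq_or_lt with rfl | hs0
          · rw [hj0 0 rfl, tangentCoordChange_tangent_center, hW0]; rfl
          · obtain ⟨hsb, -, -, hD⟩ := hW s hs
            obtain ⟨D, hD, hD'⟩ := hD hs0
            exact (hj s ⟨hs0, hsb.2⟩ D _ hD (hD' Y₀ hY₀)).symm)
      refine ⟨k, fun _ => ?_, hk2⟩
      rw [hk1, hW0]; rfl
    -- At an interior time t a single preimage Y is transported by the linearized flow; by the flow
    -- box identity it remains a preimage of Y₀ at the nearby times.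
    · have ht' : t ∈ Ioo 0 b := ⟨ht0, ht.2⟩
      obtain ⟨δ, hδ, W, -, hW⟩ := exists_flow_box h.geodesic ht' (h.interior t ht')
      obtain ⟨D, hD, hsurj⟩ := h.exists_surjective ht'
      obtain ⟨Y, hY⟩ := hsurj Y₀ hY₀
      have hW' : ∀ s ∈ Ioo (t - δ) (t + δ), s - t ∈ Ioo (-δ) δ := fun s hs =>
        ⟨by linarith [hs.1], by linarith [hs.2]⟩
      obtain ⟨k, hk1, hk2⟩ := key (t := t) (I := Ioo (t - δ) (t + δ)) (V := fun s => W (s - t) Y)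
        isPreconnected_Ioo ⟨by linarith, by linarith⟩
        (fun s hs => by
          have := (hW _ (hW' s hs)).1
          rw [add_sub_cancel] at this
          exact Ioo_subset_Ico_self this)
        (fun s hs => nhdsWithin_le_nhds (isOpen_Ioo.mem_nhds hs))
        (fun s hs => by
          have := (hW _ (hW' s hs)).2.1
          rwa [add_sub_cancel] at this)
        (fun s hs => by
          obtain ⟨-, h1, h2, h3, -⟩ := hW _ (hW' s hs)
          rw [add_sub_cancel] at h1 h2 h3
          exact ((hasDerivAt_of_flow_box ((tchart _).map_source h1) h2 h3 Y).comp_sub_const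
            s t).hasDerivWithinAt)
        (fun s hs => by
          obtain ⟨h1, -, -, -, -, h2⟩ := hW _ (hW' s hs)
          rw [add_sub_cancel] at h1 h2
          obtain ⟨D', hD', -⟩ := h.exists_surjective h1
          refine (hj s h1 D' _ hD' ?_).symm
          rw [hD.unique ((h2 (c 0)).2 D' hD')] at hY
          exact hY)
      exact ⟨k, fun h0 => absurd h0 ht0.ne', hk2⟩
  -- The local velocities k all agree with the derivative of j within the interval, which therefore
  -- serves as one global velocity.
  have huniq : ∀ t ∈ Ico 0 b, UniqueDiffWithinAt ℝ (Ico 0 b) t := uniqueDiffOn_Ico 0 b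
  have hk : ∀ t ∈ Ico 0 b, (t = 0 → derivWithin j (Ico 0 b) t = jacobiVel o (c 0) Y₀) ∧
      HasDerivWithinAt j (derivWithin j (Ico 0 b) t) (Ico 0 b) t ∧
      HasDerivWithinAt (derivWithin j (Ico 0 b)) (-(gaussCurvature (c t).1 * j t)) (Ico 0 b) t := by
    intro t ht
    obtain ⟨k, hk1, hk2, hk3⟩ := hloc t ht
    have h1 := hk2.self_of_nhdsWithin ht
    have h2 : derivWithin j (Ico 0 b) =ᶠ[𝓝[Ico 0 b] t] k := by
      filter_upwards [hk2, self_mem_nhdsWithin] with s hs hsI using hs.derivWithin (huniq s hsI)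
    have h3 := h1.derivWithin (huniq t ht)
    refine ⟨fun h0 => h3.trans (hk1 h0), ?_, hk3.congr_of_eventuallyEq h2 h3⟩
    rwa [h3]
  have h0 : (0 : ℝ) ∈ Ico 0 b := ⟨le_rfl, h.pos⟩
  exact ⟨j, derivWithin j (Ico 0 b), hj0 0 rfl, (hk 0 h0).1 rfl, fun t ht => (hk t ht).2, hj⟩

end IsEntering

end

noncomputable section

variable {M : Type*} [TopologicalSpace M] [ChartedSpace (EuclideanHalfSpace 2) M]
  [IsManifold (𝓡∂ 2) ∞ M]

variable [RiemannianBundle (fun x : M => TangentSpace (𝓡∂ 2) x)]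
  [IsContMDiffRiemannianBundle (𝓡∂ 2) ∞ Plane (fun x : M => TangentSpace (𝓡∂ 2) x)]

/-! ### The tangent spaces of `SM` and of `∂₊SM` -/

/-- The vertical part of `Y ∈ T_p (TM)`. -/
def vertPart (p : TM M) (Y : Plane × Plane) : Plane :=
  Y.2 + chartChr p.1 (extChartAt (𝓡∂ 2) p.1 p.1) p.2 Y.1

/-- By metric compatibility the derivative of |v|² sees only the vertical part of Y, so T SM
consists of the vectors whose vertical part is orthogonal to v. -/
theorem hasFDerivWithinAt_speed {x₀ : M} {z : Plane × Plane}
    (hz : z.1 ∈ (extChartAt (𝓡∂ 2) x₀).target) : ∃ L : Plane × Plane →L[ℝ] ℝ,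
    (∀ Y, L Y = 2 * metricForm x₀ z.1 z.2 (Y.2 + chartChr x₀ z.1 z.2 Y.1)) ∧
    HasFDerivWithinAt (fun z : Plane × Plane => metricForm x₀ z.1 z.2 z.2) L
      (HalfPlane ×ˢ univ) z := by
  have hm := isChartMetric x₀
  have h1 : HasFDerivWithinAt (fun z : Plane × Plane => metricForm x₀ z.1)
      ((formDeriv HalfPlane (metricForm x₀) z.1) ∘L ContinuousLinearMap.fst ℝ Plane Plane)
      (HalfPlane ×ˢ univ) z :=
    (hm.hasFDerivWithinAt hz).comp z hasFDerivWithinAt_fst fun z hz => hz.1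
  refine ⟨_, fun Y => ?_, (h1.clm_apply hasFDerivWithinAt_snd).clm_apply hasFDerivWithinAt_snd⟩
  simp only [_root_.add_apply, ContinuousLinearMap.comp_apply,
    ContinuousLinearMap.flip_apply, ContinuousLinearMap.coe_fst', ContinuousLinearMap.coe_snd',
    map_add]
  rw [hm.compat hz, hm.chr_comm hz z.2 Y.1, hm.symm z.1 (chartChr x₀ z.1 Y.1 z.2) z.2]
  linear_combination hm.symm z.1 Y.2 z.2

theorem metricForm_self (p : TM M) (u w : TanM p.1) :
    metricForm p.1 (extChartAt (𝓡∂ 2) p.1 p.1) u w = inner ℝ u w :=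
  (metricForm_apply (mem_extChartAt_target _) u w).trans (metricCoord_center p.1 u w)

theorem tchart_target_mem_nhdsWithin (p : TM M) :
    (tchart p.1).target ∈ 𝓝[range (𝓡∂ 2).tangent] (tchart p.1 p) :=
  extChartAt_target_mem_nhdsWithin (I := (𝓡∂ 2).tangent) p

theorem hasMFDerivAt_norm_sq (p : TM M) : ∃ L : Plane × Plane →L[ℝ] ℝ,
    (∀ Y, L Y = 2 * inner ℝ p.2 (vertPart p Y : TanM p.1)) ∧
    HasMFDerivAt (𝓡∂ 2).tangent 𝓘(ℝ, ℝ) (fun q : TM M => ‖q.2‖ ^ 2) p L := by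
  obtain ⟨L, hL, hL'⟩ := hasFDerivWithinAt_speed (z := tchart p.1 p)
    (mem_extChartAt_target_of_mem_source (mem_tchart_source_self p))
  rw [← range_tangent] at hL'
  have h1 : ∀ z ∈ (tchart p.1).target, ‖((tchart p.1).symm z).2‖ ^ 2
      = metricForm p.1 z.1 z.2 z.2 := fun z hz => by
    rw [norm_sq_eq_metricForm ((tchart p.1).map_target hz), (tchart p.1).right_inv hz]
  have h2 := hL'.congr_of_eventuallyEq (f₁ := fun z => ‖((tchart p.1).symm z).2‖ ^ 2)
    (Filter.mem_of_superset (tchart_target_mem_nhdsWithin p) h1)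
    (h1 _ ((tchart p.1).map_source (mem_tchart_source_self p)))
  refine ⟨L, fun Y => ?_, ?_, h2⟩
  · rw [hL, tchart_self]
    exact congrArg (2 * ·) (metricForm_self p _ _)
  · have h3 : ContinuousAt (fun z : TM M => metricForm p.1 (tchart p.1 z).1 (tchart p.1 z).2
        (tchart p.1 z).2) p := by
      have h4 : ContinuousWithinAt (fun z : Plane × Plane => metricForm p.1 z.1 z.2 z.2)
        (range (𝓡∂ 2).tangent) (tchart p.1 p) := hL'.continuousWithinAt
      have h5 : Filter.Tendsto (tchart p.1) (𝓝 p) (𝓝[range (𝓡∂ 2).tangent] (tchart p.1 p)) :=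
        tendsto_nhdsWithin_iff.2 ⟨continuousAt_tchart (mem_tchart_source_self p),
          Filter.Eventually.of_forall fun q => mem_range_self _⟩
      exact Filter.Tendsto.comp h4 h5
    refine h3.congr ?_
    filter_upwards [tchart_source_mem_nhds (mem_tchart_source_self p)] with q hq
      using (norm_sq_eq_metricForm hq).symm

theorem mem_tangentSM {p : TM M} {Y : Plane × Plane} :
    Y ∈ tangentSM p ↔ inner ℝ p.2 (vertPart p Y : TanM p.1) = 0 := by
  obtain ⟨L, hL, hL'⟩ := hasMFDerivAt_norm_sq p
  have h1 : Y ∈ tangentSM p ↔ L Y = 0 := by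
    unfold tangentSM
    rw [hL'.mfderiv]
    exact Iff.rfl
  rw [h1, hL]
  simp

theorem dProj_apply (p : TM M) (Y : Plane × Plane) : dProj p Y = Y.1 := by
  have h1 : HasMFDerivAt (𝓡∂ 2).tangent (𝓡∂ 2) (fun q : TM M => q.1) p
      (ContinuousLinearMap.fst ℝ Plane Plane) := by
    refine ⟨continuous_proj_TM.continuousAt, ?_⟩
    have h2 : ∀ z ∈ (tchart p.1).target,
        extChartAt (𝓡∂ 2) p.1 ((tchart p.1).symm z).1 = z.1 := fun z hz =>
      congrArg Prod.fst ((tchart p.1).right_inv hz)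
    exact (hasFDerivWithinAt_fst (𝕜 := ℝ) (s := range (𝓡∂ 2).tangent)
      (p := tchart p.1 p)).congr_of_eventuallyEq
      (Filter.mem_of_superset (tchart_target_mem_nhdsWithin p) h2)
      (h2 _ ((tchart p.1).map_source (mem_tchart_source_self p)))
  unfold dProj
  rw [h1.mfderiv]
  rfl

theorem mem_tangentInflux {p : TM M} {Y : Plane × Plane} :
    Y ∈ tangentInflux p ↔ Y ∈ tangentSM p ∧ boundaryCoord Y = 0 := by
  have h : Y ∈ (boundaryLine p.1).comap (dProj p) ↔ boundaryCoord Y = 0 := by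
    have h1 : dProj p Y ∈ boundaryLine p.1 ↔ boundaryCoord Y = 0 := by
      rw [dProj_apply]
      exact Iff.rfl
    exact h1
  exact and_congr Iff.rfl h

/-- Geodesics have constant speed, so the base point map preserves the norm; differentiate. One
direction restricts the derivative to T SM, the other shows that every preimage of a vector tangent
to ∂₊SM is tangent to SM. -/
theorem IsBaseDeriv.mem_tangentInflux_iff [T2Space M] {q p : TM M}
    {D : Plane × Plane →L[ℝ] Plane × Plane} (h : IsBaseDeriv q p D) {Y : Plane × Plane} :
    (D Y : TanTM q) ∈ tangentInflux q ↔ Y ∈ tangentSM p := by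
  rw [mem_tangentInflux, and_iff_left (h.boundaryCoord_apply Y)]
  obtain ⟨L, hL, hL'⟩ := hasMFDerivAt_norm_sq p
  obtain ⟨K, hK, hK'⟩ := hasMFDerivAt_norm_sq q
  have h1 : HasMFDerivAt (𝓡∂ 2).tangent 𝓘(ℝ, ℝ) ((fun q : TM M => ‖q.2‖ ^ 2) ∘ baseMap) p
      (K ∘L D) := by
    have := h.baseMap_eq
    subst this
    exact hK'.comp p h.hasMFDerivAt_baseMap
  have h2 : ((fun q : TM M => ‖q.2‖ ^ 2) ∘ baseMap) =ᶠ[𝓝 p] fun q : TM M => ‖q.2‖ ^ 2 := by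
    filter_upwards [h.eventually] with p' ⟨T, hT⟩
    exact congrArg (· ^ 2) hT.norm_eq
  have h3 : K ∘L D = L := hasMFDerivAt_unique (h1.congr_of_eventuallyEq h2.symm) hL'
  rw [mem_tangentSM, mem_tangentSM]
  have h4 : K (D Y) = L Y := congrArg (fun L : Plane × Plane →L[ℝ] ℝ => L Y) h3
  rw [hK, hL] at h4
  constructor <;> intro h5 <;> rw [h5] at h4 <;> linarith

theorem geodesicField_mem_tangentSM (p : TM M) : geodesicField p ∈ tangentSM p := by
  refine mem_tangentSM.2 ?_
  have h : vertPart p (geodesicField p) = 0 := by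
    rw [geodesicField_eq]
    exact neg_add_cancel (chartChr p.1 (extChartAt (𝓡∂ 2) p.1 p.1) p.2 p.2)
  rw [h]
  exact inner_zero_right _

/-! ### The inward normal -/

theorem inner_gradBoundaryCoord (x : M) (u : TanM x) :
    inner ℝ u (gradBoundaryCoord x) = planeCoord 0 u := by
  have hy := mem_extChartAt_target (I := 𝓡∂ 2) x
  have hm := isChartMetric x
  have h0 : gradBoundaryCoord x = ((formGram stdVec (metricForm x) (extChartAt (𝓡∂ 2) x x))⁻¹ 0 0
      • stdVec 0 + (formGram stdVec (metricForm x) (extChartAt (𝓡∂ 2) x x))⁻¹ 1 0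
      • stdVec 1 : Plane) := by
    unfold gradBoundaryCoord
    rw [gram_eq hy]
    exact Fin.sum_univ_two _
  have h1 := (metricForm_apply hy u (gradBoundaryCoord x)).trans (metricCoord_center x _ _)
  rw [← h1, h0]
  have h2 := hm.det_ne_zero hy
  have h3 := hm.gram_comm (extChartAt (𝓡∂ 2) x x)
  have h4 : ∀ w : Plane, metricForm x (extChartAt (𝓡∂ 2) x x) w
      ((formGram stdVec (metricForm x) (extChartAt (𝓡∂ 2) x x))⁻¹ 0 0
      • stdVec 0 + (formGram stdVec (metricForm x) (extChartAt (𝓡∂ 2) x x))⁻¹ 1 0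
      • stdVec 1) = planeCoord 0 w := by
    intro w
    rw [form_expand hm.coord]
    simp only [map_add, map_smul, hm.coord.apply, Matrix.inv_def, Ring.inverse_eq_inv',
      Matrix.smul_apply, Matrix.adjugate_fin_two]
    rw [Matrix.det_fin_two] at h2 ⊢
    rw [h3] at h2 ⊢
    generalize formGram stdVec (metricForm x) (extChartAt (𝓡∂ 2) x x) = G at h2 h3 ⊢
    have h5 : (G 0 0 * G 1 1 - G 0 1 * G 0 1) * (G 0 0 * G 1 1 - G 0 1 * G 0 1)⁻¹ = 1 :=
      mul_inv_cancel₀ h2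
    simp
    linear_combination w 0 * h5
  exact h4 u

theorem gradBoundaryCoord_ne_zero (x : M) : gradBoundaryCoord x ≠ 0 := by
  intro h
  have h1 := inner_gradBoundaryCoord x (stdVec 0)
  rw [h] at h1
  have h2 : planeCoord 0 (stdVec 0) = 1 := isCoord_plane.apply 0 0
  exact zero_ne_one ((inner_zero_right _).symm.trans (h1.trans h2))

theorem inner_innerNormal (x : M) (u : TanM x) :
    inner ℝ u (innerNormal x) = ‖gradBoundaryCoord x‖⁻¹ * planeCoord 0 u := by
  rw [innerNormal, real_inner_smul_right, inner_gradBoundaryCoord]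

theorem inner_innerNormal_pos {x : M} {u : TanM x} :
    0 < inner ℝ u (innerNormal x) ↔ 0 < planeCoord 0 u := by
  rw [inner_innerNormal]
  exact mul_pos_iff_of_pos_left (inv_pos.2 (norm_pos_iff.2 (gradBoundaryCoord_ne_zero x)))

theorem eq_inner_smul_add (o : ∀ x : M, Orientation ℝ (TanM x) (Fin 2)) {x : M} {v : TanM x}
    (hv : ‖v‖ = 1) (u : TanM x) :
    u = (inner ℝ v u : ℝ) • v + (inner ℝ (perp o x v) u : ℝ) • perp o x v := by
  have hv0 : v ≠ 0 := fun h => by simp [h] at hv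
  have h1 := ((o x).basisRightAngleRotation v hv0).sum_repr u
  rw [Fin.sum_univ_two, (o x).coe_basisRightAngleRotation v hv0] at h1
  set a := ((o x).basisRightAngleRotation v hv0).repr u 0
  set d := ((o x).basisRightAngleRotation v hv0).repr u 1
  have h2 : a • v + d • perp o x v = u := h1
  have h3 : inner ℝ v (perp o x v) = 0 := (real_inner_comm _ _).trans (inner_perp_self o x v)
  rw [← h2, inner_add_right, inner_add_right, real_inner_smul_right, real_inner_smul_right,
    real_inner_smul_right, real_inner_smul_right, inner_perp_self, h3, real_inner_self_eq_norm_sq,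
    real_inner_self_eq_norm_sq, norm_perp, hv]
  simp

end

noncomputable section

variable {M : Type*} [TopologicalSpace M] [ChartedSpace (EuclideanHalfSpace 2) M]
  [IsManifold (𝓡∂ 2) ∞ M]

variable [RiemannianBundle (fun x : M => TangentSpace (𝓡∂ 2) x)]
  [IsContMDiffRiemannianBundle (𝓡∂ 2) ∞ Plane (fun x : M => TangentSpace (𝓡∂ 2) x)]

/-! ### The frame of `∂₊SM` -/

section Frame

variable {o : ∀ x : M, Orientation ℝ (TanM x) (Fin 2)} {q : TM M}

theorem jacobiComp_add (p : TM M) (Y Z : Plane × Plane) :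
    jacobiComp o p (Y + Z) = jacobiComp o p Y + jacobiComp o p Z :=
  inner_add_right (𝕜 := ℝ) (perp o p.1 p.2) (Y.1 : TanM p.1) (Z.1 : TanM p.1)

theorem jacobiComp_smul (p : TM M) (a : ℝ) (Y : Plane × Plane) :
    jacobiComp o p (a • Y) = a * jacobiComp o p Y :=
  real_inner_smul_right (perp o p.1 p.2) (Y.1 : TanM p.1) a

theorem vertPart_add (p : TM M) (Y Z : Plane × Plane) :
    vertPart p (Y + Z) = vertPart p Y + vertPart p Z := by
  simp only [vertPart, Prod.fst_add, Prod.snd_add, map_add]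
  abel

theorem vertPart_smul (p : TM M) (a : ℝ) (Y : Plane × Plane) :
    vertPart p (a • Y) = a • vertPart p Y := by
  simp only [vertPart, Prod.smul_fst, Prod.smul_snd, map_smul, smul_add]

theorem jacobiVel_eq (p : TM M) (Y : Plane × Plane) :
    jacobiVel o p Y = inner ℝ (perp o p.1 p.2) (vertPart p Y : TanM p.1) := rfl

theorem jacobiVel_add (p : TM M) (Y Z : Plane × Plane) :
    jacobiVel o p (Y + Z) = jacobiVel o p Y + jacobiVel o p Z := by
  rw [jacobiVel_eq, vertPart_add]
  exact inner_add_right (𝕜 := ℝ) (perp o p.1 p.2) (vertPart p Y : TanM p.1) (vertPart p Z : TanM p.1)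

theorem jacobiVel_smul (p : TM M) (a : ℝ) (Y : Plane × Plane) :
    jacobiVel o p (a • Y) = a * jacobiVel o p Y := by
  rw [jacobiVel_eq, vertPart_smul]
  exact real_inner_smul_right (perp o p.1 p.2) (vertPart p Y : TanM p.1) a

theorem vertPart_horizontalLift (p : TM M) (w : TanM p.1) :
    vertPart p (horizontalLift p w) = 0 := by
  have h1 : christoffelAt p.1 w p.2 = chartChr p.1 (extChartAt (𝓡∂ 2) p.1 p.1) p.2 w :=
    (christoffelAt_eq p.1 w p.2).trans
      ((isChartMetric p.1).chr_comm (mem_extChartAt_target p.1) w p.2)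
  have h2 : ∀ u u' : Plane, u = u' → -u + u' = 0 := fun u u' h => by rw [h, neg_add_cancel]
  exact h2 _ _ h1

theorem horizontalLift_mem_tangentSM (p : TM M) (w : TanM p.1) :
    horizontalLift p w ∈ tangentSM p := by
  refine mem_tangentSM.2 ?_
  rw [vertPart_horizontalLift]
  exact inner_zero_right _

theorem vertPart_verticalLift (p : TM M) (w : TanM p.1) : vertPart p (verticalLift p w) = w := by
  have h : ∀ u : Plane, u + chartChr p.1 (extChartAt (𝓡∂ 2) p.1 p.1) p.2 0 = u := fun u => by
    rw [map_zero, add_zero]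
  exact h w

theorem frameV_mem (q : TM M) : frameV o q ∈ tangentInflux q := by
  refine mem_tangentInflux.2 ⟨mem_tangentSM.2 ?_, map_zero (planeCoord 0)⟩
  rw [frameV, vertPart_verticalLift]
  exact (real_inner_comm _ _).trans (inner_perp_self o q.1 q.2)

theorem jacobiComp_frameV (q : TM M) : jacobiComp o q (frameV o q) = 0 :=
  inner_zero_right (𝕜 := ℝ) (perp o q.1 q.2)

theorem jacobiVel_frameV (hq : ‖q.2‖ = 1) : jacobiVel o q (frameV o q) = 1 := by
  refine (congrArg (fun u : TanM q.1 => inner ℝ (perp o q.1 q.2) u)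
    (vertPart_verticalLift q (perp o q.1 q.2))).trans ?_
  rw [real_inner_self_eq_norm_sq, norm_perp, hq, one_pow]

theorem planeCoord_perp_innerNormal (x : M) : planeCoord 0 (perp o x (innerNormal x)) = 0 := by
  have h := inner_innerNormal x (perp o x (innerNormal x))
  rw [inner_perp_self] at h
  exact (mul_eq_zero.1 h.symm).resolve_left
    (inv_ne_zero (norm_ne_zero_iff.2 (gradBoundaryCoord_ne_zero x)))

theorem frameT_mem (q : TM M) : frameT o q ∈ tangentInflux q := by
  refine Submodule.smul_mem _ _ (mem_tangentInflux.2 ⟨horizontalLift_mem_tangentSM _ _, ?_⟩)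
  exact (map_neg (planeCoord 0) (perp o q.1 (innerNormal q.1))).trans
    (neg_eq_zero.2 (planeCoord_perp_innerNormal q.1))

theorem jacobiVel_frameT (q : TM M) : jacobiVel o q (frameT o q) = 0 := by
  refine (jacobiVel_smul q _ (horizontalLift q (-perp o q.1 (innerNormal q.1)))).trans ?_
  exact mul_eq_zero_of_right _ ((congrArg (fun u : TanM q.1 => inner ℝ (perp o q.1 q.2) u)
    (vertPart_horizontalLift q _)).trans (inner_zero_right _))

/-- The rotation is an isometry, so ⟨v_⊥, ν_⊥⟩ = ⟨v, ν⟩, which the normalizing factor of T cancels.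
-/
theorem jacobiComp_frameT (hq : q ∈ influx M) : jacobiComp o q (frameT o q) = -1 := by
  refine (jacobiComp_smul q _ (horizontalLift q (-perp o q.1 (innerNormal q.1)))).trans ?_
  have h1 : jacobiComp o q (horizontalLift q (-perp o q.1 (innerNormal q.1)))
      = -inner ℝ q.2 (innerNormal q.1) :=
    (inner_neg_right (𝕜 := ℝ) (perp o q.1 q.2) (perp o q.1 (innerNormal q.1))).trans
      (congrArg Neg.neg ((o q.1).rightAngleRotation.inner_map_map q.2 (innerNormal q.1)))
  rw [h1, mul_neg, inv_mul_cancel₀ hq.2.2.ne']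

/-- A vanishing normal component makes dπ Y a multiple of v. It is tangent to the boundary while v
is transverse to it, so it is zero. The vertical part is then orthogonal to both v and v_⊥. -/
theorem eq_zero_of_mem_tangentInflux (hq : q ∈ influx M) {Y : Plane × Plane}
    (hY : Y ∈ tangentInflux q) (h1 : jacobiComp o q Y = 0) (h2 : jacobiVel o q Y = 0) : Y = 0 := by
  have hu : ‖q.2‖ = 1 := hq.1
  have hpos : 0 < planeCoord 0 q.2 := inner_innerNormal_pos.1 hq.2.2
  rw [mem_tangentInflux] at hY
  have h3 : (Y.1 : TanM q.1) = (inner ℝ q.2 (Y.1 : TanM q.1) : ℝ) • q.2 := by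
    refine (eq_inner_smul_add o hu (Y.1 : TanM q.1)).trans ?_
    have h4 : inner ℝ (perp o q.1 q.2) (Y.1 : TanM q.1) = 0 := h1
    rw [h4, zero_smul, add_zero]
  have h5 : (inner ℝ q.2 (Y.1 : TanM q.1) : ℝ) * planeCoord 0 q.2 = 0 :=
    ((map_smul (planeCoord 0) (inner ℝ q.2 (Y.1 : TanM q.1) : ℝ) (q.2 : Plane)).symm.trans
      (congrArg (planeCoord 0) h3.symm)).trans hY.2
  have h6 : Y.1 = 0 := by
    refine h3.trans ?_
    rw [(mul_eq_zero.1 h5).resolve_right hpos.ne', zero_smul]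
    rfl
  have h7 : vertPart q Y = Y.2 := by rw [vertPart, h6, map_zero, add_zero]
  have h8 : Y.2 = 0 := by
    refine (eq_inner_smul_add o hu (Y.2 : TanM q.1)).trans ?_
    have h9 := mem_tangentSM.1 hY.1
    rw [jacobiVel_eq] at h2
    rw [h7] at h9 h2
    rw [h9, h2, zero_smul, zero_smul, add_zero]
    rfl
  exact Prod.ext h6 h8

/-- Normal component and velocity are (0, 1) on V and (-1, 0) on T, and they separate points. So
they are the dual coframe up to sign: V^♭ is `jacobiVel` and T^♭ is minus `jacobiComp`. -/
theorem eq_frame (hq : q ∈ influx M) {Y : Plane × Plane} (hY : Y ∈ tangentInflux q)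
    {V T : Plane × Plane} (hV : V = frameV o q) (hT : T = frameT o q) :
    Y = jacobiVel o q Y • V + (-jacobiComp o q Y) • T := by
  have hV' : V ∈ tangentInflux q := hV ▸ frameV_mem q
  have hT' : T ∈ tangentInflux q := hT ▸ frameT_mem q
  have h1 : jacobiComp o q V = 0 := hV ▸ jacobiComp_frameV q
  have h2 : jacobiVel o q V = 1 := hV ▸ jacobiVel_frameV hq.1
  have h3 : jacobiComp o q T = -1 := hT ▸ jacobiComp_frameT hq
  have h4 : jacobiVel o q T = 0 := hT ▸ jacobiVel_frameT q
  set α := jacobiVel o q Y with hα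
  set β := jacobiComp o q Y with hβ
  have h5 : Y + (-α) • V + β • T = 0 := by
    refine eq_zero_of_mem_tangentInflux (o := o) hq ?_ ?_ ?_
    · exact (tangentInflux q).add_mem ((tangentInflux q).add_mem hY
        ((tangentInflux q).smul_mem _ hV')) ((tangentInflux q).smul_mem _ hT')
    · rw [jacobiComp_add, jacobiComp_add, jacobiComp_smul, jacobiComp_smul, h1, h3, ← hβ]; ring
    · rw [jacobiVel_add, jacobiVel_add, jacobiVel_smul, jacobiVel_smul, h2, h4, ← hα]; ring
  have h6 : Y = (Y + (-α) • V + β • T) + (α • V + (-β) • T) := by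
    module
  rw [h5, zero_add] at h6
  exact h6

theorem exists_basis_frame (o : ∀ x : M, Orientation ℝ (TanM x) (Fin 2)) (hq : q ∈ influx M) :
    ∃ e : Module.Basis (Fin 2) ℝ (tangentInflux q),
      (e 0 : TanTM q) = frameV o q ∧ (e 1 : TanTM q) = frameT o q := by
  set v : Fin 2 → tangentInflux q := ![⟨frameV o q, frameV_mem q⟩, ⟨frameT o q, frameT_mem q⟩]
  have hli : LinearIndependent ℝ v := by
    rw [LinearIndependent.pair_iff]
    intro s t hst
    have h1 : s • (frameV o q : Plane × Plane) + t • (frameT o q : Plane × Plane) = 0 :=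
      congrArg Subtype.val hst
    have key : ∀ V T : Plane × Plane, V = frameV o q → T = frameT o q → s • V + t • T = 0 →
        s = 0 ∧ t = 0 := by
      intro V T hV hT h0
      have hc := jacobiComp_add (o := o) q (s • V) (t • T)
      have hv := jacobiVel_add (o := o) q (s • V) (t • T)
      have h00 : jacobiComp o q 0 = 0 := inner_zero_right (𝕜 := ℝ) (perp o q.1 q.2)
      have h01 : jacobiVel o q 0 = 0 := by
        have := jacobiVel_smul (o := o) q 0 0
        rwa [zero_smul, zero_mul] at this
      have h1 : jacobiComp o q V = 0 := hV ▸ jacobiComp_frameV q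
      have h2 : jacobiVel o q V = 1 := hV ▸ jacobiVel_frameV hq.1
      have h3 : jacobiComp o q T = -1 := hT ▸ jacobiComp_frameT hq
      have h4 : jacobiVel o q T = 0 := hT ▸ jacobiVel_frameT q
      rw [h0, jacobiComp_smul, jacobiComp_smul, h1, h3, h00] at hc
      rw [h0, jacobiVel_smul, jacobiVel_smul, h2, h4, h01] at hv
      constructor <;> linarith
    exact key _ _ rfl rfl h1
  have hsp : ⊤ ≤ Submodule.span ℝ (range v) := by
    rintro Y -
    have h1 : Y = jacobiVel o q Y.1 • v 0 + (-jacobiComp o q Y.1) • v 1 :=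
      Subtype.ext (eq_frame hq Y.2 rfl rfl)
    rw [h1]
    exact Submodule.add_mem _ (Submodule.smul_mem _ _ (Submodule.subset_span ⟨0, rfl⟩))
      (Submodule.smul_mem _ _ (Submodule.subset_span ⟨1, rfl⟩))
  refine ⟨Module.Basis.mk hli hsp, ?_, ?_⟩ <;> rw [Module.Basis.mk_apply] <;> rfl

theorem coord_frame (hq : q ∈ influx M) {e : Module.Basis (Fin 2) ℝ (tangentInflux q)}
    (h0 : (e 0 : TanTM q) = frameV o q) (h1 : (e 1 : TanTM q) = frameT o q)
    (Y : tangentInflux q) :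
    e.coord 0 Y = jacobiVel o q Y.1 ∧ e.coord 1 Y = -jacobiComp o q Y.1 := by
  have h : Y = jacobiVel o q Y.1 • e 0 + (-jacobiComp o q Y.1) • e 1 :=
    Subtype.ext (eq_frame hq Y.2 h0 h1)
  constructor
  · conv_lhs => rw [h]
    simp
  · conv_lhs => rw [h]
    simp

end Frame

end

noncomputable section

/-! ### The scalar Jacobi equation -/

theorem wronskian_eq {K y y' z z' : ℝ → ℝ} {b t : ℝ}
    (hy : ∀ t ∈ Ico 0 b, HasDerivWithinAt y (y' t) (Ico 0 b) t ∧
      HasDerivWithinAt y' (-(K t * y t)) (Ico 0 b) t)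
    (hz : ∀ t ∈ Ico 0 b, HasDerivWithinAt z (z' t) (Ico 0 b) t ∧
      HasDerivWithinAt z' (-(K t * z t)) (Ico 0 b) t) (ht : t ∈ Ico 0 b) :
    y t * z' t - y' t * z t = y 0 * z' 0 - y' 0 * z 0 := by
  have hd : ∀ s ∈ Ico 0 b, HasDerivWithinAt (fun s => y s * z' s - y' s * z s) 0 (Ico 0 b) s :=
    fun s hs => (((hy s hs).1.mul (hz s hs).2).sub ((hy s hs).2.mul (hz s hs).1)).congr_deriv
      (by ring)
  have hsub : Icc 0 t ⊆ Ico 0 b := fun s hs => ⟨hs.1, hs.2.trans_lt ht.2⟩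
  exact constant_of_has_deriv_right_zero (f := fun s => y s * z' s - y' s * z s) (a := 0) (b := t)
    (fun s hs => ((hd s (hsub hs)).continuousWithinAt).mono hsub)
    (fun s hs => (hd s (hsub (Ico_subset_Icc_self hs))).mono_of_mem_nhdsWithin
      (Filter.mem_of_superset (Ico_mem_nhdsGE (hs.2.trans ht.2)) (Ico_subset_Ico_left hs.1)))
    t (right_mem_Icc.2 ht.1)

/-- The Wronskians of the pairs (y, d), (y, a) and (a, d) are constant, the last one being 1, and
together they solve for y. No regularity of K is involved. -/
theorem jacobi_eq_combination {K a a' d d' y y' : ℝ → ℝ} {b t : ℝ}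
    (ha : ∀ t ∈ Ico 0 b, HasDerivWithinAt a (a' t) (Ico 0 b) t ∧
      HasDerivWithinAt a' (-(K t * a t)) (Ico 0 b) t) (ha0 : a 0 = 1) (ha0' : a' 0 = 0)
    (hd : ∀ t ∈ Ico 0 b, HasDerivWithinAt d (d' t) (Ico 0 b) t ∧
      HasDerivWithinAt d' (-(K t * d t)) (Ico 0 b) t) (hd0 : d 0 = 0) (hd0' : d' 0 = 1)
    (hy : ∀ t ∈ Ico 0 b, HasDerivWithinAt y (y' t) (Ico 0 b) t ∧
      HasDerivWithinAt y' (-(K t * y t)) (Ico 0 b) t) (ht : t ∈ Ico 0 b) :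
    y t = y 0 * a t + y' 0 * d t := by
  have h1 := wronskian_eq hy hd ht
  have h2 := wronskian_eq hy ha ht
  have h3 := wronskian_eq ha hd ht
  rw [hd0, hd0'] at h1
  rw [ha0, ha0'] at h2
  rw [ha0, ha0', hd0, hd0'] at h3
  linear_combination a t * h1 - d t * h2 - y t * h3

variable {M : Type*} [TopologicalSpace M] [ChartedSpace (EuclideanHalfSpace 2) M]
  [IsManifold (𝓡∂ 2) ∞ M]

variable [RiemannianBundle (fun x : M => TangentSpace (𝓡∂ 2) x)]
  [IsContMDiffRiemannianBundle (𝓡∂ 2) ∞ Plane (fun x : M => TangentSpace (𝓡∂ 2) x)]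

theorem isScalarJacobi_iff {p : TM M} {y₀ y₁ : ℝ} {y : ℝ → ℝ} {c : ℝ → TM M}
    (hc : ∀ t ∈ Ico 0 (exitTime p), geodesicFlow t p = c t) :
    IsScalarJacobi p y₀ y₁ y ↔ ∃ y' : ℝ → ℝ, y 0 = y₀ ∧ y' 0 = y₁ ∧ ∀ t ∈ Ico 0 (exitTime p),
      HasDerivWithinAt y (y' t) (Ico 0 (exitTime p)) t ∧
      HasDerivWithinAt y' (-(gaussCurvature (c t).1 * y t)) (Ico 0 (exitTime p)) t := by
  refine exists_congr fun y' => and_congr_right fun _ => and_congr_right fun _ =>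
    forall_congr' fun t => forall_congr' fun ht => ?_
  rw [hc t ht]

/-! ### Geodesics issued from the boundary -/

theorem exitTime_le {p : TM M} {t : ℝ} (ht : t ∈ hitTimes p) : exitTime p ≤ t :=
  csInf_le ⟨0, fun _ hs => hs.1.le⟩ ht

theorem exists_isEntering [T2Space M] {q : TM M} (hq : q ∈ influx M) (hτ : 0 < exitTime q) :
    ∃ c : ℝ → TM M, c 0 = q ∧ IsEntering c (exitTime q) ∧
      ∀ t ∈ Icc 0 (exitTime q), geodesicFlow t q = c t := by
  -- The infimum of the empty set is 0 by convention, so a positive exit time guarantees that the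
  -- boundary is hit.
  have hne : (hitTimes q).Nonempty := by
    by_contra h
    rw [exitTime, not_nonempty_iff_eq_empty.1 h, Real.sInf_empty] at hτ
    exact lt_irrefl _ hτ
  obtain ⟨t₁, ht₁⟩ := hne
  have hle := exitTime_le ht₁
  obtain ⟨h0, c, hc, -⟩ := ht₁
  rw [isGeodesicFrom_of_le h0.le] at hc
  have hgeo : ∀ t ∈ Icc 0 (exitTime q), IsGeodesicFrom q t c := fun t ht =>
    (isGeodesicFrom_of_le ht.1).2 ⟨hc.1, hc.2.mono (Icc_subset_Icc_right (ht.2.trans hle))⟩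
  refine ⟨c, hc.1, ⟨hτ, hc.2.mono (Icc_subset_Icc_right hle), ?_, ?_, fun s hs => ?_, ?_⟩,
    fun t ht => geodesicFlow_eq (hgeo t ht)⟩
  · rw [hc.1]; exact hq.2.1
  · rw [hc.1]; exact inner_innerNormal_pos.1 hq.2.2
  · by_contra h
    exact absurd (exitTime_le ⟨hs.1, c, hgeo s (Ioo_subset_Icc_self hs),
      mem_boundary_iff_not_mem_interior.2 h⟩) (not_le.2 hs.2)
  · rw [hc.1]; exact hq.1

theorem geodesicFlow_zero (p : TM M) : geodesicFlow 0 p = p := by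
  unfold geodesicFlow
  split_ifs with h
  · exact h.choose_spec.1
  · rfl

theorem negTM_mem_unitTangent {p : TM M} (hp : p ∈ unitTangent M) : negTM p ∈ unitTangent M :=
  (norm_neg p.2).trans hp

/-- Reverse the geodesic with initial data (x, -v) that non-trapping provides, up to its exit time
T. That the end point lies on the boundary is read off from F(p) ∈ ∂₊SM, so T need not be shown to
be a hitting time itself. -/
theorem reaches_of_baseMap_mem_influx [T2Space M] (hM : NonTrapping M) {p : TM M}
    (hp : p ∈ unitTangent M) (hi : p.1 ∈ (𝓡∂ 2).interior M) (hF : baseMap p ∈ influx M) :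
    ∃ T, Reaches (baseMap p) p T := by
  obtain ⟨B, hB⟩ := hM
  obtain ⟨⟨t₁, ht₁⟩, -⟩ := hB (negTM p) (negTM_mem_unitTangent hp) hi
  set T := exitTime (negTM p) with hT
  have hle : T ≤ t₁ := exitTime_le ht₁
  have hbase : baseMap p = geodesicFlow (-T) p := rfl
  have hT0 : 0 ≤ T := Real.sInf_nonneg fun t ht => ht.1.le
  -- If T were 0, then F(p) = p would lie over the interior.
  have hTpos : 0 < T := by
    refine hT0.lt_of_ne fun h0 => ?_
    rw [← h0, neg_zero, geodesicFlow_zero] at hbase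
    rw [hbase] at hF
    exact mem_boundary_iff_not_mem_interior.1 hF.2.1 hi
  obtain ⟨h0, c, hc, -⟩ := ht₁
  rw [isGeodesicFrom_of_le h0.le] at hc
  have hcT := hc.2.mono (Icc_subset_Icc_right hle)
  have hr : IsMIntegralCurveOn (fun s => negTM (c (T - s))) geodesicField (Icc 0 T) :=
    (isMIntegralCurveOn_reverse hcT T).mono fun s hs => ⟨by simp [hs.2], by simp [hs.1]⟩
  have hend : negTM (c (T - T)) = p := by rw [sub_self, hc.1, negTM_negTM]
  have hG : IsGeodesicFrom p (-T) (fun s => negTM (c (T - (s + T)))) := by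
    refine ⟨by simpa using hend, ?_⟩
    rw [uIcc_of_ge (by linarith)]
    simpa using isMIntegralCurveOn_comp_add_Icc hr T
  have hstart : negTM (c (T - 0)) = baseMap p := by
    rw [hbase, geodesicFlow_eq hG, neg_add_cancel]
  refine ⟨T, hTpos, hF.2.1, _, hr, hstart, hend, fun s hs => ?_⟩
  rw [negTM_fst]
  rcases hs.2.eq_or_lt with rfl | hsT
  · rw [sub_self, hc.1]; exact hi
  · by_contra h
    refine absurd (exitTime_le (p := negTM p) (t := T - s) ⟨by linarith, c,
      (isGeodesicFrom_of_le (by linarith)).2 ⟨hc.1, hcT.mono (Icc_subset_Icc_right (by linarith [hs.1]))⟩,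
      mem_boundary_iff_not_mem_interior.2 h⟩) ?_
    rw [← hT]
    linarith [hs.1]

/-- Non-trapping continues the geodesic beyond p up to the boundary, so there is a hitting time. As
p is interior, the continuation stays inside for a short while, which pushes every hitting time
strictly beyond T. -/
theorem Reaches.lt_exitTime [T2Space M] (hM : NonTrapping M) {q p : TM M} {T : ℝ}
    (h : Reaches q p T) (hp : p ∈ unitTangent M) : T < exitTime q := by
  obtain ⟨hT, hq, γ, hγ, hγ0, hγT, hγi⟩ := h
  have hi : p.1 ∈ (𝓡∂ 2).interior M := hγT ▸ hγi T ⟨hT, le_rfl⟩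
  obtain ⟨B, hB⟩ := hM
  obtain ⟨⟨t₂, ht₂, c, hc, hcb⟩, -⟩ := hB p hp hi
  rw [isGeodesicFrom_of_le ht₂.le] at hc
  have h1 : IsMIntegralCurveOn (fun u => c (u - T)) geodesicField (Icc T (T + t₂)) := by
    have := isMIntegralCurveOn_comp_add_Icc hc.2 (-T)
    simpa [sub_eq_add_neg, add_comm] using this
  have h2 := isMIntegralCurveOn_ite hT.le (by linarith) hγ h1 (by simp [hγT, hc.1])
  set d : ℝ → TM M := fun s => if s ≤ T then γ s else c (s - T) with hd
  have hd0 : d 0 = q := by simp [hd, hT.le, hγ0]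
  have hne : (hitTimes q).Nonempty := by
    refine ⟨T + t₂, by linarith, d, (isGeodesicFrom_of_le (by linarith)).2 ⟨hd0, h2⟩, ?_⟩
    simpa [hd, not_le.2 ht₂] using hcb
  have hcont : ContinuousWithinAt c (Icc 0 t₂) 0 := hc.2.continuousWithinAt ⟨le_rfl, ht₂.le⟩
  have hev : ∀ᶠ s in 𝓝[Icc 0 t₂] 0, (c s).1 ∈ (𝓡∂ 2).interior M := by
    rw [← hc.1] at hi
    have hs := mem_tchart_source_self (c 0)
    have h3 : ∀ᶠ p' in 𝓝 (c 0), p'.1 ∈ (𝓡∂ 2).interior M := by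
      have h4 : ContinuousAt (fun p' => boundaryCoord (tchart (c 0).1 p')) (c 0) :=
        boundaryCoord.continuous.continuousAt.comp (continuousAt_tchart hs)
      filter_upwards [tchart_source_mem_nhds hs,
        h4 (isOpen_Ioi.mem_nhds ((mem_interior_iff hs).1 hi))] with p' hp' hp''
        using (mem_interior_iff hp').2 hp''
    exact hcont.eventually h3
  obtain ⟨ε, hε, hεi⟩ : ∃ ε > 0, ∀ s ∈ Icc 0 t₂, s < ε → (c s).1 ∈ (𝓡∂ 2).interior M := by
    obtain ⟨ε, hε, h5⟩ := Metric.mem_nhdsWithin_iff.1 hev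
    exact ⟨ε, hε, fun s hs hsε => h5 ⟨by simpa [abs_of_nonneg hs.1] using hsε, hs⟩⟩
  have hlow : ∀ t ∈ hitTimes q, T + min ε t₂ ≤ t := by
    rintro t ⟨ht, c', hc', hb⟩
    by_contra! hlt
    rw [isGeodesicFrom_of_le ht.le] at hc'
    have h6 := eqOn_of_geodesic (left_mem_Icc.2 ht.le) hc'.2
      (h2.mono (Icc_subset_Icc_right (by linarith [min_le_right ε t₂])))
      (by rw [hc'.1]; exact hd0.symm) (right_mem_Icc.2 ht.le)
    rw [h6] at hb
    refine mem_boundary_iff_not_mem_interior.1 hb ?_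
    by_cases htT : t ≤ T
    · have hdt : d t = γ t := if_pos htT
      rw [hdt]
      exact hγi t ⟨ht, htT⟩
    · have hdt : d t = c (t - T) := if_neg htT
      rw [hdt]
      rw [not_le] at htT
      exact hεi _ ⟨by linarith, by linarith [min_le_right ε t₂]⟩ (by linarith [min_le_left ε t₂])
  have := le_csInf hne hlow
  have h7 : 0 < min ε t₂ := lt_min hε ht₂
  rw [exitTime]
  linarith

/-! ### The derivative of the base point map within `SM` -/

/-- Take the straight line in a chart and rescale its fibre component to unit length. The length has
derivative zero at time 0 because Y is tangent to SM, so rescaling does not change the velocity. -/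
theorem exists_curve_unitTangent {p : TM M} (hp : p ∈ unitTangent M)
    (hi : p.1 ∈ (𝓡∂ 2).interior M) {Y : Plane × Plane} (hY : Y ∈ tangentSM p) :
    ∃ γ : ℝ → TM M, γ 0 = p ∧ (∀ᶠ s in 𝓝 0, γ s ∈ unitTangent M) ∧
      HasMFDerivAt 𝓘(ℝ, ℝ) (𝓡∂ 2).tangent γ 0 ((1 : ℝ →L[ℝ] ℝ).smulRight Y) := by
  have hs := mem_tchart_source_self p
  set z := tchart p.1 p with hz
  have hzt : z ∈ (tchart p.1).target := (tchart p.1).map_source hs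
  have hzn : (tchart p.1).target ∈ 𝓝 z := tchart_target_mem_nhds hzt ((mem_interior_iff hs).1 hi)
  obtain ⟨L, hL, hL'⟩ := hasFDerivWithinAt_speed (z := z) (mem_extChartAt_target_of_mem_source hs)
  have hL'' := hL'.hasFDerivAt (Filter.mem_of_superset hzn (by
    rw [tchart_target]; exact prod_mono (chart_target_subset _) Subset.rfl))
  have hLY : L Y = 0 := by
    rw [hL, hz, tchart_self]
    exact mul_eq_zero_of_right _ ((metricForm_self p p.2 (vertPart p Y)).trans (mem_tangentSM.1 hY))
  have hline : HasDerivAt (fun s : ℝ => z + s • Y) Y 0 := by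
    simpa using ((hasDerivAt_id (0 : ℝ)).smul_const Y).const_add z
  set n : ℝ → ℝ := fun s => metricForm p.1 (z + s • Y).1 (z + s • Y).2 (z + s • Y).2 with hn
  have hn0 : n 0 = 1 := by
    simp only [hn, zero_smul, add_zero]
    rw [← norm_sq_eq_metricForm hs, show ‖p.2‖ = 1 from hp, one_pow]
  have hn' : HasDerivAt n 0 0 := by
    have h1 : HasFDerivAt (fun z : Plane × Plane => metricForm p.1 z.1 z.2 z.2) L
        (z + (0 : ℝ) • Y) := by rwa [zero_smul, add_zero]
    exact (h1.comp_hasDerivAt (0 : ℝ) hline).congr_deriv hLY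
  have hr : HasDerivAt (fun s => (Real.sqrt (n s))⁻¹) 0 0 := by
    have h1 := (hn'.sqrt (by rw [hn0]; exact one_ne_zero)).inv (by simp [hn0])
    refine h1.congr_deriv ?_
    simp
  have hζ : HasDerivAt (fun s => ((z + s • Y).1, (Real.sqrt (n s))⁻¹ • (z + s • Y).2)) Y 0 := by
    have h1 : HasDerivAt (fun s : ℝ => (z + s • Y).1) Y.1 0 :=
      (ContinuousLinearMap.fst ℝ Plane Plane).hasFDerivAt.comp_hasDerivAt 0 hline
    have h2 : HasDerivAt (fun s : ℝ => (z + s • Y).2) Y.2 0 :=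
      (ContinuousLinearMap.snd ℝ Plane Plane).hasFDerivAt.comp_hasDerivAt 0 hline
    refine (h1.prodMk (hr.smul h2)).congr_deriv ?_
    simp [hn0]
  set ζ : ℝ → Plane × Plane := fun s => ((z + s • Y).1, (Real.sqrt (n s))⁻¹ • (z + s • Y).2)
  have hζ0 : ζ 0 = z := by
    change ((z + (0 : ℝ) • Y).1, (Real.sqrt (n 0))⁻¹ • (z + (0 : ℝ) • Y).2) = z
    rw [hn0]; simp
  have hγ0 : (tchart p.1).symm (ζ 0) = p := by rw [hζ0]; exact (tchart p.1).left_inv hs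
  refine ⟨fun s => (tchart p.1).symm (ζ s), hγ0, ?_, ?_⟩
  · have h1 : ∀ᶠ s in 𝓝 0, ζ s ∈ (tchart p.1).target :=
      hζ.continuousAt (by rw [hζ0]; exact hzn)
    have h2 : ∀ᶠ s in 𝓝 0, 0 < n s :=
      hn'.continuousAt (isOpen_Ioi.mem_nhds (by rw [hn0]; exact (one_pos : (0 : ℝ) < 1)))
    filter_upwards [h1, h2] with s hs1 hs2
    have h3 := norm_sq_eq_metricForm ((tchart p.1).map_target hs1)
    rw [(tchart p.1).right_inv hs1] at h3
    have h4 : metricForm p.1 (ζ s).1 (ζ s).2 (ζ s).2 = 1 := by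
      have h5 : metricForm p.1 (ζ s).1 (ζ s).2 (ζ s).2
          = (Real.sqrt (n s))⁻¹ * ((Real.sqrt (n s))⁻¹ * n s) := by
        simp only [ζ, map_smul, smul_apply, smul_eq_mul, hn]
      have h6 := Real.mul_self_sqrt hs2.le
      have h7 := (Real.sqrt_pos.2 hs2).ne'
      rw [h5]
      nth_rewrite 3 [← h6]
      field_simp
    rw [h4] at h3
    exact (sq_eq_sq₀ (norm_nonneg _) zero_le_one).1 (h3.trans (one_pow 2).symm)
  · have h1 := hasMFDerivAt_tchart_symm (x₀ := p.1) (z := ζ 0) (by rw [hζ0]; exact hzn)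
    have hζ' : HasFDerivAt ζ ((1 : ℝ →L[ℝ] ℝ).smulRight Y) 0 :=
      hζ.hasFDerivAt.congr_fderiv (ContinuousLinearMap.ext_ring (by simp))
    have h2 : HasMFDerivAt 𝓘(ℝ, ℝ) (𝓡∂ 2).tangent (fun s => (tchart p.1).symm (ζ s)) 0
        ((tangentCoordChange (𝓡∂ 2).tangent ⟨p.1, 0⟩ ((tchart p.1).symm (ζ 0))
          ((tchart p.1).symm (ζ 0))) ∘L ((1 : ℝ →L[ℝ] ℝ).smulRight Y)) :=
      HasMFDerivAt.comp (0 : ℝ) h1 hζ'.hasMFDerivAt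
    have h3 : (tangentCoordChange (𝓡∂ 2).tangent ⟨p.1, 0⟩ ((tchart p.1).symm (ζ 0))
        ((tchart p.1).symm (ζ 0))) ∘L ((1 : ℝ →L[ℝ] ℝ).smulRight Y)
        = (1 : ℝ →L[ℝ] ℝ).smulRight Y := by
      rw [hγ0]
      refine ContinuousLinearMap.ext_ring ?_
      rw [ContinuousLinearMap.comp_apply]
      exact tangentCoordChange_tangent_center p _
    exact h3 ▸ h2

/-- SM has no interior in TM, so a derivative within SM is determined only on T SM; there it is
tested along curves lying in SM. -/
theorem eqOn_tangentSM {p : TM M} (hp : p ∈ unitTangent M) (hi : p.1 ∈ (𝓡∂ 2).interior M)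
    {D D' : Plane × Plane →L[ℝ] Plane × Plane}
    (hD : HasMFDerivAt (𝓡∂ 2).tangent (𝓡∂ 2).tangent baseMap p D)
    (hD' : HasMFDerivWithinAt (𝓡∂ 2).tangent (𝓡∂ 2).tangent baseMap (unitTangent M) p D')
    {Y : Plane × Plane} (hY : Y ∈ tangentSM p) : D Y = D' Y := by
  obtain ⟨γ, rfl, hγu, hγ⟩ := exists_curve_unitTangent hp hi hY
  have h1 := hD.comp 0 hγ
  have h2 : HasMFDerivWithinAt 𝓘(ℝ, ℝ) (𝓡∂ 2).tangent (baseMap ∘ γ) (γ ⁻¹' unitTangent M) 0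
      (D' ∘L (1 : ℝ →L[ℝ] ℝ).smulRight Y) :=
    HasMFDerivWithinAt.comp 0 hD' hγ.hasMFDerivWithinAt Subset.rfl
  have h3 := hasMFDerivAt_unique h1 (h2.hasMFDerivAt hγu)
  have h4 := congrArg (fun L : ℝ →L[ℝ] Plane × Plane => L 1) h3
  have h5 : D ((1 : ℝ) • Y) = D' ((1 : ℝ) • Y) := h4
  rwa [one_smul] at h5

end

noncomputable section

variable {M : Type*} [TopologicalSpace M] [ChartedSpace (EuclideanHalfSpace 2) M]
  [IsManifold (𝓡∂ 2) ∞ M]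

variable [RiemannianBundle (fun x : M => TangentSpace (𝓡∂ 2) x)]
  [IsContMDiffRiemannianBundle (𝓡∂ 2) ∞ Plane (fun x : M => TangentSpace (𝓡∂ 2) x)]

/-! ### The composition of the canonical relations -/

/-- The differential of the base point map at `φ_t(q)`, in terms of the solutions of the scalar
Jacobi equation. -/
theorem exists_isBaseDeriv_geodesicFlow [T2Space M] {o : ∀ x : M, Orientation ℝ (TanM x) (Fin 2)}
    (ho : IsSurfaceOrientation o) {q p : TM M} (hq : q ∈ influx M) {t : ℝ}
    (ht : t ∈ Ioo 0 (exitTime q)) (hp : geodesicFlow t q = p) :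
    p ∈ unitTangent M ∧ p.1 ∈ (𝓡∂ 2).interior M ∧
    (∃ a b, IsScalarJacobi q 1 0 a ∧ IsScalarJacobi q 0 1 b) ∧
    ∃ D, IsBaseDeriv q p D ∧ D (geodesicField p) = 0 ∧
      (∀ Y, boundaryCoord Y = 0 → ∃ Y', D Y' = Y) ∧
      ∀ a b, IsScalarJacobi q 1 0 a → IsScalarJacobi q 0 1 b → ∀ Y,
        jacobiComp o p Y = b t * jacobiVel o q (D Y) + a t * jacobiComp o q (D Y) := by
  obtain ⟨c, rfl, hc, hflow⟩ := exists_isEntering hq (ht.1.trans ht.2)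
  rw [hflow t (Ioo_subset_Icc_self ht)] at hp
  subst hp
  have hflow' : ∀ t ∈ Ico 0 (exitTime (c 0)), geodesicFlow t (c 0) = c t := fun t ht =>
    hflow t (Ico_subset_Icc_self ht)
  obtain ⟨D, hD, hsurj⟩ := hc.exists_surjective ht
  refine ⟨hc.norm_eq (Ioo_subset_Icc_self ht), hc.interior t ht, ?_, D, hD,
    hc.apply_geodesicField ht hD, hsurj, ?_⟩
  -- The solutions a and b exist because they are realized geometrically: V has initial data (0, 1)
  -- and -T has initial data (1, 0).
  · have hV : boundaryCoord (frameV o (c 0)) = 0 := (mem_tangentInflux.1 (frameV_mem (c 0))).2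
    have hT : boundaryCoord (-frameT o (c 0)) = 0 :=
      (mem_tangentInflux.1 (neg_mem (frameT_mem (c 0)))).2
    have hT1 : jacobiComp o (c 0) (-frameT o (c 0)) = 1 := by
      have h1 := (jacobiComp_smul (o := o) (c 0) (-1) (frameT o (c 0))).trans
        (congrArg (-1 * ·) (jacobiComp_frameT hq))
      refine Eq.trans ?_ (h1.trans (by norm_num))
      exact congrArg (jacobiComp o (c 0)) (neg_one_smul ℝ (frameT o (c 0))).symm
    have hT2 : jacobiVel o (c 0) (-frameT o (c 0)) = 0 := by
      have h1 := (jacobiVel_smul (o := o) (c 0) (-1) (frameT o (c 0))).trans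
        (congrArg (-1 * ·) (jacobiVel_frameT (c 0)))
      refine Eq.trans ?_ (h1.trans (by norm_num))
      exact congrArg (jacobiVel o (c 0)) (neg_one_smul ℝ (frameT o (c 0))).symm
    obtain ⟨b, b', hb0, hb0', hb, -⟩ := hc.exists_jacobi ho hV
    obtain ⟨a, a', ha0, ha0', ha, -⟩ := hc.exists_jacobi ho hT
    exact ⟨a, b, (isScalarJacobi_iff hflow').2 ⟨a', ha0.trans hT1, ha0'.trans hT2, ha⟩,
      (isScalarJacobi_iff hflow').2 ⟨b', hb0.trans (jacobiComp_frameV (c 0)),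
        hb0'.trans (jacobiVel_frameV hq.1), hb⟩⟩
  · intro a b ha hb Y
    obtain ⟨a', ha0, ha0', ha⟩ := (isScalarJacobi_iff hflow').1 ha
    obtain ⟨b', hb0, hb0', hb⟩ := (isScalarJacobi_iff hflow').1 hb
    obtain ⟨j, k, hj0, hk0, hj, hjD⟩ := hc.exists_jacobi ho (hD.boundaryCoord_apply Y)
    have h1 := jacobi_eq_combination (K := fun t => gaussCurvature (c t).1) ha ha0 ha0' hb hb0 hb0'
      hj (Ioo_subset_Ico_self ht)
    rw [hjD t ht D Y hD rfl, h1, hj0, hk0]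
    ring

theorem covector_eq_smul_flat_perp (o : ∀ x : M, Orientation ℝ (TanM x) (Fin 2)) {x : M}
    {v : TanM x} (hv : ‖v‖ = 1) {ξ : Module.Dual ℝ (TanM x)} (h : ξ v = 0) :
    ξ = ξ (perp o x v) • flat (perp o x v) := by
  ext u
  conv_lhs => rw [eq_inner_smul_add o hv u]
  rw [map_add, map_smul, map_smul, h, smul_zero, zero_add]
  exact mul_comm _ _

/-- Testing dF^T η = dπ^T ξ on the geodesic field gives ξ(v) = 0, hence ξ = l (v_⊥)^♭ with l ≠ 0.
Testing it on preimages of arbitrary vectors of T(∂₊SM) then computes η. -/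
theorem comp_subset_jacobiRelation [T2Space M] (hM : NonTrapping M)
    {o : ∀ x : M, Orientation ℝ (TanM x) (Fin 2)} (ho : IsSurfaceOrientation o) :
    SetRel.comp (canonicalPushforward M) (canonicalPullback M) ⊆ jacobiRelation o := by
  rintro ⟨α, β⟩ ⟨m, ⟨p, hF, η, D', hD', hi, hη, hdF, hm⟩, ⟨p', ξ, -, hξ, hm'⟩⟩
  obtain ⟨rfl, rfl⟩ := Prod.mk.inj hm
  obtain ⟨hm'', rfl⟩ := Prod.mk.inj hm'
  obtain ⟨rfl, hηξ⟩ := Sigma.mk.inj hm''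
  replace hηξ := eq_of_heq hηξ
  obtain ⟨T, hT⟩ := reaches_of_baseMap_mem_influx hM p.2 hi hF
  have hTτ := hT.lt_exitTime hM p.2
  have hflow : geodesicFlow T (baseMap p.1) = p.1 := by
    obtain ⟨h0, -, c, hc, hc0, hcT, -⟩ := hT
    exact (geodesicFlow_eq ((isGeodesicFrom_of_le h0.le).2 ⟨hc0, hc⟩)).trans hcT
  obtain ⟨-, -, ⟨a, b, ha, hb⟩, D, hD, hDX, hsurj, hcomp⟩ :=
    exists_isBaseDeriv_geodesicFlow ho hF ⟨hT.1, hTτ⟩ hflow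
  have hDD : ∀ Y : Plane × Plane, Y ∈ tangentSM p.1 → D Y = D' Y := fun Y hY =>
    eqOn_tangentSM p.2 hi hD.hasMFDerivAt_baseMap hdF hY
  have hpair : ∀ (Y : Plane × Plane) (hY : Y ∈ tangentSM p.1),
      η ⟨D Y, hD.mem_tangentInflux_iff.2 hY⟩ = ξ (Y.1 : TanM p.1.1) := by
    intro Y hY
    have h1 := LinearMap.congr_fun hηξ ⟨Y, hY⟩
    have h2 : ξ (dProj p.1 Y) = ξ (Y.1 : TanM p.1.1) := congrArg ξ (dProj_apply p.1 Y)
    refine Eq.trans ?_ (h1.trans h2)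
    exact congrArg η (Subtype.ext (hDD Y hY))
  have hξv : ξ p.1.2 = 0 := by
    refine (hpair (geodesicField p.1) (geodesicField_mem_tangentSM p.1)).symm.trans ?_
    exact (congrArg η (Subtype.ext hDX)).trans (map_zero η)
  have hξ' := covector_eq_smul_flat_perp o p.2 hξv
  obtain ⟨e, he0, he1⟩ := exists_basis_frame o hF
  set l := ξ (perp o p.1.1 p.1.2) with hl
  refine ⟨⟨baseMap p.1, hF⟩, T, l, a, b, e, ⟨hT.1, hTτ⟩, ?_, ha, hb, he0, he1, ?_⟩
  · intro h0
    rw [h0, zero_smul] at hξ'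
    exact hξ hξ'
  · rw [hflow, ← hξ']
    have hη' : η = l • (b T • e.coord 0 - a T • e.coord 1) := by
      refine LinearMap.ext fun Y₀ => ?_
      -- The preimage is found in T(TM); that it lies in T SM, where the two covectors agree,
      -- follows because its image is tangent to ∂₊SM.
      obtain ⟨Y, hY⟩ := hsurj Y₀.1 (mem_tangentInflux.1 Y₀.2).2
      have hYm : Y ∈ tangentSM p.1 := hD.mem_tangentInflux_iff.1 (hY.symm ▸ Y₀.2)
      obtain ⟨h1, h2⟩ := coord_frame hF he0 he1 Y₀
      have h3 : η Y₀ = ξ (Y.1 : TanM p.1.1) :=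
        (congrArg η (Subtype.ext hY.symm)).trans (hpair Y hYm)
      have h4 : ξ (Y.1 : TanM p.1.1) = l * jacobiComp o p.1 Y :=
        LinearMap.congr_fun hξ' (Y.1 : TanM p.1.1)
      have h5 := hcomp a b ha hb Y
      rw [hY] at h5
      have h6 : (l • (b T • e.coord 0 - a T • e.coord 1)) Y₀
          = l * (b T * e.coord 0 Y₀ - a T * e.coord 1 Y₀) := rfl
      rw [h6, h1, h2, h3, h4, h5]
      ring
    rw [hη']

/-- The formula for the normal component of Y in terms of D Y says directly that η ∘ D = ξ ∘ dπ on T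
SM, so p = φ_t(q) is the intermediate point of the composition. -/
theorem jacobiRelation_subset_comp [T2Space M] {o : ∀ x : M, Orientation ℝ (TanM x) (Fin 2)}
    (ho : IsSurfaceOrientation o) :
    jacobiRelation o ⊆ SetRel.comp (canonicalPushforward M) (canonicalPullback M) := by
  rintro _ ⟨⟨q, hq⟩, t, l, a, b, e, ht, hl, ha, hb, he0, he1, rfl⟩
  obtain ⟨p, hp⟩ : ∃ p, geodesicFlow t q = p := ⟨_, rfl⟩
  obtain ⟨hpu, hi, -, D, hD, -, -, hcomp⟩ := exists_isBaseDeriv_geodesicFlow ho hq ht hp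
  simp only at e ht ha hb he0 he1 ⊢
  rw [hp]
  -- Replacing q by F(p) places η in the cotangent space over which the canonical relation is
  -- defined.
  have hF := hD.baseMap_eq
  subst hF
  set ξ : Module.Dual ℝ (TanM p.1) := l • flat (perp o p.1 p.2) with hξ
  set η : Module.Dual ℝ (tangentInflux (baseMap p)) := l • (b t • e.coord 0 - a t • e.coord 1)
    with hη
  have hpair : ∀ (Y : Plane × Plane) (hY : Y ∈ tangentSM p),
      η ⟨D Y, hD.mem_tangentInflux_iff.2 hY⟩ = ξ (Y.1 : TanM p.1) := by
    intro Y hY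
    obtain ⟨h1, h2⟩ := coord_frame hq he0 he1 ⟨D Y, hD.mem_tangentInflux_iff.2 hY⟩
    have h3 : ξ (Y.1 : TanM p.1) = l * jacobiComp o p Y := rfl
    have h6 : η ⟨D Y, hD.mem_tangentInflux_iff.2 hY⟩
        = l * (b t * e.coord 0 ⟨D Y, hD.mem_tangentInflux_iff.2 hY⟩
          - a t * e.coord 1 ⟨D Y, hD.mem_tangentInflux_iff.2 hY⟩) := rfl
    rw [h6, h1, h2, h3, hcomp a b ha hb Y]
    ring
  have hξp : ξ (perp o p.1 p.2) = l := by
    have h1 : ξ (perp o p.1 p.2) = l * inner ℝ (perp o p.1 p.2) (perp o p.1 p.2) := rfl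
    rw [h1, real_inner_self_eq_norm_sq, norm_perp, show ‖p.2‖ = 1 from hpu, one_pow, mul_one]
  have hη0 : η ≠ 0 := by
    intro h0
    -- The horizontal lift of v_⊥ is tangent to SM and pairs with ξ to l, so η takes the nonzero
    -- value l on its image under D.
    have h1 := hpair (horizontalLift p (perp o p.1 p.2)) (horizontalLift_mem_tangentSM p _)
    rw [h0] at h1
    exact hl (hξp.symm.trans h1.symm)
  have hξ0 : ξ ≠ 0 := by
    intro h0
    rw [h0] at hξp
    exact hl hξp.symm
  refine ⟨⟨⟨p, hpu⟩, ξ ∘ₗ dProj p ∘ₗ (tangentSM p).subtype⟩,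
    ⟨⟨p, hpu⟩, hq, η, D, fun Y hY => hD.mem_tangentInflux_iff.2 hY, hi, hη0,
      hD.hasMFDerivAt_baseMap.hasMFDerivWithinAt, ?_⟩, ⟨⟨p, hpu⟩, ξ, hi, hξ0, rfl⟩⟩
  refine congrArg (fun ζ => ((⟨⟨baseMap p, hq⟩, η⟩ : CotInflux M), (⟨⟨p, hpu⟩, ζ⟩ : CotSM M)))
    (LinearMap.ext fun Y => ?_)
  exact (congrArg ξ (dProj_apply p Y.1)).trans (hpair Y.1 Y.2).symm

end
end RiemSurface

theorem mainTheorem1 {M : Type*} [TopologicalSpace M] [T2Space M]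
    [ChartedSpace (EuclideanHalfSpace 2) M] [IsManifold (𝓡∂ 2) ∞ M]
    [RiemannianBundle (fun x : M => TangentSpace (𝓡∂ 2) x)]
    [IsContMDiffRiemannianBundle (𝓡∂ 2) ∞ (EuclideanSpace ℝ (Fin 2))
      (fun x : M => TangentSpace (𝓡∂ 2) x)]
    (hM : NonTrapping M) (hconv : StrictlyConvexBoundary M)
    (o : ∀ x : M, Orientation ℝ (TangentSpace (𝓡∂ 2) x) (Fin 2)) (ho : IsSurfaceOrientation o) :
    SetRel.comp (canonicalPushforward M) (canonicalPullback M) = jacobiRelation o := by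
  exact (comp_subset_jacobiRelation hM ho).antisymm (jacobiRelation_subset_comp ho)
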